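/- A pasture is a commutative monoid $P$ with absorbing element $0\neq 1$ such that $P^\times=P\setminus\{0\}$, together with an involution $a\mapsto -a$ and a set $N_P$ of unordered triples $a+b+c$ of elements of $P$ that is closed under multiplication by elements of $P$ and satisfies $a+b+0\in N_P\iff b=-a$. Morphisms of pastures are the multiplicative maps preserving $0$, $1$ and null sets. The tensor product $P\otimes Q$ of pastures is their coproduct: its underlying monoid is $\{0\}\cup (P^\times\times Q^\times)/\{\pm(1,1)\}$, and its null set consists of all $a\otimes d+b\otimes d+c\otimes d$ with $a+b+c\in N_P$, $d\in Q$, and all $d\otimes a+d\otimes b+d\otimes c$ with $d\in P$, $a+b+c\in N_Q$. Let $M$ be a matroid of rank $r$ on a finite set $E$. For $(J,a,b,c,d)\in E^{r-2}\times E^4$ such that $Jac,Jad,Jbc,Jbd$ are (ordered) bases of $M$, call the tuple non-degenerate if $Jab$ and $Jcd$ are bases too, and degenerate otherwise. The extended Tutte group is the abelian group generated by $-1$ and by symbols $T_I$ for the ordered bases $I\in E^r$ of $M$, with the relations $(-1)^2=1$, $T_{\sigma(I)}=\mathrm{sign}(\sigma)\,T_I$ for permutations $\sigma$, and $T_{Jac}T_{Jbd}=T_{Jad}T_{Jbc}$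 for degenerate $(J,a,b,c,d)$. The inner Tutte group is its subgroup of elements of degree $0$ and multi-degree $0\in\mathbb Z^E$, where $T_I$ has degree $1$ and multi-degree $\sum_{e\in I}\delta_e$. The foundation $F_M$ of $M$ is the pasture whose unit group is the inner Tutte group and whose null set is generated by the terms $$\frac{T_{Jac}T_{Jbd}}{T_{Jad}T_{Jbc}}+\frac{T_{Jab}T_{Jcd}}{T_{Jad}T_{Jcb}}-1$$ for all non-degenerate $(J,a,b,c,d)$. A $P$-representation of $M$ is an alternating function $\Delta:E^r\to P$ with $\Delta(I)\neq 0$ if and only if $I$ is an ordered basis of $M$, such that $$\Delta(Je_1e_2)\Delta(Je_3e_4)-\Delta(Je_1e_3)\Delta(Je_2e_4)+\Delta(Je_1e_4)\Delta(Je_2e_3)\in N_P$$ for all $J\in E^{r-2}$ and $e_1,\dots,e_4\in E$. Two $P$-representations are isomorphic if they differ by a factor in $P^\times$, and $\mathcal X^I_M(P)$ denotes the set of isomorphism classes. **Theorem.** Let $M_1$ and $M_2$ be matroids on finite ground sets. 1. There is an isomorphism of pastures $F_{M_1\oplus M_2}\simeq F_{M_1}\otimes F_{M_2}$. 2. There is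 a bijection $\mathcal X^I_{M_1\oplus M_2}(P)\to\mathcal X^I_{M_1}(P)\times\mathcal X^I_{M_2}(P)$ for every pasture $P$, functorial in $P$, under which the class of every representation $\Delta$ corresponds to a pair of classes of representations $(\Delta_1,\Delta_2)$ with $\Delta(I_1I_2)=\Delta_1(I_1)\Delta_2(I_2)$ for all tuples $I_1,I_2$ of elements of $M_1,M_2$ of lengths the ranks of $M_1,M_2$. -/

import Mathlib

universe u v w

/-! ### Pastures -/

/-- A pasture. A pointed monoid `P` with `Pˣ = P \ {0}` is a commutative group with zero.
The null set, a set of unordered triples `a + b + c`, is the symmetric ternary relation `null`. -/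
class Pasture (P : Type u) extends CommGroupWithZero P, InvolutiveNeg P where
  /-- `null a b c` says that `a + b + c` belongs to the null set. -/
  null : P → P → P → Prop
  null_swap : ∀ a b c, null a b c → null b a c
  null_rotate : ∀ a b c, null a b c → null b c a
  null_mul : ∀ a b c d, null a b c → null (d * a) (d * b) (d * c)
  null_zero : ∀ a b, null a b 0 ↔ b = -a

namespace Pasture

/-- A morphism of pastures: a morphism of pointed monoids that preserves the null set. -/
structure Hom (P : Type u) (Q : Type v) [Pasture P] [Pasture Q] extends P →*₀ Q where
  map_null : ∀ a b c, null a b c → null (toFun a) (toFun b) (toFun c)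

/-- An isomorphism of pastures: a multiplicative bijection that preserves the null set in both
directions. -/
structure Iso (P : Type u) (Q : Type v) [Pasture P] [Pasture Q] extends P ≃* Q where
  map_null_iff : ∀ a b c, null (toFun a) (toFun b) (toFun c) ↔ null a b c

section Basic

variable {P : Type u} [Pasture P]

theorem mul_neg_one' (a : P) : a * (-1) = -a := by
  have h : null (1 : P) (-1) 0 := (null_zero _ _).2 rfl
  have h' := null_mul _ _ _ a h
  rw [mul_one, mul_zero] at h'
  exact (null_zero _ _).1 h'

instance : HasDistribNeg P where
  neg_mul a b := by
    rw [← mul_neg_one' a, ← mul_neg_one' (a * b), mul_assoc, mul_comm (-1) b, mul_assoc]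
  mul_neg a b := by rw [← mul_neg_one' b, ← mul_neg_one' (a * b), mul_assoc]

theorem Hom.map_neg_one {Q : Type v} [Pasture Q] (f : Hom P Q) :
    f.toMonoidWithZeroHom (-1) = -1 := by
  have h := f.map_null _ _ _ ((null_zero (1 : P) (-1)).2 rfl)
  have h1 : f.toFun 1 = 1 := f.map_one'
  have h0 : f.toFun 0 = 0 := f.map_zero'
  rw [h1, h0] at h
  exact (null_zero _ _).1 h

/-- The sign of a permutation as an element of a pasture. -/
def sgn (P : Type u) [Pasture P] {r : ℕ} (σ : Equiv.Perm (Fin r)) : P :=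
  if Equiv.Perm.sign σ = 1 then 1 else -1

end Basic

/-- Negation on `WithZero G` induced by multiplication with an element `ε` of order at most 2. -/
noncomputable abbrev withZeroNeg {G : Type u} [CommGroup G] (ε : G) (hε : ε * ε = 1) :
    InvolutiveNeg (WithZero G) where
  neg x := (ε : WithZero G) * x
  neg_neg x := by
    rw [← mul_assoc, ← WithZero.coe_mul, hε, WithZero.coe_one, one_mul]

/-- The pasture with unit group `G`, with `-1 = ε`, and with null set generated by the terms
`a + b + c` for the triples `(a, b, c)` of units in `S`. It consists of all terms `x - x + 0`
and of all multiples of the given terms. -/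
noncomputable abbrev ofGenerators {G : Type u} [CommGroup G] (ε : G) (hε : ε * ε = 1)
    (S : Set (G × G × G)) : Pasture (WithZero G) :=
  { (inferInstance : CommGroupWithZero (WithZero G)), withZeroNeg ε hε with
    null := fun x y z =>
      (∃ a : WithZero G, ({x, y, z} : Multiset (WithZero G)) = {a, (ε : WithZero G) * a, 0}) ∨
      (∃ (d : G) (s : G × G × G), s ∈ S ∧ ({x, y, z} : Multiset (WithZero G)) =
        {((d * s.1 : G) : WithZero G), ((d * s.2.1 : G) : WithZero G),
          ((d * s.2.2 : G) : WithZero G)})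
    null_swap := by
      intro a b c h
      have e : ({b, a, c} : Multiset (WithZero G)) = {a, b, c} := Multiset.cons_swap _ _ _
      rw [e]
      exact h
    null_rotate := by
      intro a b c h
      have e : ({b, c, a} : Multiset (WithZero G)) = {a, b, c} := by
        change b ::ₘ c ::ₘ a ::ₘ 0 = a ::ₘ b ::ₘ c ::ₘ 0
        rw [Multiset.cons_swap c a, Multiset.cons_swap b a]
      rw [e]
      exact h
    null_mul := by
      intro a b c d h
      have key : ∀ p q r : WithZero G, ({a, b, c} : Multiset (WithZero G)) = {p, q, r} →
          ({d * a, d * b, d * c} : Multiset (WithZero G)) = {d * p, d * q, d * r} := by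
        intro p q r h
        simpa using congrArg (Multiset.map (fun x => d * x)) h
      rcases h with ⟨x, hx⟩ | ⟨g, s, hs, hx⟩
      · refine Or.inl ⟨d * x, ?_⟩
        rw [key _ _ _ hx, mul_zero, mul_left_comm]
      · induction d using WithZero.recZeroCoe with
        | zero => exact Or.inl ⟨0, by simp⟩
        | coe d =>
          refine Or.inr ⟨d * g, s, hs, ?_⟩
          rw [key _ _ _ hx]
          simp only [WithZero.coe_mul, mul_assoc]
    null_zero := by
      intro a b
      have rot : ∀ x y : WithZero G, ({x, y, 0} : Multiset (WithZero G)) = 0 ::ₘ {x, y} := by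
        intro x y
        change x ::ₘ y ::ₘ 0 ::ₘ 0 = 0 ::ₘ x ::ₘ y ::ₘ 0
        rw [Multiset.cons_swap y 0, Multiset.cons_swap x 0]
      have pair : ∀ p q x y : WithZero G, ({p, q} : Multiset (WithZero G)) = {x, y} →
          p = x ∧ q = y ∨ p = y ∧ q = x := by
        intro p q x y h
        have hp : p ∈ ({x, y} : Multiset (WithZero G)) := by
          rw [← h]
          simp
        rw [Multiset.insert_eq_cons, Multiset.mem_cons, Multiset.mem_singleton] at hp
        rcases hp with rfl | rfl
        · exact Or.inl ⟨rfl, by simpa [Multiset.insert_eq_cons] using h⟩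
        · rw [Multiset.pair_comm x] at h
          exact Or.inr ⟨rfl, by simpa [Multiset.insert_eq_cons] using h⟩
      constructor
      · rintro (⟨x, hx⟩ | ⟨g, s, -, hx⟩)
        · rw [rot, rot, Multiset.cons_inj_right] at hx
          replace hx := pair _ _ _ _ hx
          have hεx : (ε : WithZero G) * ((ε : WithZero G) * x) = x := by
            rw [← mul_assoc, ← WithZero.coe_mul, hε, WithZero.coe_one, one_mul]
          change b = (ε : WithZero G) * a
          rcases hx with ⟨rfl, rfl⟩ | ⟨rfl, rfl⟩
          · rfl
          · exact hεx.symm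
        · have h0 : (0 : WithZero G) ∈ ({a, b, 0} : Multiset (WithZero G)) := by simp
          rw [hx] at h0
          simp only [Multiset.insert_eq_cons, Multiset.mem_cons, Multiset.mem_singleton] at h0
          rcases h0 with h0 | h0 | h0 <;> exact absurd h0.symm WithZero.coe_ne_zero
      · rintro rfl
        exact Or.inl ⟨a, rfl⟩ }

/-! ### The tensor product of two pastures -/

section Tensor

variable (P : Type u) (Q : Type v) [Pasture P] [Pasture Q]

/-- The subgroup `{±(1, 1)}` of `Pˣ × Qˣ`. -/
def signSubgroup : Subgroup (Pˣ × Qˣ) := Subgroup.zpowers (-1, -1)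

/-- The underlying set `{0} ∪ (Pˣ × Qˣ) / {±(1, 1)}` of the tensor product. -/
abbrev Tensor : Type (max u v) := WithZero ((Pˣ × Qˣ) ⧸ signSubgroup P Q)

variable {P Q}

open Classical in
/-- The pure tensor `a ⊗ b`, which is `0` if `a = 0` or `b = 0`. -/
noncomputable def tmul (a : P) (b : Q) : Tensor P Q :=
  if h : a ≠ 0 ∧ b ≠ 0 then
    (((Units.mk0 a h.1, Units.mk0 b h.2) : Pˣ × Qˣ) : (Pˣ × Qˣ) ⧸ signSubgroup P Q)
  else 0

theorem tmul_units (a : Pˣ) (b : Qˣ) :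
    tmul (a : P) (b : Q) =
      (((a, b) : Pˣ × Qˣ) : (Pˣ × Qˣ) ⧸ signSubgroup P Q) := by
  simp [tmul]

theorem zero_tmul (b : Q) : tmul (0 : P) b = 0 := by simp [tmul]

theorem tmul_zero (a : P) : tmul a (0 : Q) = 0 := by simp [tmul]

theorem tmul_mul_tmul (a a' : P) (b b' : Q) :
    tmul a b * tmul a' b' = tmul (a * a') (b * b') := by
  by_cases ha : a = 0
  · simp [ha, zero_tmul]
  by_cases ha' : a' = 0
  · simp [ha', zero_tmul]
  by_cases hb : b = 0
  · simp [hb, tmul_zero]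
  by_cases hb' : b' = 0
  · simp [hb', tmul_zero]
  lift a to Pˣ using isUnit_iff_ne_zero.2 ha
  lift a' to Pˣ using isUnit_iff_ne_zero.2 ha'
  lift b to Qˣ using isUnit_iff_ne_zero.2 hb
  lift b' to Qˣ using isUnit_iff_ne_zero.2 hb'
  rw [← Units.val_mul, ← Units.val_mul, tmul_units, tmul_units, tmul_units, ← WithZero.coe_mul]
  rfl

theorem exists_eq_tmul (x : Tensor P Q) : ∃ (a : P) (b : Q), x = tmul a b := by
  induction x using WithZero.recZeroCoe with
  | zero => exact ⟨0, 0, (zero_tmul _).symm⟩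
  | coe x =>
    induction x using QuotientGroup.induction_on with
    | H x => exact ⟨x.1, x.2, (tmul_units x.1 x.2).symm⟩

theorem tmul_eq_zero {a : P} {b : Q} (h : tmul a b = 0) : a = 0 ∨ b = 0 := by
  by_contra! hab
  rw [tmul, dif_pos hab] at h
  exact WithZero.coe_ne_zero h

/-- The element `(-1) ⊗ 1 = 1 ⊗ (-1)`. -/
def tensorNegOne (P : Type u) (Q : Type v) [Pasture P] [Pasture Q] :
    (Pˣ × Qˣ) ⧸ signSubgroup P Q :=
  (((-1, 1) : Pˣ × Qˣ) : (Pˣ × Qˣ) ⧸ signSubgroup P Q)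

theorem tensorNegOne_mul_self : tensorNegOne P Q * tensorNegOne P Q = 1 := by
  rw [tensorNegOne, ← QuotientGroup.mk_mul]
  have e : ((-1, 1) : Pˣ × Qˣ) * (-1, 1) = 1 := by simp
  rw [e]
  exact QuotientGroup.mk_one _

theorem tensorNegOne_mul_tmul (a : P) (b : Q) :
    (tensorNegOne P Q : Tensor P Q) * tmul a b = tmul (-a) b := by
  have h : (tensorNegOne P Q : Tensor P Q) = tmul (-1) 1 := by
    have := tmul_units (-1 : Pˣ) (1 : Qˣ)
    rw [Units.val_neg, Units.val_one, Units.val_one] at this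
    exact this.symm
  rw [h, tmul_mul_tmul, neg_one_mul, one_mul]

theorem neg_tmul_eq_tmul_neg (a : P) (b : Q) : tmul (-a) b = tmul a (-b) := by
  have h : tmul (-1 : P) (1 : Q) = tmul (1 : P) (-1 : Q) := by
    have h1 := tmul_units (-1 : Pˣ) (1 : Qˣ)
    have h2 := tmul_units (1 : Pˣ) (-1 : Qˣ)
    rw [Units.val_neg, Units.val_one, Units.val_one] at h1 h2
    rw [h1, h2]
    congr 1
    rw [QuotientGroup.eq]
    have e : ((-1, 1) : Pˣ × Qˣ)⁻¹ * (1, -1) = (-1, -1) := by simp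
    rw [e]
    exact Subgroup.mem_zpowers _
  have h' := congrArg (fun t => t * tmul a b) h
  simpa [tmul_mul_tmul] using h'

/-- The tensor product `P ⊗ Q` of pastures. -/
noncomputable instance : Pasture (Tensor P Q) :=
  { (inferInstance : CommGroupWithZero (Tensor P Q)),
    withZeroNeg (tensorNegOne P Q) tensorNegOne_mul_self with
    null := fun x y z =>
      (∃ (a b c : P) (d : Q), null a b c ∧ x = tmul a d ∧ y = tmul b d ∧ z = tmul c d) ∨
      (∃ (d : P) (a b c : Q), null a b c ∧ x = tmul d a ∧ y = tmul d b ∧ z = tmul d c)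
    null_swap := by
      rintro x y z (⟨a, b, c, d, h, hx, hy, hz⟩ | ⟨d, a, b, c, h, hx, hy, hz⟩)
      · exact Or.inl ⟨b, a, c, d, null_swap _ _ _ h, hy, hx, hz⟩
      · exact Or.inr ⟨d, b, a, c, null_swap _ _ _ h, hy, hx, hz⟩
    null_rotate := by
      rintro x y z (⟨a, b, c, d, h, hx, hy, hz⟩ | ⟨d, a, b, c, h, hx, hy, hz⟩)
      · exact Or.inl ⟨b, c, a, d, null_rotate _ _ _ h, hy, hz, hx⟩
      · exact Or.inr ⟨d, b, c, a, null_rotate _ _ _ h, hy, hz, hx⟩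
    null_mul := by
      intro x y z t ht
      obtain ⟨p, q, rfl⟩ := exists_eq_tmul t
      rcases ht with ⟨a, b, c, d, h, rfl, rfl, rfl⟩ | ⟨d, a, b, c, h, rfl, rfl, rfl⟩
      · exact Or.inl ⟨p * a, p * b, p * c, q * d, null_mul _ _ _ _ h, tmul_mul_tmul _ _ _ _,
          tmul_mul_tmul _ _ _ _, tmul_mul_tmul _ _ _ _⟩
      · exact Or.inr ⟨p * d, q * a, q * b, q * c, null_mul _ _ _ _ h, tmul_mul_tmul _ _ _ _,
          tmul_mul_tmul _ _ _ _, tmul_mul_tmul _ _ _ _⟩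
    null_zero := by
      intro x y
      change _ ↔ y = (tensorNegOne P Q : Tensor P Q) * x
      constructor
      · rintro (⟨a, b, c, d, h, rfl, rfl, hz⟩ | ⟨d, a, b, c, h, rfl, rfl, hz⟩)
        · rw [tensorNegOne_mul_tmul]
          rcases tmul_eq_zero hz.symm with rfl | rfl
          · rw [(null_zero _ _).1 h]
          · rw [tmul_zero, tmul_zero]
        · rw [tensorNegOne_mul_tmul, neg_tmul_eq_tmul_neg]
          rcases tmul_eq_zero hz.symm with rfl | rfl
          · rw [zero_tmul, zero_tmul]
          · rw [(null_zero _ _).1 h]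
      · rintro rfl
        obtain ⟨a, d, rfl⟩ := exists_eq_tmul x
        exact Or.inl ⟨a, -a, 0, d, (null_zero _ _).2 rfl, rfl, tensorNegOne_mul_tmul _ _,
          (zero_tmul _).symm⟩ }

end Tensor

end Pasture

/-! ### Tuples and ordered bases -/

/-- The tuple `(J, a, b)` in `E ^ r`, for a tuple `J` in `E ^ k`, to be used for `k + 2 = r`. -/
def tupleSnoc₂ {α : Type u} {k : ℕ} (r : ℕ) (J : Fin k → α) (a b : α) : Fin r → α :=
  fun i => if h : (i : ℕ) < k then J ⟨i, h⟩ else if (i : ℕ) = k then a else b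

namespace Matroid

variable {α : Type u} {β : Type v}

/-- The rank of a finite matroid, as a natural number. -/
noncomputable def natRank (M : Matroid α) : ℕ := M.eRank.toNat

/-- A tuple `I` of length the rank of `M` is an ordered basis of `M` if its set of entries is a
basis of `M`. -/
def IsOrderedBasis (M : Matroid α) (I : Fin M.natRank → α) : Prop := M.IsBase (Set.range I)

theorem natRank_eq_ncard {M : Matroid α} {B : Set α} (hB : M.IsBase B) :
    M.natRank = B.ncard := by
  rw [natRank, ← hB.encard_eq_eRank, Set.ncard_def]

theorem natRank_sum (M : Matroid α) (N : Matroid β) [M.Finite] [N.Finite] :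
    (M.sum N).natRank = M.natRank + N.natRank := by
  obtain ⟨B, hB⟩ := M.exists_isBase
  obtain ⟨C, hC⟩ := N.exists_isBase
  have hB' : B.Finite := M.ground_finite.subset hB.subset_ground
  have hC' : C.Finite := N.ground_finite.subset hC.subset_ground
  have h : (M.sum N).IsBase (Sum.inl '' B ∪ Sum.inr '' C) := by
    rw [sum_isBase_iff]
    simpa [Set.preimage_image_eq _ Sum.inl_injective, Set.preimage_image_eq _ Sum.inr_injective]
      using And.intro hB hC
  rw [natRank_eq_ncard h, natRank_eq_ncard hB, natRank_eq_ncard hC, Set.ncard_union_eq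
    Set.disjoint_image_inl_image_inr (hB'.image _) (hC'.image _),
    Set.ncard_image_of_injective _ Sum.inl_injective,
    Set.ncard_image_of_injective _ Sum.inr_injective]

/-- The concatenation of a tuple of elements of `M` with a tuple of elements of `N`, as a tuple of
elements of the direct sum of `M` and `N`. -/
noncomputable def concat (M : Matroid α) (N : Matroid β) [M.Finite] [N.Finite] (I : Fin M.natRank → α)
    (J : Fin N.natRank → β) : Fin (M.sum N).natRank → α ⊕ β :=
  fun i => Fin.append (Sum.inl ∘ I) (Sum.inr ∘ J) (Fin.cast (natRank_sum M N) i)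

/-! ### Representations over pastures -/

open Pasture in
/-- A representation of `M` over the pasture `P`: a weak Grassmann-Plücker function whose support
is the set of bases of `M`. The tuples have entries in `α`; the first axiom says that the function
vanishes unless all entries are in the ground set. -/
structure Representation (M : Matroid α) (P : Type w) [Pasture P] where
  /-- The Grassmann-Plücker function. -/
  toFun : (Fin M.natRank → α) → P
  ne_zero_iff : ∀ I, toFun I ≠ 0 ↔ M.IsOrderedBasis I
  alternating : ∀ (I : Fin M.natRank → α) (σ : Equiv.Perm (Fin M.natRank)),
    toFun (I ∘ σ) = sgn P σ * toFun I
  plucker : ∀ (k : ℕ), k + 2 = M.natRank → ∀ (J : Fin k → α) (e₁ e₂ e₃ e₄ : α),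
    null
      (toFun (tupleSnoc₂ _ J e₁ e₂) * toFun (tupleSnoc₂ _ J e₃ e₄))
      (-(toFun (tupleSnoc₂ _ J e₁ e₃) * toFun (tupleSnoc₂ _ J e₂ e₄)))
      (toFun (tupleSnoc₂ _ J e₁ e₄) * toFun (tupleSnoc₂ _ J e₂ e₃))

namespace Representation

variable {M : Matroid α} {P : Type w} [Pasture P]

/-- Two representations are isomorphic if they differ by a nonzero scalar factor. -/
instance isoSetoid (M : Matroid α) (P : Type w) [Pasture P] : Setoid (Representation M P) where
  r Δ Δ' := ∃ c : P, c ≠ 0 ∧ ∀ I, Δ'.toFun I = c * Δ.toFun I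
  iseqv :=
    { refl := fun Δ => ⟨1, one_ne_zero, fun I => (one_mul _).symm⟩
      symm := fun {Δ Δ'} ⟨c, hc, h⟩ =>
        ⟨c⁻¹, inv_ne_zero hc, fun I => by rw [h, inv_mul_cancel_left₀ hc]⟩
      trans := fun {Δ Δ' Δ''} ⟨c, hc, h⟩ ⟨c', hc', h'⟩ =>
        ⟨c' * c, mul_ne_zero hc' hc, fun I => by rw [h', h, mul_assoc]⟩ }

/-- The push-forward of a representation along a morphism of pastures. -/
def map {Q : Type w} [Pasture Q] (f : Pasture.Hom P Q) (Δ : Representation M P) :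
    Representation M Q where
  toFun I := f.toMonoidWithZeroHom (Δ.toFun I)
  ne_zero_iff I := by rw [← Δ.ne_zero_iff, map_ne_zero]
  alternating I σ := by
    rw [Δ.alternating, map_mul]
    congr 1
    unfold Pasture.sgn
    split_ifs
    · exact map_one _
    · exact f.map_neg_one
  plucker k hk J e₁ e₂ e₃ e₄ := by
    have h := f.map_null _ _ _ (Δ.plucker k hk J e₁ e₂ e₃ e₄)
    have hmul : ∀ x y : P, f.toFun (x * y) = f.toFun x * f.toFun y := f.map_mul'
    have hneg : ∀ x : P, f.toFun (-x) = -f.toFun x := by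
      intro x
      have h1 : f.toFun (-1) = -1 := f.map_neg_one
      rw [← neg_one_mul, hmul, h1, neg_one_mul]
    rw [hneg, hmul, hmul, hmul] at h
    exact h

end Representation

/-- The set of isomorphism classes of representations of `M` over `P`. -/
def IsoClass (M : Matroid α) (P : Type w) [Pasture P] : Type (max u w) :=
  Quotient (Representation.isoSetoid M P)

/-- The isomorphism class of a representation. -/
def Representation.isoClass {M : Matroid α} {P : Type w} [Pasture P] (Δ : Representation M P) :
    IsoClass M P :=
  Quotient.mk _ Δ

/-- The push-forward of isomorphism classes along a morphism of pastures. -/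
def IsoClass.map {M : Matroid α} {P Q : Type w} [Pasture P] [Pasture Q] (f : Pasture.Hom P Q) :
    IsoClass M P → IsoClass M Q :=
  Quotient.map (Representation.map f) (by
    rintro Δ Δ' ⟨c, hc, h⟩
    refine ⟨f.toMonoidWithZeroHom c, (map_ne_zero _).2 hc, fun I => ?_⟩
    change f.toMonoidWithZeroHom (Δ'.toFun I) = _ * f.toMonoidWithZeroHom (Δ.toFun I)
    rw [h, map_mul])

/-! ### The Tutte group and the inner Tutte group -/

/-- The generators of the extended Tutte group: `-1` and `T_I` for every ordered basis `I`. -/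
inductive TutteGen (M : Matroid α) : Type u
  | negOne : TutteGen M
  | basis (I : Fin M.natRank → α) (hI : M.IsOrderedBasis I) : TutteGen M

/-- The free abelian group on the generators of the extended Tutte group. -/
abbrev FreeTutte (M : Matroid α) : Type u := Abelianization (FreeGroup (TutteGen M))

/-- The generator `-1` in the free abelian group. -/
def freeNegOne (M : Matroid α) : FreeTutte M := Abelianization.of (FreeGroup.of TutteGen.negOne)

/-- The generator `T_I` in the free abelian group. -/
def freeT {M : Matroid α} (I : Fin M.natRank → α) (hI : M.IsOrderedBasis I) : FreeTutte M :=
  Abelianization.of (FreeGroup.of (TutteGen.basis I hI))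

/-- The relations of the Tutte group: `(-1)² = 1`, the generators `T_I` are alternating,
and `T_{Jac} T_{Jbd} = T_{Jad} T_{Jbc}` for degenerate tuples `(J, a, b, c, d)`, that is, if
`Jac`, `Jad`, `Jbc`, `Jbd` are bases but `Jab` and `Jcd` are not both bases. -/
inductive TutteRel (M : Matroid α) : FreeTutte M → FreeTutte M → Prop
  | negOne : TutteRel M (freeNegOne M * freeNegOne M) 1
  | even (I : Fin M.natRank → α) (σ : Equiv.Perm (Fin M.natRank))
      (hI : M.IsOrderedBasis I) (hIσ : M.IsOrderedBasis (I ∘ σ))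
      (hσ : Equiv.Perm.sign σ = 1) : TutteRel M (freeT (I ∘ σ) hIσ) (freeT I hI)
  | odd (I : Fin M.natRank → α) (σ : Equiv.Perm (Fin M.natRank))
      (hI : M.IsOrderedBasis I) (hIσ : M.IsOrderedBasis (I ∘ σ))
      (hσ : Equiv.Perm.sign σ = -1) :
      TutteRel M (freeT (I ∘ σ) hIσ) (freeNegOne M * freeT I hI)
  | degenerate (k : ℕ) (hk : k + 2 = M.natRank) (J : Fin k → α) (a b c d : α)
      (hac : M.IsOrderedBasis (tupleSnoc₂ _ J a c)) (had : M.IsOrderedBasis (tupleSnoc₂ _ J a d))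
      (hbc : M.IsOrderedBasis (tupleSnoc₂ _ J b c)) (hbd : M.IsOrderedBasis (tupleSnoc₂ _ J b d))
      (hdeg : ¬ (M.IsOrderedBasis (tupleSnoc₂ _ J a b) ∧
        M.IsOrderedBasis (tupleSnoc₂ _ J c d))) :
      TutteRel M (freeT _ hac * freeT _ hbd) (freeT _ had * freeT _ hbc)

/-- The subgroup generated by the relations of the Tutte group. -/
def tutteRelations (M : Matroid α) : Subgroup (FreeTutte M) :=
  Subgroup.closure {x | ∃ y z, TutteRel M y z ∧ x = y / z}

/-- The extended Tutte group, generated by `-1` and the symbols `T_I`. -/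
abbrev ExtTutteGroup (M : Matroid α) : Type u := FreeTutte M ⧸ tutteRelations M

/-- The element `-1` of the extended Tutte group. -/
def tutteNegOne (M : Matroid α) : ExtTutteGroup M :=
  (freeNegOne M : FreeTutte M ⧸ tutteRelations M)

/-- The element `T_I` of the extended Tutte group. -/
def tutteT {M : Matroid α} (I : Fin M.natRank → α) (hI : M.IsOrderedBasis I) : ExtTutteGroup M :=
  (freeT I hI : FreeTutte M ⧸ tutteRelations M)

/-- The degree and the multi-degree of the generators: those of `-1` are `0`, and `T_I` has
degree `1` and multi-degree `∑_{e ∈ I} δ_e`. -/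
noncomputable def degGen (M : Matroid α) : TutteGen M → Multiplicative (ℤ × (α →₀ ℤ))
  | TutteGen.negOne => 1
  | TutteGen.basis I _ => Multiplicative.ofAdd (1, ∑ i, Finsupp.single (I i) 1)

/-- The degree and the multi-degree on the free abelian group. -/
noncomputable def freeDeg (M : Matroid α) : FreeTutte M →* Multiplicative (ℤ × (α →₀ ℤ)) :=
  Abelianization.lift (FreeGroup.lift (degGen M))

theorem freeDeg_negOne (M : Matroid α) : freeDeg M (freeNegOne M) = 1 := by
  simp [freeDeg, freeNegOne, degGen]

theorem freeDeg_T {M : Matroid α} (I : Fin M.natRank → α) (hI : M.IsOrderedBasis I) :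
    freeDeg M (freeT I hI) = Multiplicative.ofAdd (1, ∑ i, Finsupp.single (I i) 1) := by
  simp [freeDeg, freeT, degGen]

theorem sum_tupleSnoc₂ {k r : ℕ} (hk : k + 2 = r) (J : Fin k → α) (a b : α) :
    ∑ i, Finsupp.single (tupleSnoc₂ r J a b i) (1 : ℤ) =
      (∑ i, Finsupp.single (J i) 1) + Finsupp.single a 1 + Finsupp.single b 1 := by
  subst hk
  rw [Fin.sum_univ_castSucc, Fin.sum_univ_castSucc]
  simp [tupleSnoc₂]

theorem freeDeg_eq_of_rel {M : Matroid α} {x y : FreeTutte M} (h : TutteRel M x y) :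
    freeDeg M x = freeDeg M y := by
  have hperm : ∀ (I : Fin M.natRank → α) (σ : Equiv.Perm (Fin M.natRank)),
      ∑ i, Finsupp.single ((I ∘ σ) i) (1 : ℤ) = ∑ i, Finsupp.single (I i) 1 := fun I σ =>
    Equiv.sum_comp σ (fun i => Finsupp.single (I i) (1 : ℤ))
  cases h with
  | negOne => simp [freeDeg_negOne]
  | even I σ hI hIσ hσ => rw [freeDeg_T, freeDeg_T, hperm]
  | odd I σ hI hIσ hσ => rw [map_mul, freeDeg_negOne, one_mul, freeDeg_T, freeDeg_T, hperm]
  | degenerate k hk J a b c d hac had hbc hbd hdeg =>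
    simp only [map_mul, freeDeg_T, sum_tupleSnoc₂ hk, ← ofAdd_add, Prod.mk_add_mk]
    congr 2
    abel

/-- The degree and the multi-degree on the extended Tutte group. -/
noncomputable def tutteDeg (M : Matroid α) : ExtTutteGroup M →* Multiplicative (ℤ × (α →₀ ℤ)) :=
  QuotientGroup.lift (tutteRelations M) (freeDeg M) (by
    intro x hx
    have hle : tutteRelations M ≤ (freeDeg M).ker := by
      refine (Subgroup.closure_le _).2 ?_
      rintro _ ⟨y, z, h, rfl⟩
      rw [SetLike.mem_coe, MonoidHom.mem_ker, map_div, freeDeg_eq_of_rel h, div_self']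
    exact MonoidHom.mem_ker.1 (hle hx))

/-- The inner Tutte group. The elements of degree zero form the Tutte group, generated by `-1` and
the quotients `T_I / T_J`; the inner Tutte group consists of its elements of multi-degree zero. -/
noncomputable def innerTutteGroup (M : Matroid α) : Subgroup (ExtTutteGroup M) := (tutteDeg M).ker

/-- The element `-1` of the inner Tutte group. -/
noncomputable def innerNegOne (M : Matroid α) : innerTutteGroup M :=
  ⟨tutteNegOne M, MonoidHom.mem_ker.2 (freeDeg_negOne M)⟩

theorem innerNegOne_mul_self (M : Matroid α) : innerNegOne M * innerNegOne M = 1 := by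
  apply Subtype.ext
  change tutteNegOne M * tutteNegOne M = 1
  rw [tutteNegOne, ← QuotientGroup.mk_mul, QuotientGroup.eq_one_iff]
  exact Subgroup.subset_closure ⟨_, _, TutteRel.negOne, (div_one _).symm⟩

/-- The universal cross ratio `(T_{Jac} T_{Jbd}) / (T_{Jad} T_{Jbc})`. -/
noncomputable def crossRatio (M : Matroid α) {k : ℕ} (hk : k + 2 = M.natRank) (J : Fin k → α)
    (a b c d : α)
    (hac : M.IsOrderedBasis (tupleSnoc₂ _ J a c)) (had : M.IsOrderedBasis (tupleSnoc₂ _ J a d))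
    (hbc : M.IsOrderedBasis (tupleSnoc₂ _ J b c)) (hbd : M.IsOrderedBasis (tupleSnoc₂ _ J b d)) :
    innerTutteGroup M :=
  ⟨(tutteT _ hac * tutteT _ hbd) / (tutteT _ had * tutteT _ hbc), by
    have h : ∀ I (hI : M.IsOrderedBasis I), tutteDeg M (tutteT I hI) =
        Multiplicative.ofAdd (1, ∑ i, Finsupp.single (I i) 1) := fun I hI => freeDeg_T I hI
    refine MonoidHom.mem_ker.2 ?_
    rw [map_div, div_eq_one]
    simp only [map_mul, h, sum_tupleSnoc₂ hk, ← ofAdd_add, Prod.mk_add_mk]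
    congr 2
    abel⟩

/-- The terms `[a b; c d]_J + [a c; b d]_J - 1` for all non-degenerate `(J, a, b, c, d)`. -/
def foundationTerms (M : Matroid α) :
    Set (innerTutteGroup M × innerTutteGroup M × innerTutteGroup M) :=
  {s | ∃ (k : ℕ) (hk : k + 2 = M.natRank) (J : Fin k → α) (a b c d : α)
      (hab : M.IsOrderedBasis (tupleSnoc₂ _ J a b)) (hac : M.IsOrderedBasis (tupleSnoc₂ _ J a c))
      (had : M.IsOrderedBasis (tupleSnoc₂ _ J a d)) (hbc : M.IsOrderedBasis (tupleSnoc₂ _ J b c))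
      (hcb : M.IsOrderedBasis (tupleSnoc₂ _ J c b)) (hbd : M.IsOrderedBasis (tupleSnoc₂ _ J b d))
      (hcd : M.IsOrderedBasis (tupleSnoc₂ _ J c d)),
      s = (crossRatio M hk J a b c d hac had hbc hbd, crossRatio M hk J a c b d hab had hcb hcd,
        innerNegOne M)}

/-- The underlying set of the foundation of `M`: the inner Tutte group with a zero added. -/
def Foundation (M : Matroid α) : Type u := WithZero (innerTutteGroup M)

/-- The foundation of `M`: the pasture whose unit group is the inner Tutte group of `M` and whose
null set is generated by the terms `[a b; c d]_J + [a c; b d]_J - 1`. -/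
noncomputable instance (M : Matroid α) : Pasture (Foundation M) :=
  Pasture.ofGenerators (innerNegOne M) (innerNegOne_mul_self M) (foundationTerms M)

end Matroid

/-!
The idea is to replace representations and foundations by one notion, that of a *Tutte function*
of a matroid `M`: a function `f` on the ordered bases of `M`, with values in an abelian group, that
is alternating and satisfies the degenerate three-term relations. Homomorphisms out of the extended
Tutte group are Tutte functions (`IsTutteFun.lift`, `isTutteFun_tutteFun`), and a representation
over a pasture `P` is a Tutte function with values in `Pˣ` whose cross ratios satisfy
`[a b; c d]_J + [a c; b d]_J - 1 ∈ N_P` for all non-degenerate `(J, a, b, c, d)`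
(`IsUnitRepresentation`). That the remaining Plücker relations hold follows from the exchange
property: they never have exactly one nonzero term (`IsUnitRepresentation.null_placeTwo`).

Three facts about a direct sum carry both parts of the theorem.

* Tutte functions `f₁` and `f₂` of the summands, for the same sign character, give a Tutte function
  of the direct sum with `(I₁, I₂) ↦ f₁(I₁) f₂(I₂)` (`IsTutteFun.sumFun`). A degenerate tuple
  `(J, a, b, c, d)` has `a, b, c, d` in one summand, or `a, b` in one and `c, d` in the other; in the
  second case the relation holds by commutativity.
* Conversely, every Tutte function `F` of the direct sum satisfies
  `F(I₁, I₂) F(B₁, B₂) = F(I₁, B₂) F(B₁, I₂)` (`IsTutteFun.map_concat_mul`). If `B₁` and `B₂` arise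
  from `I₁` and `I₂` by one replacement each, this is a degenerate relation. The general case
  follows since ordered bases are connected by such replacements and permutations
  (`eq_of_invariant`).
* If `(J, a, b, c, d)` is non-degenerate, then `a, b, c, d` belong to one summand, so the cross
  ratios of `F` are cross ratios of its restriction to that summand
  (`NonDegenerate.exists_crossRatioFun_eq`).

So representations of a direct sum are exactly the products of representations of the summands,
and the factors are unique up to scalars; this is the second part. For the first part, fix an
ordered basis `(B₁, B₂)`. The Tutte functions `T_{(I, B₂)} / T_{(B₁, B₂)}` and
`T_{(B₁, I)} / T_{(B₁, B₂)}` give homomorphisms from the inner Tutte groups of the summands to that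
of the direct sum. Their product is surjective by the factorization of `T`
(`exists_mem_innerTutteGroup`), and its kernel is `{±(1, 1)}`, as one sees from the homomorphism
`T_{(I₁, I₂)} ↦ (T_{I₁}, T_{I₂})` (`innerInl_mul_innerInr_eq_one_iff`). By the third fact it matches
the generators of the null sets (`mem_foundationTerms_sum_iff`).
-/

/-! ### Tuples with two distinguished entries -/

/-- The tuple obtained from `I` by placing `a` at position `p` and `b` at position `q`. Up to a
permutation of the entries, these are the tuples `(J, a, b)`, but here the two distinguished
positions are arbitrary. -/
def placeTwo {α : Type u} {r : ℕ} (I : Fin r → α) (p q : Fin r) (a b : α) : Fin r → α :=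
  Function.update (Function.update I p a) q b

section Tuples

variable {α : Type u} {r : ℕ}

theorem placeTwo_left (I : Fin r → α) {p q : Fin r} (hpq : p ≠ q) (a b : α) :
    placeTwo I p q a b p = a := by
  simp [placeTwo, hpq]

theorem placeTwo_right (I : Fin r → α) (p q : Fin r) (a b : α) : placeTwo I p q a b q = b := by
  simp [placeTwo]

theorem placeTwo_of_ne (I : Fin r → α) {p q i : Fin r} (hp : i ≠ p) (hq : i ≠ q) (a b : α) :
    placeTwo I p q a b i = I i := by
  simp [placeTwo, hp, hq]

theorem placeTwo_comp (I : Fin r → α) (p q : Fin r) (a b : α) (σ : Equiv.Perm (Fin r)) :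
    placeTwo (I ∘ σ) p q a b = placeTwo I (σ p) (σ q) a b ∘ σ := by
  funext i
  simp [placeTwo, Function.update_apply]

theorem placeTwo_placeTwo (I : Fin r → α) {p q : Fin r} (hpq : p ≠ q) (a b a' b' : α) :
    placeTwo (placeTwo I p q a b) p q a' b' = placeTwo I p q a' b' := by
  funext i
  rcases eq_or_ne i q with rfl | hq
  · simp only [placeTwo_right]
  rcases eq_or_ne i p with rfl | hp
  · simp only [placeTwo_left _ hpq]
  · simp only [placeTwo_of_ne _ hp hq]

theorem placeTwo_swap (I : Fin r → α) {p q : Fin r} (hpq : p ≠ q) (a b : α) :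
    placeTwo I p q b a = placeTwo I p q a b ∘ Equiv.swap p q := by
  funext i
  rcases eq_or_ne i q with rfl | hq
  · simp [placeTwo_right, placeTwo_left _ hpq]
  rcases eq_or_ne i p with rfl | hp
  · simp [placeTwo_right, placeTwo_left _ hpq]
  · simp [placeTwo_of_ne _ hp hq, Equiv.swap_apply_of_ne_of_ne hp hq]

theorem update_placeTwo_left (I : Fin r → α) {p q : Fin r} (hpq : p ≠ q) (a b a' : α) :
    Function.update (placeTwo I p q a b) p a' = placeTwo I p q a' b := by
  rw [placeTwo, Function.update_comm hpq.symm, Function.update_idem]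
  rfl

theorem update_placeTwo_right (I : Fin r → α) (p q : Fin r) (a b b' : α) :
    Function.update (placeTwo I p q a b) q b' = placeTwo I p q a b' := by
  rw [placeTwo, Function.update_idem]
  rfl

/-- The tuples `(J, a, b)` differ only in the last two positions. -/
theorem exists_tupleSnoc₂_eq_placeTwo {k : ℕ} (hk : k + 2 = r) (J : Fin k → α) (x : α) :
    ∃ (I : Fin r → α) (p q : Fin r), p ≠ q ∧ ∀ a b, tupleSnoc₂ r J a b = placeTwo I p q a b := by
  refine ⟨tupleSnoc₂ r J x x, ⟨k, by omega⟩, ⟨k + 1, by omega⟩, by simp, fun a b => ?_⟩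
  funext i
  rcases eq_or_ne i ⟨k + 1, by omega⟩ with rfl | hq
  · simp [placeTwo_right, tupleSnoc₂]
  rcases eq_or_ne i ⟨k, by omega⟩ with rfl | hp
  · rw [placeTwo_left _ (by simp)]
    simp [tupleSnoc₂]
  · rw [placeTwo_of_ne _ hp hq]
    have h : (i : ℕ) < k := by
      have h1 : (i : ℕ) ≠ k + 1 := fun h => hq (Fin.ext h)
      have h2 : (i : ℕ) ≠ k := fun h => hp (Fin.ext h)
      omega
    simp [tupleSnoc₂, h]

/-- A permutation moves any two distinguished positions to the end of the tuple. -/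
theorem exists_placeTwo_comp_eq_tupleSnoc₂ (I : Fin r → α) {p q : Fin r} (hpq : p ≠ q) :
    ∃ (k : ℕ) (_ : k + 2 = r) (J : Fin k → α) (σ : Equiv.Perm (Fin r)),
      ∀ a b, placeTwo I p q a b ∘ σ = tupleSnoc₂ r J a b := by
  obtain ⟨k, hk⟩ : ∃ k, k + 2 = r := ⟨r - 2, by have := p.2; have := q.2; omega⟩
  have hk0 : k < r := by omega
  have hk1 : k + 1 < r := by omega
  -- The second swap corrects the image of the last position without moving `p`, as `p ≠ q`.
  obtain ⟨σ, hσp, hσq⟩ : ∃ σ : Equiv.Perm (Fin r), σ ⟨k, hk0⟩ = p ∧ σ ⟨k + 1, hk1⟩ = q := by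
    refine ⟨Equiv.swap (Equiv.swap ⟨k, hk0⟩ p ⟨k + 1, hk1⟩) q * Equiv.swap ⟨k, hk0⟩ p, ?_, ?_⟩
    · rw [Equiv.Perm.mul_apply, Equiv.swap_apply_left]
      refine Equiv.swap_apply_of_ne_of_ne (fun h => ?_) hpq
      have h' := congrArg (Equiv.swap (⟨k, hk0⟩ : Fin r) p) h
      rw [Equiv.swap_apply_right, Equiv.swap_apply_self] at h'
      simp at h'
    · rw [Equiv.Perm.mul_apply, Equiv.swap_apply_left]
  refine ⟨k, hk, fun i => I (σ ⟨i, by omega⟩), σ, fun a b => ?_⟩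
  funext i
  rw [Function.comp_apply]
  rcases eq_or_ne i ⟨k + 1, hk1⟩ with rfl | hq
  · rw [hσq, placeTwo_right]
    simp [tupleSnoc₂]
  rcases eq_or_ne i ⟨k, hk0⟩ with rfl | hp
  · rw [hσp, placeTwo_left _ hpq]
    simp [tupleSnoc₂]
  · rw [placeTwo_of_ne]
    · have h : (i : ℕ) < k := by
        have h1 : (i : ℕ) ≠ k + 1 := fun h => hq (Fin.ext h)
        have h2 : (i : ℕ) ≠ k := fun h => hp (Fin.ext h)
        omega
      simp [tupleSnoc₂, h]
    · rw [← hσp]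
      exact fun h => hp (σ.injective h)
    · rw [← hσq]
      exact fun h => hq (σ.injective h)

/-- Two injective tuples with the same entries differ by a permutation. -/
theorem exists_perm_of_range_eq {I I' : Fin r → α} (hI : Function.Injective I)
    (hI' : Function.Injective I') (h : Set.range I = Set.range I') :
    ∃ σ : Equiv.Perm (Fin r), I' = I ∘ σ := by
  refine ⟨(Equiv.ofInjective I' hI').trans
    ((Equiv.setCongr h.symm).trans (Equiv.ofInjective I hI).symm), ?_⟩
  funext i
  simp only [Function.comp_apply, Equiv.trans_apply]
  rw [Equiv.apply_ofInjective_symm hI]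
  rfl

theorem range_update_of_injective {I : Fin r → α} (hI : Function.Injective I) (p : Fin r) (a : α) :
    Set.range (Function.update I p a) = insert a (Set.range I \ {I p}) := by
  ext x
  constructor
  · rintro ⟨i, rfl⟩
    rcases eq_or_ne i p with rfl | h
    · simp
    · simp [h, hI.ne h]
  · rintro (rfl | ⟨⟨i, rfl⟩, h⟩)
    · exact ⟨p, by simp⟩
    · refine ⟨i, ?_⟩
      rw [Function.update_of_ne]
      rintro rfl
      exact h rfl

end Tuples

/-! ### Ordered bases -/

namespace Matroid

variable {α : Type u} {β : Type v}

theorem isOrderedBasis_comp_iff {M : Matroid α} {I : Fin M.natRank → α}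
    (σ : Equiv.Perm (Fin M.natRank)) : M.IsOrderedBasis (I ∘ σ) ↔ M.IsOrderedBasis I := by
  rw [IsOrderedBasis, IsOrderedBasis, σ.surjective.range_comp]

theorem IsOrderedBasis.comp {M : Matroid α} {I : Fin M.natRank → α} (hI : M.IsOrderedBasis I)
    (σ : Equiv.Perm (Fin M.natRank)) : M.IsOrderedBasis (I ∘ σ) :=
  (isOrderedBasis_comp_iff σ).2 hI

theorem IsOrderedBasis.injective {M : Matroid α} {I : Fin M.natRank → α}
    (hI : M.IsOrderedBasis I) : Function.Injective I := by
  have h : (Set.range I).ncard = M.natRank := (natRank_eq_ncard hI).symm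
  rw [← Set.image_univ] at h
  refine Set.injOn_univ.1 (Set.injOn_of_ncard_image_eq ?_)
  rw [h]
  simp [Set.ncard_univ]

theorem IsBase.exists_isOrderedBasis {M : Matroid α} [M.Finite] {B : Set α} (hB : M.IsBase B) :
    ∃ I : Fin M.natRank → α, M.IsOrderedBasis I ∧ Set.range I = B := by
  have hfin : B.Finite := M.ground_finite.subset hB.subset_ground
  have : Finite B := hfin
  have hcard : Nat.card B = M.natRank := by rw [natRank_eq_ncard hB, Nat.card_coe_set_eq]
  let e : Fin M.natRank ≃ B := (Finite.equivFinOfCardEq hcard).symm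
  have hr : Set.range (fun i => (e i : α)) = B := by
    change Set.range (Subtype.val ∘ e) = B
    rw [e.surjective.range_comp, Subtype.range_val]
  exact ⟨fun i => e i, by rw [IsOrderedBasis, hr]; exact hB, hr⟩

theorem exists_isOrderedBasis (M : Matroid α) [M.Finite] :
    ∃ I : Fin M.natRank → α, M.IsOrderedBasis I := by
  obtain ⟨B, hB⟩ := M.exists_isBase
  obtain ⟨I, hI, -⟩ := hB.exists_isOrderedBasis
  exact ⟨I, hI⟩

theorem isOrderedBasis_placeTwo_swap {M : Matroid α} (I : Fin M.natRank → α)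
    {p q : Fin M.natRank} (hpq : p ≠ q) (a b : α) :
    M.IsOrderedBasis (placeTwo I p q b a) ↔ M.IsOrderedBasis (placeTwo I p q a b) := by
  rw [placeTwo_swap I hpq, isOrderedBasis_comp_iff]

/-- Any two ordered bases are connected by permutations and by replacements of single entries. -/
theorem eq_of_invariant {M : Matroid α} {X : Type w} (F : (Fin M.natRank → α) → X)
    (hperm : ∀ I (σ : Equiv.Perm (Fin M.natRank)), M.IsOrderedBasis I → F (I ∘ σ) = F I)
    (hupd : ∀ I p a, M.IsOrderedBasis I → M.IsOrderedBasis (Function.update I p a) →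
      F (Function.update I p a) = F I)
    {I I' : Fin M.natRank → α} (hI : M.IsOrderedBasis I) (hI' : M.IsOrderedBasis I') :
    F I = F I' := by
  -- Induction on the number of entries of `I` that are not entries of `I'`: if there is one, basis
  -- exchange replaces it by an entry of `I'`; if there is none, only the order differs.
  induction hn : (Set.range I \ Set.range I').ncard using Nat.strong_induction_on generalizing I
    with
  | _ n ih =>
    by_cases hs : Set.range I ⊆ Set.range I'
    · obtain ⟨σ, rfl⟩ := exists_perm_of_range_eq hI.injective hI'.injective
        (IsBase.eq_of_subset_isBase hI hI' hs)
      exact (hperm I σ hI).symm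
    · obtain ⟨e, ⟨p, rfl⟩, he'⟩ := Set.not_subset.1 hs
      obtain ⟨y, ⟨hy, hyI⟩, hB⟩ := IsBase.exchange_mem hI hI' ⟨p, rfl⟩ he'
      rw [← range_update_of_injective hI.injective] at hB
      have hlt : (Set.range (Function.update I p y) \ Set.range I').ncard < n := by
        rw [← hn]
        refine Set.ncard_lt_ncard ?_ ((Set.finite_range I).sdiff)
        rw [range_update_of_injective hI.injective]
        refine ⟨?_, fun hsub => ?_⟩
        · rintro x ⟨rfl | hx, hx'⟩
          · exact absurd hy hx'
          · exact ⟨hx.1, hx'⟩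
        · rcases (hsub ⟨⟨p, rfl⟩, he'⟩).1 with h | h
          · exact he' (h ▸ hy)
          · exact h.2 rfl
      rw [← hupd I p y hI hB]
      exact ih _ hlt hB rfl

/-- If `Jab` and `Jcd` are bases, then `Jac` or `Jad` is a basis. -/
theorem IsOrderedBasis.exchange_placeTwo {M : Matroid α} {I : Fin M.natRank → α}
    {p q : Fin M.natRank} (hpq : p ≠ q) {a b c d : α}
    (hab : M.IsOrderedBasis (placeTwo I p q a b)) (hcd : M.IsOrderedBasis (placeTwo I p q c d)) :
    M.IsOrderedBasis (placeTwo I p q a c) ∨ M.IsOrderedBasis (placeTwo I p q a d) := by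
  have hmem : ∀ z, z ∈ Set.range (placeTwo I p q c d) →
      z ∉ Set.range (placeTwo I p q a b) → z = c ∨ z = d := by
    rintro _ ⟨i, rfl⟩ h
    rcases eq_or_ne i q with rfl | hq
    · exact Or.inr (placeTwo_right _ _ _ _ _)
    rcases eq_or_ne i p with rfl | hp
    · exact Or.inl (placeTwo_left _ hpq _ _)
    · exact absurd ⟨i, by rw [placeTwo_of_ne I hp hq, placeTwo_of_ne I hp hq]⟩ h
  by_cases hb : b ∈ Set.range (placeTwo I p q c d)
  · obtain ⟨i, hi⟩ := hb
    rcases eq_or_ne i q with rfl | hq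
    · rw [placeTwo_right] at hi
      exact Or.inr (hi ▸ hab)
    rcases eq_or_ne i p with rfl | hp
    · rw [placeTwo_left _ hpq] at hi
      exact Or.inl (hi ▸ hab)
    · rw [placeTwo_of_ne _ hp hq, ← placeTwo_of_ne I hp hq a b] at hi
      exact absurd (hab.injective (hi.trans (placeTwo_right I p q a b).symm)) hq
  · have hb' : b ∈ Set.range (placeTwo I p q a b) := ⟨q, placeTwo_right _ _ _ _ _⟩
    obtain ⟨z, ⟨hz, hz'⟩, hB⟩ := IsBase.exchange_mem hab hcd hb' hb
    have h := range_update_of_injective hab.injective q z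
    rw [placeTwo_right, update_placeTwo_right] at h
    rw [← h] at hB
    rcases hmem z hz hz' with rfl | rfl
    · exact Or.inl hB
    · exact Or.inr hB

/-- If `Jab` and `Jcd` are bases, then so are `Jac` and `Jbd`, or `Jad` and `Jbc`. -/
theorem IsOrderedBasis.exchange_pairs {M : Matroid α} {I : Fin M.natRank → α}
    {p q : Fin M.natRank} (hpq : p ≠ q) {a b c d : α}
    (hab : M.IsOrderedBasis (placeTwo I p q a b)) (hcd : M.IsOrderedBasis (placeTwo I p q c d)) :
    M.IsOrderedBasis (placeTwo I p q a c) ∧ M.IsOrderedBasis (placeTwo I p q b d) ∨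
      M.IsOrderedBasis (placeTwo I p q a d) ∧ M.IsOrderedBasis (placeTwo I p q b c) := by
  have hs := fun x y => isOrderedBasis_placeTwo_swap (M := M) I hpq x y
  have h1 := hab.exchange_placeTwo hpq hcd
  have h2 := ((hs a b).2 hab).exchange_placeTwo hpq hcd
  have h3 := hcd.exchange_placeTwo hpq hab
  have h4 := ((hs c d).2 hcd).exchange_placeTwo hpq hab
  rw [hs a c, hs b c] at h3
  rw [hs a d, hs b d] at h4
  tauto

end Matroid

/-! ### Group-valued functions on ordered bases -/

/-- The sign character of `{±1}` with values in a group in which `-1` is represented by `ε`. -/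
def signChar {G : Type w} [CommGroup G] (ε : G) (hε : ε * ε = 1) : ℤˣ →* G where
  toFun u := if u = 1 then 1 else ε
  map_one' := by simp
  map_mul' u v := by
    rcases Int.units_eq_one_or u with rfl | rfl <;> rcases Int.units_eq_one_or v with rfl | rfl <;>
      simp [hε]

theorem signChar_neg_one {G : Type w} [CommGroup G] (ε : G) (hε : ε * ε = 1) :
    signChar ε hε (-1) = ε := by
  simp [signChar]

theorem map_units_int_mul_self {G : Type w} [CommGroup G] (χ : ℤˣ →* G) (u : ℤˣ) :
    χ u * χ u = 1 := by
  rw [← map_mul, Int.units_mul_self, map_one]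

/-- The cross ratio `(f(Jac) f(Jbd)) / (f(Jad) f(Jbc))` of a group-valued function `f`. -/
def crossRatioFun {α : Type u} {G : Type w} [CommGroup G] {r : ℕ} (f : (Fin r → α) → G)
    (I : Fin r → α) (p q : Fin r) (a b c d : α) : G :=
  (f (placeTwo I p q a c) * f (placeTwo I p q b d)) /
    (f (placeTwo I p q a d) * f (placeTwo I p q b c))

namespace Matroid

variable {α : Type u} {β : Type v}

/-- A group-valued function on the ordered bases of `M` that is alternating, with respect to the
sign character `χ`, and satisfies the degenerate Grassmann-Plücker relations. It is defined on all
tuples, but only its values on ordered bases are meaningful. -/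
structure IsTutteFun (M : Matroid α) {G : Type w} [CommGroup G] (χ : ℤˣ →* G)
    (f : (Fin M.natRank → α) → G) : Prop where
  map_comp : ∀ I (σ : Equiv.Perm (Fin M.natRank)), M.IsOrderedBasis I → f (I ∘ σ) = χ (Equiv.Perm.sign σ) * f I
  degenerate : ∀ I p q, p ≠ q → ∀ a b c d,
    M.IsOrderedBasis (placeTwo I p q a c) → M.IsOrderedBasis (placeTwo I p q a d) →
    M.IsOrderedBasis (placeTwo I p q b c) → M.IsOrderedBasis (placeTwo I p q b d) →
    ¬ (M.IsOrderedBasis (placeTwo I p q a b) ∧ M.IsOrderedBasis (placeTwo I p q c d)) →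
    f (placeTwo I p q a c) * f (placeTwo I p q b d) =
      f (placeTwo I p q a d) * f (placeTwo I p q b c)

/-- The tuple `(J, a, b, c, d)` is non-degenerate: for any two of the four entries, placing them at
the positions `p` and `q` of `I` gives an ordered basis. -/
structure NonDegenerate (M : Matroid α) (I : Fin M.natRank → α) (p q : Fin M.natRank)
    (a b c d : α) : Prop where
  ne : p ≠ q
  ab : M.IsOrderedBasis (placeTwo I p q a b)
  ac : M.IsOrderedBasis (placeTwo I p q a c)
  ad : M.IsOrderedBasis (placeTwo I p q a d)
  bc : M.IsOrderedBasis (placeTwo I p q b c)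
  bd : M.IsOrderedBasis (placeTwo I p q b d)
  cd : M.IsOrderedBasis (placeTwo I p q c d)

namespace NonDegenerate

variable {M : Matroid α} {I : Fin M.natRank → α} {p q : Fin M.natRank} {a b c d : α}

theorem cb (h : M.NonDegenerate I p q a b c d) : M.IsOrderedBasis (placeTwo I p q c b) :=
  (isOrderedBasis_placeTwo_swap I h.ne b c).2 h.bc

theorem swap (h : M.NonDegenerate I p q a b c d) : M.NonDegenerate I p q a c b d :=
  ⟨h.ne, h.ac, h.ab, h.ad, h.cb, h.cd, h.bd⟩

/-- The cross ratio depends on a function only up to a constant factor. -/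
theorem crossRatioFun_eq_of_mul {G : Type w} [CommGroup G] {r' : ℕ} {γ : Type*}
    (h : M.NonDegenerate I p q a b c d) {f : (Fin M.natRank → α) → G} (g : (Fin r' → γ) → G)
    (t : G) (e : α → γ) (I' : Fin r' → γ) (p' q' : Fin r')
    (hfg : ∀ x y, M.IsOrderedBasis (placeTwo I p q x y) →
      g (placeTwo I' p' q' (e x) (e y)) = t * f (placeTwo I p q x y)) :
    crossRatioFun g I' p' q' (e a) (e b) (e c) (e d) = crossRatioFun f I p q a b c d := by
  rw [crossRatioFun, hfg _ _ h.ac, hfg _ _ h.bd, hfg _ _ h.ad, hfg _ _ h.bc, mul_mul_mul_comm,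
    mul_mul_mul_comm t _ t, mul_div_mul_left_eq_div]
  rfl

end NonDegenerate

section Tutte

variable {M : Matroid α} {G : Type w} [CommGroup G] {χ : ℤˣ →* G} {f : (Fin M.natRank → α) → G}

theorem IsTutteFun.map_swap (hf : M.IsTutteFun χ f) {I : Fin M.natRank → α} {p q : Fin M.natRank}
    (hpq : p ≠ q) {a b : α} (h : M.IsOrderedBasis (placeTwo I p q a b)) :
    f (placeTwo I p q b a) = χ (-1) * f (placeTwo I p q a b) := by
  rw [placeTwo_swap I hpq, hf.map_comp _ _ h, Equiv.Perm.sign_swap hpq]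

theorem IsTutteFun.const_mul (hf : M.IsTutteFun χ f) (c : G) :
    M.IsTutteFun χ (fun I => c * f I) where
  map_comp I σ hI := by rw [hf.map_comp I σ hI, mul_left_comm]
  degenerate I p q hpq a b c' d h1 h2 h3 h4 h5 := by
    rw [mul_mul_mul_comm, hf.degenerate I p q hpq a b c' d h1 h2 h3 h4 h5, mul_mul_mul_comm]

theorem IsTutteFun.map {H : Type*} [CommGroup H] (hf : M.IsTutteFun χ f) (g : G →* H) :
    M.IsTutteFun (g.comp χ) (fun I => g (f I)) where
  map_comp I σ hI := by rw [hf.map_comp I σ hI, map_mul]; rfl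
  degenerate I p q hpq a b c d h1 h2 h3 h4 h5 := by
    rw [← map_mul, ← map_mul, hf.degenerate I p q hpq a b c d h1 h2 h3 h4 h5]

/-- The value of a Tutte function on the generators of the extended Tutte group. -/
def tutteGenMap (M : Matroid α) (χ : ℤˣ →* G) (f : (Fin M.natRank → α) → G) : TutteGen M → G
  | TutteGen.negOne => χ (-1)
  | TutteGen.basis I _ => f I

/-- The homomorphism from the extended Tutte group with `-1 ↦ χ(-1)` and `T_I ↦ f(I)`. -/
def IsTutteFun.lift (hf : M.IsTutteFun χ f) : ExtTutteGroup M →* G :=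
  QuotientGroup.lift (tutteRelations M)
    (Abelianization.lift (FreeGroup.lift (tutteGenMap M χ f))) (by
      set φ := Abelianization.lift (FreeGroup.lift (tutteGenMap M χ f)) with hφ
      have hneg : φ (freeNegOne M) = χ (-1) := by simp [hφ, freeNegOne, tutteGenMap]
      have hT : ∀ I (hI : M.IsOrderedBasis I), φ (freeT I hI) = f I := by
        intro I hI
        simp [hφ, freeT, tutteGenMap]
      have hle : tutteRelations M ≤ φ.ker := by
        refine (Subgroup.closure_le _).2 ?_
        rintro _ ⟨y, z, h, rfl⟩
        rw [SetLike.mem_coe, MonoidHom.mem_ker, map_div, div_eq_one]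
        cases h with
        | negOne => rw [map_mul, hneg, map_one, map_units_int_mul_self]
        | even I σ hI hIσ hσ => rw [hT, hT, hf.map_comp I σ hI, hσ, map_one, one_mul]
        | odd I σ hI hIσ hσ => rw [map_mul, hT, hT, hneg, hf.map_comp I σ hI, hσ]
        | degenerate k hk J a b c d hac had hbc hbd hdeg =>
          obtain ⟨I, p, q, hpq, h⟩ := exists_tupleSnoc₂_eq_placeTwo hk J a
          simp only [map_mul, hT]
          simp only [h] at hac had hbc hbd hdeg ⊢
          exact hf.degenerate I p q hpq a b c d hac had hbc hbd hdeg
      intro x hx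
      exact MonoidHom.mem_ker.1 (hle hx))

theorem IsTutteFun.lift_negOne (hf : M.IsTutteFun χ f) : hf.lift (tutteNegOne M) = χ (-1) := by
  simp [lift, tutteNegOne, freeNegOne, tutteGenMap]

theorem IsTutteFun.lift_T (hf : M.IsTutteFun χ f) {I : Fin M.natRank → α}
    (hI : M.IsOrderedBasis I) : hf.lift (tutteT I hI) = f I := by
  simp [lift, tutteT, freeT, tutteGenMap]

/-- The extended Tutte group is generated by `-1` and the elements `T_I`. -/
theorem extTutteGroup_induction {p : ExtTutteGroup M → Prop} (one : p 1)
    (negOne : p (tutteNegOne M)) (T : ∀ I (hI : M.IsOrderedBasis I), p (tutteT I hI))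
    (mul : ∀ x y, p x → p y → p (x * y)) (inv : ∀ x, p x → p x⁻¹) (x : ExtTutteGroup M) :
    p x := by
  induction x using QuotientGroup.induction_on with
  | H x =>
    induction x using QuotientGroup.induction_on with
    | H x =>
      induction x using FreeGroup.induction_on with
      | C1 => exact one
      | of x =>
        cases x with
        | negOne => exact negOne
        | basis I hI => exact T I hI
      | inv_of x hx => exact inv _ hx
      | mul x y hx hy => exact mul _ _ hx hy

theorem extTutteGroup_hom_ext {φ ψ : ExtTutteGroup M →* G}
    (hneg : φ (tutteNegOne M) = ψ (tutteNegOne M))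
    (hT : ∀ I (hI : M.IsOrderedBasis I), φ (tutteT I hI) = ψ (tutteT I hI)) : φ = ψ := by
  refine MonoidHom.ext fun y => ?_
  induction y using extTutteGroup_induction with
  | one => rw [map_one, map_one]
  | negOne => exact hneg
  | T I hI => exact hT I hI
  | mul x y hx hy => rw [map_mul, map_mul, hx, hy]
  | inv x hx => rw [map_inv, map_inv, hx]

end Tutte

section Universal

variable (M : Matroid α)

theorem tutteNegOne_mul_self : tutteNegOne M * tutteNegOne M = 1 :=
  congrArg Subtype.val (innerNegOne_mul_self M)

/-- The sign character of the extended Tutte group. -/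
def tutteSign : ℤˣ →* ExtTutteGroup M := signChar (tutteNegOne M) (tutteNegOne_mul_self M)

theorem tutteSign_neg_one : tutteSign M (-1) = tutteNegOne M := signChar_neg_one _ _

open Classical in
/-- The universal Tutte function `I ↦ T_I`, extended by `1` to tuples that are not ordered
bases. -/
noncomputable def tutteFun (I : Fin M.natRank → α) : ExtTutteGroup M :=
  if h : M.IsOrderedBasis I then tutteT I h else 1

variable {M}

theorem tutteFun_eq {I : Fin M.natRank → α} (h : M.IsOrderedBasis I) :
    tutteFun M I = tutteT I h := dif_pos h

theorem IsTutteFun.lift_tutteFun {G : Type w} [CommGroup G] {χ : ℤˣ →* G}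
    {f : (Fin M.natRank → α) → G} (hf : M.IsTutteFun χ f) {I : Fin M.natRank → α}
    (hI : M.IsOrderedBasis I) : hf.lift (tutteFun M I) = f I := by
  rw [tutteFun_eq hI, hf.lift_T]

theorem mk_eq_of_tutteRel {x y : FreeTutte M} (h : TutteRel M x y) :
    (x : FreeTutte M ⧸ tutteRelations M) = y :=
  QuotientGroup.eq_iff_div_mem.2 (Subgroup.subset_closure ⟨x, y, h, rfl⟩)

variable (M)

theorem isTutteFun_tutteFun : M.IsTutteFun (tutteSign M) (tutteFun M) := by
  have hcomp : ∀ I (σ : Equiv.Perm (Fin M.natRank)), M.IsOrderedBasis I →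
      tutteFun M (I ∘ σ) = tutteSign M (Equiv.Perm.sign σ) * tutteFun M I := by
    intro I σ hI
    rw [tutteFun_eq hI, tutteFun_eq (hI.comp σ)]
    rcases Int.units_eq_one_or (Equiv.Perm.sign σ) with h | h
    · rw [h, map_one, one_mul]
      exact mk_eq_of_tutteRel (TutteRel.even I σ hI (hI.comp σ) h)
    · rw [h, tutteSign_neg_one]
      exact mk_eq_of_tutteRel (TutteRel.odd I σ hI (hI.comp σ) h)
  refine ⟨hcomp, ?_⟩
  intro I p q hpq a b c d hac had hbc hbd hdeg
  obtain ⟨k, hk, J, σ, hJ⟩ := exists_placeTwo_comp_eq_tupleSnoc₂ I hpq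
  set χ := tutteSign M (Equiv.Perm.sign σ) with hχ
  have key : ∀ x y, M.IsOrderedBasis (placeTwo I p q x y) →
      ∃ h : M.IsOrderedBasis (tupleSnoc₂ _ J x y),
        tutteT _ h = χ * tutteFun M (placeTwo I p q x y) := by
    intro x y h
    refine ⟨hJ x y ▸ h.comp σ, ?_⟩
    rw [← tutteFun_eq, ← hJ, hcomp _ _ h]
  obtain ⟨hac', eac⟩ := key a c hac
  obtain ⟨had', ead⟩ := key a d had
  obtain ⟨hbc', ebc⟩ := key b c hbc
  obtain ⟨hbd', ebd⟩ := key b d hbd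
  have hdeg' : ¬ (M.IsOrderedBasis (tupleSnoc₂ _ J a b) ∧
      M.IsOrderedBasis (tupleSnoc₂ _ J c d)) := by
    rwa [← hJ, ← hJ, isOrderedBasis_comp_iff, isOrderedBasis_comp_iff]
  have h : tutteT _ hac' * tutteT _ hbd' = tutteT _ had' * tutteT _ hbc' :=
    mk_eq_of_tutteRel (TutteRel.degenerate k hk J a b c d hac' had' hbc' hbd' hdeg')
  rw [eac, ebd, ead, ebc, mul_mul_mul_comm, mul_mul_mul_comm χ _ χ] at h
  exact mul_left_cancel h

/-- The terms that generate the null set of the foundation, in terms of the universal Tutte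
function. -/
theorem mem_foundationTerms_iff
    (s : innerTutteGroup M × innerTutteGroup M × innerTutteGroup M) :
    s ∈ foundationTerms M ↔ ∃ I p q a b c d, M.NonDegenerate I p q a b c d ∧
      (s.1 : ExtTutteGroup M) = crossRatioFun (tutteFun M) I p q a b c d ∧
      (s.2.1 : ExtTutteGroup M) = crossRatioFun (tutteFun M) I p q a c b d ∧
      s.2.2 = innerNegOne M := by
  constructor
  · rintro ⟨k, hk, J, a, b, c, d, hab, hac, had, hbc, hcb, hbd, hcd, rfl⟩
    obtain ⟨I, p, q, hpq, h⟩ := exists_tupleSnoc₂_eq_placeTwo hk J a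
    have hnd : M.NonDegenerate I p q a b c d := by
      constructor <;> first | exact hpq | (rw [← h]; assumption)
    refine ⟨I, p, q, a, b, c, d, hnd, ?_, ?_, rfl⟩
    · simp only [crossRatio, crossRatioFun, ← h]
      rw [tutteFun_eq hac, tutteFun_eq had, tutteFun_eq hbc, tutteFun_eq hbd]
    · simp only [crossRatio, crossRatioFun, ← h]
      rw [tutteFun_eq hab, tutteFun_eq had, tutteFun_eq hcb, tutteFun_eq hcd]
  · rintro ⟨I, p, q, a, b, c, d, h, h1, h2, h3⟩
    obtain ⟨k, hk, J, σ, hJ⟩ := exists_placeTwo_comp_eq_tupleSnoc₂ I h.ne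
    set χ := tutteSign M (Equiv.Perm.sign σ) with hχ
    have key : ∀ x y, M.IsOrderedBasis (placeTwo I p q x y) →
        ∃ h : M.IsOrderedBasis (tupleSnoc₂ _ J x y),
          tutteT _ h = χ * tutteFun M (placeTwo I p q x y) := by
      intro x y h
      refine ⟨hJ x y ▸ h.comp σ, ?_⟩
      rw [← tutteFun_eq, ← hJ, (isTutteFun_tutteFun M).map_comp _ _ h]
    obtain ⟨hab', eab⟩ := key a b h.ab
    obtain ⟨hac', eac⟩ := key a c h.ac
    obtain ⟨had', ead⟩ := key a d h.ad
    obtain ⟨hbc', ebc⟩ := key b c h.bc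
    obtain ⟨hcb', ecb⟩ := key c b h.cb
    obtain ⟨hbd', ebd⟩ := key b d h.bd
    obtain ⟨hcd', ecd⟩ := key c d h.cd
    refine ⟨k, hk, J, a, b, c, d, hab', hac', had', hbc', hcb', hbd', hcd', ?_⟩
    refine Prod.ext (Subtype.ext ?_) (Prod.ext (Subtype.ext ?_) h3)
    · change (s.1 : ExtTutteGroup M) =
        (tutteT _ hac' * tutteT _ hbd') / (tutteT _ had' * tutteT _ hbc')
      rw [h1, eac, ebd, ead, ebc, mul_mul_mul_comm, mul_mul_mul_comm χ _ χ,
        mul_div_mul_left_eq_div]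
      rfl
    · change (s.2.1 : ExtTutteGroup M) =
        (tutteT _ hab' * tutteT _ hcd') / (tutteT _ had' * tutteT _ hcb')
      rw [h2, eab, ecd, ead, ecb, mul_mul_mul_comm, mul_mul_mul_comm χ _ χ,
        mul_div_mul_left_eq_div]
      rfl

end Universal

end Matroid

/-! ### Ordered bases of a direct sum -/

namespace Matroid

variable {α : Type u} {β : Type v}

section Summand

variable {M₁ : Matroid α} {M₂ : Matroid β}

/-- Replacing an entry of an ordered basis of a direct sum by an element of the other summand does
not give an ordered basis. -/
theorem IsOrderedBasis.isLeft_eq_of_update {T : Fin (M₁.sum M₂).natRank → α ⊕ β}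
    {i : Fin (M₁.sum M₂).natRank} {x : α ⊕ β} (hT : (M₁.sum M₂).IsOrderedBasis T)
    (hx : (M₁.sum M₂).IsOrderedBasis (Function.update T i x)) : x.isLeft = (T i).isLeft := by
  have hx' := hx
  rw [IsOrderedBasis, range_update_of_injective hT.injective, sum_isBase_iff] at hx'
  obtain ⟨h1, h2⟩ := sum_isBase_iff.1 hT
  rcases x with x | x <;> rcases hi : T i with y | y <;> try rfl
  · have hs := hx'.2.eq_of_subset_isBase h2 (by
      rintro z (hz | hz)
      · simp at hz
      · exact hz.1)
    have hy : y ∈ (Sum.inr ⁻¹' Set.range T : Set β) := ⟨i, hi⟩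
    rw [← hs, hi] at hy
    simp at hy
  · have hs := hx'.1.eq_of_subset_isBase h1 (by
      rintro z (hz | hz)
      · simp at hz
      · exact hz.1)
    have hy : y ∈ (Sum.inl ⁻¹' Set.range T : Set α) := ⟨i, hi⟩
    rw [← hs, hi] at hy
    simp at hy

theorem isLeft_left_eq_of_placeTwo {I : Fin (M₁.sum M₂).natRank → α ⊕ β}
    {p q : Fin (M₁.sum M₂).natRank} (hpq : p ≠ q) {a b c : α ⊕ β}
    (hac : (M₁.sum M₂).IsOrderedBasis (placeTwo I p q a c))
    (hbc : (M₁.sum M₂).IsOrderedBasis (placeTwo I p q b c)) : b.isLeft = a.isLeft := by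
  have h := hac.isLeft_eq_of_update (i := p) (x := b) (by rwa [update_placeTwo_left I hpq])
  rwa [placeTwo_left I hpq] at h

theorem isLeft_right_eq_of_placeTwo {I : Fin (M₁.sum M₂).natRank → α ⊕ β}
    {p q : Fin (M₁.sum M₂).natRank} {a b c : α ⊕ β}
    (hab : (M₁.sum M₂).IsOrderedBasis (placeTwo I p q a b))
    (hac : (M₁.sum M₂).IsOrderedBasis (placeTwo I p q a c)) : c.isLeft = b.isLeft := by
  have h := hab.isLeft_eq_of_update (i := q) (x := c) (by rwa [update_placeTwo_right I])
  rwa [placeTwo_right I] at h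

end Summand

section Sum

variable (M₁ : Matroid α) (M₂ : Matroid β) [M₁.Finite] [M₂.Finite]

/-- The positions in a tuple of elements of the direct sum, divided into the first `r(M₁)` and the
last `r(M₂)` ones. -/
noncomputable def sumPos : Fin M₁.natRank ⊕ Fin M₂.natRank ≃ Fin (M₁.sum M₂).natRank :=
  finSumFinEquiv.trans (finCongr (natRank_sum M₁ M₂).symm)

variable {M₁ M₂}

theorem concat_sumPos_inl (I₁ : Fin M₁.natRank → α) (I₂ : Fin M₂.natRank → β)
    (i : Fin M₁.natRank) : concat M₁ M₂ I₁ I₂ (sumPos M₁ M₂ (Sum.inl i)) = Sum.inl (I₁ i) := by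
  simp [concat, sumPos]

theorem concat_sumPos_inr (I₁ : Fin M₁.natRank → α) (I₂ : Fin M₂.natRank → β)
    (i : Fin M₂.natRank) : concat M₁ M₂ I₁ I₂ (sumPos M₁ M₂ (Sum.inr i)) = Sum.inr (I₂ i) := by
  simp [concat, sumPos]

theorem eq_concat_iff {T : Fin (M₁.sum M₂).natRank → α ⊕ β} {I₁ : Fin M₁.natRank → α}
    {I₂ : Fin M₂.natRank → β} :
    T = concat M₁ M₂ I₁ I₂ ↔ (∀ i, T (sumPos M₁ M₂ (Sum.inl i)) = Sum.inl (I₁ i)) ∧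
      ∀ i, T (sumPos M₁ M₂ (Sum.inr i)) = Sum.inr (I₂ i) := by
  constructor
  · rintro rfl
    exact ⟨concat_sumPos_inl _ _, concat_sumPos_inr _ _⟩
  · rintro ⟨h1, h2⟩
    funext i
    obtain ⟨x | x, rfl⟩ := (sumPos M₁ M₂).surjective i
    · rw [h1, concat_sumPos_inl]
    · rw [h2, concat_sumPos_inr]

theorem inl_preimage_range_concat (I₁ : Fin M₁.natRank → α) (I₂ : Fin M₂.natRank → β) :
    Sum.inl ⁻¹' Set.range (concat M₁ M₂ I₁ I₂) = Set.range I₁ := by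
  ext x
  constructor
  · rintro ⟨i, hi⟩
    obtain ⟨y | y, rfl⟩ := (sumPos M₁ M₂).surjective i
    · rw [concat_sumPos_inl] at hi
      exact ⟨y, Sum.inl_injective hi⟩
    · rw [concat_sumPos_inr] at hi
      simp at hi
  · rintro ⟨i, rfl⟩
    exact ⟨_, concat_sumPos_inl _ _ i⟩

theorem inr_preimage_range_concat (I₁ : Fin M₁.natRank → α) (I₂ : Fin M₂.natRank → β) :
    Sum.inr ⁻¹' Set.range (concat M₁ M₂ I₁ I₂) = Set.range I₂ := by
  ext x
  constructor
  · rintro ⟨i, hi⟩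
    obtain ⟨y | y, rfl⟩ := (sumPos M₁ M₂).surjective i
    · rw [concat_sumPos_inl] at hi
      simp at hi
    · rw [concat_sumPos_inr] at hi
      exact ⟨y, Sum.inr_injective hi⟩
  · rintro ⟨i, rfl⟩
    exact ⟨_, concat_sumPos_inr _ _ i⟩

theorem isOrderedBasis_concat_iff {I₁ : Fin M₁.natRank → α} {I₂ : Fin M₂.natRank → β} :
    (M₁.sum M₂).IsOrderedBasis (concat M₁ M₂ I₁ I₂) ↔
      M₁.IsOrderedBasis I₁ ∧ M₂.IsOrderedBasis I₂ := by
  rw [IsOrderedBasis, sum_isBase_iff, inl_preimage_range_concat, inr_preimage_range_concat]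
  rfl

theorem concat_update_left (I₁ : Fin M₁.natRank → α) (I₂ : Fin M₂.natRank → β)
    (p : Fin M₁.natRank) (a : α) :
    concat M₁ M₂ (Function.update I₁ p a) I₂ =
      Function.update (concat M₁ M₂ I₁ I₂) (sumPos M₁ M₂ (Sum.inl p)) (Sum.inl a) := by
  refine (eq_concat_iff.2 ⟨fun i => ?_, fun i => ?_⟩).symm
  · rcases eq_or_ne i p with rfl | h
    · simp
    · rw [Function.update_of_ne (by simpa using h), Function.update_of_ne h, concat_sumPos_inl]
  · rw [Function.update_of_ne (by simp), concat_sumPos_inr]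

theorem concat_update_right (I₁ : Fin M₁.natRank → α) (I₂ : Fin M₂.natRank → β)
    (p : Fin M₂.natRank) (a : β) :
    concat M₁ M₂ I₁ (Function.update I₂ p a) =
      Function.update (concat M₁ M₂ I₁ I₂) (sumPos M₁ M₂ (Sum.inr p)) (Sum.inr a) := by
  refine (eq_concat_iff.2 ⟨fun i => ?_, fun i => ?_⟩).symm
  · rw [Function.update_of_ne (by simp), concat_sumPos_inl]
  · rcases eq_or_ne i p with rfl | h
    · simp
    · rw [Function.update_of_ne (by simpa using h), Function.update_of_ne h, concat_sumPos_inr]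

theorem concat_placeTwo_left (I₁ : Fin M₁.natRank → α) (I₂ : Fin M₂.natRank → β)
    (p q : Fin M₁.natRank) (a b : α) :
    concat M₁ M₂ (placeTwo I₁ p q a b) I₂ = placeTwo (concat M₁ M₂ I₁ I₂)
      (sumPos M₁ M₂ (Sum.inl p)) (sumPos M₁ M₂ (Sum.inl q)) (Sum.inl a) (Sum.inl b) := by
  rw [placeTwo, placeTwo, concat_update_left, concat_update_left]

theorem concat_placeTwo_right (I₁ : Fin M₁.natRank → α) (I₂ : Fin M₂.natRank → β)
    (p q : Fin M₂.natRank) (a b : β) :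
    concat M₁ M₂ I₁ (placeTwo I₂ p q a b) = placeTwo (concat M₁ M₂ I₁ I₂)
      (sumPos M₁ M₂ (Sum.inr p)) (sumPos M₁ M₂ (Sum.inr q)) (Sum.inr a) (Sum.inr b) := by
  rw [placeTwo, placeTwo, concat_update_right, concat_update_right]

theorem concat_update_update (I₁ : Fin M₁.natRank → α) (I₂ : Fin M₂.natRank → β)
    (p : Fin M₁.natRank) (q : Fin M₂.natRank) (a : α) (b : β) :
    concat M₁ M₂ (Function.update I₁ p a) (Function.update I₂ q b) =
      placeTwo (concat M₁ M₂ I₁ I₂) (sumPos M₁ M₂ (Sum.inl p)) (sumPos M₁ M₂ (Sum.inr q))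
        (Sum.inl a) (Sum.inr b) := by
  rw [placeTwo, concat_update_right, concat_update_left]

variable (M₁ M₂) in
/-- The block permutation of the positions of a tuple of elements of the direct sum. -/
noncomputable def sumPerm (σ : Equiv.Perm (Fin M₁.natRank)) (τ : Equiv.Perm (Fin M₂.natRank)) :
    Equiv.Perm (Fin (M₁.sum M₂).natRank) :=
  (sumPos M₁ M₂).permCongr (Equiv.Perm.sumCongr σ τ)

theorem sign_sumPerm (σ : Equiv.Perm (Fin M₁.natRank)) (τ : Equiv.Perm (Fin M₂.natRank)) :
    Equiv.Perm.sign (sumPerm M₁ M₂ σ τ) = Equiv.Perm.sign σ * Equiv.Perm.sign τ := by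
  rw [sumPerm, Equiv.Perm.sign_permCongr, Equiv.Perm.sign_sumCongr]

theorem concat_comp (I₁ : Fin M₁.natRank → α) (I₂ : Fin M₂.natRank → β)
    (σ : Equiv.Perm (Fin M₁.natRank)) (τ : Equiv.Perm (Fin M₂.natRank)) :
    concat M₁ M₂ (I₁ ∘ σ) (I₂ ∘ τ) = concat M₁ M₂ I₁ I₂ ∘ sumPerm M₁ M₂ σ τ := by
  refine (eq_concat_iff.2 ⟨fun i => ?_, fun i => ?_⟩).symm
  · simp [sumPerm, concat_sumPos_inl]
  · simp [sumPerm, concat_sumPos_inr]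

theorem isOrderedBasis_concat {I₁ : Fin M₁.natRank → α} {I₂ : Fin M₂.natRank → β}
    (h₁ : M₁.IsOrderedBasis I₁) (h₂ : M₂.IsOrderedBasis I₂) :
    (M₁.sum M₂).IsOrderedBasis (concat M₁ M₂ I₁ I₂) :=
  isOrderedBasis_concat_iff.2 ⟨h₁, h₂⟩

/-- Every ordered basis of a direct sum can be sorted. -/
theorem IsOrderedBasis.exists_eq_concat_comp {T : Fin (M₁.sum M₂).natRank → α ⊕ β}
    (hT : (M₁.sum M₂).IsOrderedBasis T) :
    ∃ (I₁ : Fin M₁.natRank → α) (I₂ : Fin M₂.natRank → β)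
      (σ : Equiv.Perm (Fin (M₁.sum M₂).natRank)),
      M₁.IsOrderedBasis I₁ ∧ M₂.IsOrderedBasis I₂ ∧ T = concat M₁ M₂ I₁ I₂ ∘ σ := by
  obtain ⟨h1, h2⟩ := sum_isBase_iff.1 hT
  obtain ⟨I₁, hI₁, hr₁⟩ := h1.exists_isOrderedBasis
  obtain ⟨I₂, hI₂, hr₂⟩ := h2.exists_isOrderedBasis
  have hr : Set.range (concat M₁ M₂ I₁ I₂) = Set.range T := by
    rw [← Set.image_preimage_inl_union_image_preimage_inr (Set.range T), ← hr₁, ← hr₂,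
      ← inl_preimage_range_concat I₁ I₂, ← inr_preimage_range_concat I₁ I₂,
      Set.image_preimage_inl_union_image_preimage_inr]
  obtain ⟨σ, hσ⟩ := exists_perm_of_range_eq (isOrderedBasis_concat hI₁ hI₂).injective hT.injective hr
  exact ⟨I₁, I₂, σ, hI₁, hI₂, hσ⟩

/-- Two sortings of the same ordered basis differ by a block permutation. -/
theorem exists_perm_of_concat_comp_eq {I₁ I₁' : Fin M₁.natRank → α} {I₂ I₂' : Fin M₂.natRank → β}
    {σ σ' : Equiv.Perm (Fin (M₁.sum M₂).natRank)} (h₁ : M₁.IsOrderedBasis I₁)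
    (h₂ : M₂.IsOrderedBasis I₂) (h : concat M₁ M₂ I₁ I₂ ∘ σ = concat M₁ M₂ I₁' I₂' ∘ σ') :
    ∃ (τ₁ : Equiv.Perm (Fin M₁.natRank)) (τ₂ : Equiv.Perm (Fin M₂.natRank)),
      I₁' = I₁ ∘ τ₁ ∧ I₂' = I₂ ∘ τ₂ ∧ σ = sumPerm M₁ M₂ τ₁ τ₂ * σ' := by
  have hr : Set.range (concat M₁ M₂ I₁ I₂) = Set.range (concat M₁ M₂ I₁' I₂') := by
    rw [← σ.surjective.range_comp, h, σ'.surjective.range_comp]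
  have hb : (M₁.sum M₂).IsOrderedBasis (concat M₁ M₂ I₁' I₂') := by
    rw [IsOrderedBasis, ← hr]
    exact isOrderedBasis_concat h₁ h₂
  obtain ⟨h₁', h₂'⟩ := isOrderedBasis_concat_iff.1 hb
  obtain ⟨τ₁, rfl⟩ := exists_perm_of_range_eq h₁.injective h₁'.injective (by
    rw [← inl_preimage_range_concat I₁ I₂, hr, inl_preimage_range_concat])
  obtain ⟨τ₂, rfl⟩ := exists_perm_of_range_eq h₂.injective h₂'.injective (by
    rw [← inr_preimage_range_concat I₁ I₂, hr, inr_preimage_range_concat])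
  refine ⟨τ₁, τ₂, rfl, rfl, ?_⟩
  rw [concat_comp] at h
  ext1 i
  exact (isOrderedBasis_concat h₁ h₂).injective (congrFun h i)

/-- Sorting of a tuple with two distinguished entries from the same or from different summands. -/
theorem exists_sort_placeTwo {I : Fin (M₁.sum M₂).natRank → α ⊕ β}
    {p q : Fin (M₁.sum M₂).natRank} (hpq : p ≠ q) {a c : α ⊕ β}
    (hac : (M₁.sum M₂).IsOrderedBasis (placeTwo I p q a c)) :
    ∃ (I₁ : Fin M₁.natRank → α) (I₂ : Fin M₂.natRank → β)
      (σ : Equiv.Perm (Fin (M₁.sum M₂).natRank)), M₁.IsOrderedBasis I₁ ∧ M₂.IsOrderedBasis I₂ ∧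
      ((a.isLeft = true ∧ c.isLeft = true ∧ ∃ p₁ q₁, p₁ ≠ q₁ ∧ ∀ x y,
          placeTwo I p q (Sum.inl x) (Sum.inl y) =
            concat M₁ M₂ (placeTwo I₁ p₁ q₁ x y) I₂ ∘ σ) ∨
        (a.isLeft = true ∧ c.isLeft = false ∧ ∃ p₁ q₂, ∀ x y,
          placeTwo I p q (Sum.inl x) (Sum.inr y) =
            concat M₁ M₂ (Function.update I₁ p₁ x) (Function.update I₂ q₂ y) ∘ σ) ∨
        (a.isLeft = false ∧ c.isLeft = true ∧ ∃ p₂ q₁, ∀ x y,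
          placeTwo I p q (Sum.inr x) (Sum.inl y) =
            concat M₁ M₂ (Function.update I₁ q₁ y) (Function.update I₂ p₂ x) ∘ σ) ∨
        (a.isLeft = false ∧ c.isLeft = false ∧ ∃ p₂ q₂, p₂ ≠ q₂ ∧ ∀ x y,
          placeTwo I p q (Sum.inr x) (Sum.inr y) =
            concat M₁ M₂ I₁ (placeTwo I₂ p₂ q₂ x y) ∘ σ)) := by
  obtain ⟨I₁, I₂, σ, h₁, h₂, h⟩ := hac.exists_eq_concat_comp
  have key : ∀ x y, placeTwo I p q x y =
      placeTwo (concat M₁ M₂ I₁ I₂) (σ p) (σ q) x y ∘ σ := by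
    intro x y
    rw [← placeTwo_comp, ← h, placeTwo_placeTwo I hpq]
  have ha : a = concat M₁ M₂ I₁ I₂ (σ p) := by
    rw [← placeTwo_left I hpq a c, h]
    rfl
  have hc : c = concat M₁ M₂ I₁ I₂ (σ q) := by
    rw [← placeTwo_right I p q a c, h]
    rfl
  refine ⟨I₁, I₂, σ, h₁, h₂, ?_⟩
  have hσ : σ p ≠ σ q := σ.injective.ne hpq
  obtain ⟨p' | p', hp⟩ := (sumPos M₁ M₂).surjective (σ p) <;>
    obtain ⟨q' | q', hq⟩ := (sumPos M₁ M₂).surjective (σ q) <;>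
    simp only [← hp, ← hq, concat_sumPos_inl, concat_sumPos_inr] at ha hc hσ key <;>
    subst ha hc
  · refine Or.inl ⟨rfl, rfl, p', q', fun h => hσ (by rw [h]), fun x y => ?_⟩
    rw [key, concat_placeTwo_left]
  · refine Or.inr (Or.inl ⟨rfl, rfl, p', q', fun x y => ?_⟩)
    rw [key, concat_update_update]
  · refine Or.inr (Or.inr (Or.inl ⟨rfl, rfl, p', q', fun x y => ?_⟩))
    rw [key, concat_update_update, placeTwo, placeTwo, Function.update_comm (by simp)]
  · refine Or.inr (Or.inr (Or.inr ⟨rfl, rfl, p', q', fun h => hσ (by rw [h]), fun x y => ?_⟩))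
    rw [key, concat_placeTwo_right]

/-- A non-degenerate tuple of a direct sum comes from one of the two summands, up to sorting. -/
theorem NonDegenerate.exists_sort {I : Fin (M₁.sum M₂).natRank → α ⊕ β}
    {p q : Fin (M₁.sum M₂).natRank} {a b c d : α ⊕ β}
    (h : (M₁.sum M₂).NonDegenerate I p q a b c d) :
    ∃ (I₁ : Fin M₁.natRank → α) (I₂ : Fin M₂.natRank → β)
      (σ : Equiv.Perm (Fin (M₁.sum M₂).natRank)), M₁.IsOrderedBasis I₁ ∧ M₂.IsOrderedBasis I₂ ∧
      ((∃ p₁ q₁ a₁ b₁ c₁ d₁, a = Sum.inl a₁ ∧ b = Sum.inl b₁ ∧ c = Sum.inl c₁ ∧ d = Sum.inl d₁ ∧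
          M₁.NonDegenerate I₁ p₁ q₁ a₁ b₁ c₁ d₁ ∧ ∀ x y,
          placeTwo I p q (Sum.inl x) (Sum.inl y) =
            concat M₁ M₂ (placeTwo I₁ p₁ q₁ x y) I₂ ∘ σ) ∨
        (∃ p₂ q₂ a₂ b₂ c₂ d₂, a = Sum.inr a₂ ∧ b = Sum.inr b₂ ∧ c = Sum.inr c₂ ∧ d = Sum.inr d₂ ∧
          M₂.NonDegenerate I₂ p₂ q₂ a₂ b₂ c₂ d₂ ∧ ∀ x y,
          placeTwo I p q (Sum.inr x) (Sum.inr y) =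
            concat M₁ M₂ I₁ (placeTwo I₂ p₂ q₂ x y) ∘ σ)) := by
  have hb : b.isLeft = a.isLeft := isLeft_left_eq_of_placeTwo h.ne h.ac h.bc
  have hcb : c.isLeft = b.isLeft := isLeft_right_eq_of_placeTwo h.ab h.ac
  have hdb : d.isLeft = b.isLeft := isLeft_right_eq_of_placeTwo h.ab h.ad
  obtain ⟨I₁, I₂, σ, h₁, h₂, ⟨ha, hc, p₁, q₁, hne, hs⟩ | ⟨ha, hc, -⟩ | ⟨ha, hc, -⟩ |
    ⟨ha, hc, p₁, q₁, hne, hs⟩⟩ := exists_sort_placeTwo h.ne h.ac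
  · refine ⟨I₁, I₂, σ, h₁, h₂, Or.inl ?_⟩
    rw [ha] at hb
    rw [hb] at hdb
    obtain ⟨a, rfl⟩ := Sum.isLeft_iff.1 ha
    obtain ⟨b, rfl⟩ := Sum.isLeft_iff.1 hb
    obtain ⟨c, rfl⟩ := Sum.isLeft_iff.1 hc
    obtain ⟨d, rfl⟩ := Sum.isLeft_iff.1 hdb
    have key : ∀ x y, (M₁.sum M₂).IsOrderedBasis (placeTwo I p q (Sum.inl x) (Sum.inl y)) →
        M₁.IsOrderedBasis (placeTwo I₁ p₁ q₁ x y) := by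
      intro x y hxy
      rw [hs, isOrderedBasis_comp_iff, isOrderedBasis_concat_iff] at hxy
      exact hxy.1
    exact ⟨p₁, q₁, a, b, c, d, rfl, rfl, rfl, rfl, ⟨hne, key _ _ h.ab, key _ _ h.ac,
      key _ _ h.ad, key _ _ h.bc, key _ _ h.bd, key _ _ h.cd⟩, hs⟩
  · simp [ha, hc, hb] at hcb
  · simp [ha, hc, hb] at hcb
  · refine ⟨I₁, I₂, σ, h₁, h₂, Or.inr ?_⟩
    rw [ha] at hb
    rw [hb] at hdb
    obtain ⟨a, rfl⟩ := Sum.isRight_iff.1 (Sum.isLeft_eq_false.1 ha)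
    obtain ⟨b, rfl⟩ := Sum.isRight_iff.1 (Sum.isLeft_eq_false.1 hb)
    obtain ⟨c, rfl⟩ := Sum.isRight_iff.1 (Sum.isLeft_eq_false.1 hc)
    obtain ⟨d, rfl⟩ := Sum.isRight_iff.1 (Sum.isLeft_eq_false.1 hdb)
    have key : ∀ x y, (M₁.sum M₂).IsOrderedBasis (placeTwo I p q (Sum.inr x) (Sum.inr y)) →
        M₂.IsOrderedBasis (placeTwo I₂ p₁ q₁ x y) := by
      intro x y hxy
      rw [hs, isOrderedBasis_comp_iff, isOrderedBasis_concat_iff] at hxy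
      exact hxy.2
    exact ⟨p₁, q₁, a, b, c, d, rfl, rfl, rfl, rfl, ⟨hne, key _ _ h.ab, key _ _ h.ac,
      key _ _ h.ad, key _ _ h.bc, key _ _ h.bd, key _ _ h.cd⟩, hs⟩

theorem NonDegenerate.concat_left {I₁ : Fin M₁.natRank → α} {p q : Fin M₁.natRank}
    {a b c d : α} (h : M₁.NonDegenerate I₁ p q a b c d) {I₂ : Fin M₂.natRank → β}
    (hI₂ : M₂.IsOrderedBasis I₂) :
    (M₁.sum M₂).NonDegenerate (concat M₁ M₂ I₁ I₂) (sumPos M₁ M₂ (Sum.inl p))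
      (sumPos M₁ M₂ (Sum.inl q)) (Sum.inl a) (Sum.inl b) (Sum.inl c) (Sum.inl d) := by
  obtain ⟨h0, h1, h2, h3, h4, h5, h6⟩ := h
  refine ⟨by simpa using h0, ?_, ?_, ?_, ?_, ?_, ?_⟩ <;> rw [← concat_placeTwo_left] <;>
    exact isOrderedBasis_concat ‹_› hI₂

theorem NonDegenerate.concat_right {I₂ : Fin M₂.natRank → β} {p q : Fin M₂.natRank}
    {a b c d : β} (h : M₂.NonDegenerate I₂ p q a b c d) {I₁ : Fin M₁.natRank → α}
    (hI₁ : M₁.IsOrderedBasis I₁) :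
    (M₁.sum M₂).NonDegenerate (concat M₁ M₂ I₁ I₂) (sumPos M₁ M₂ (Sum.inr p))
      (sumPos M₁ M₂ (Sum.inr q)) (Sum.inr a) (Sum.inr b) (Sum.inr c) (Sum.inr d) := by
  obtain ⟨h0, h1, h2, h3, h4, h5, h6⟩ := h
  refine ⟨by simpa using h0, ?_, ?_, ?_, ?_, ?_, ?_⟩ <;> rw [← concat_placeTwo_right] <;>
    exact isOrderedBasis_concat hI₁ ‹_›

end Sum

end Matroid

/-! ### Sums, restrictions and factorization of Tutte functions -/

namespace Matroid

variable {α : Type u} {β : Type v}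

section SumFun

variable {M₁ : Matroid α} {M₂ : Matroid β} [M₁.Finite] [M₂.Finite] {G : Type w} [CommGroup G]
  {χ : ℤˣ →* G} {f₁ : (Fin M₁.natRank → α) → G} {f₂ : (Fin M₂.natRank → β) → G}
  {F : (Fin (M₁.sum M₂).natRank → α ⊕ β) → G}

open Classical in
/-- The alternating function on the ordered bases of the direct sum with
`(I₁, I₂) ↦ f₁(I₁) f₂(I₂)`. It is defined by sorting a given ordered basis, and is `1` on tuples
that are not ordered bases. -/
noncomputable def sumFun (M₁ : Matroid α) (M₂ : Matroid β) [M₁.Finite] [M₂.Finite] (χ : ℤˣ →* G)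
    (f₁ : (Fin M₁.natRank → α) → G) (f₂ : (Fin M₂.natRank → β) → G)
    (T : Fin (M₁.sum M₂).natRank → α ⊕ β) : G :=
  if h : (M₁.sum M₂).IsOrderedBasis T then
    χ (Equiv.Perm.sign h.exists_eq_concat_comp.choose_spec.choose_spec.choose) *
      (f₁ h.exists_eq_concat_comp.choose * f₂ h.exists_eq_concat_comp.choose_spec.choose)
  else 1

theorem sumFun_concat_comp (hf₁ : M₁.IsTutteFun χ f₁) (hf₂ : M₂.IsTutteFun χ f₂)
    {I₁ : Fin M₁.natRank → α} {I₂ : Fin M₂.natRank → β} (h₁ : M₁.IsOrderedBasis I₁)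
    (h₂ : M₂.IsOrderedBasis I₂) (σ : Equiv.Perm (Fin (M₁.sum M₂).natRank)) :
    sumFun M₁ M₂ χ f₁ f₂ (concat M₁ M₂ I₁ I₂ ∘ σ) =
      χ (Equiv.Perm.sign σ) * (f₁ I₁ * f₂ I₂) := by
  have h : (M₁.sum M₂).IsOrderedBasis (concat M₁ M₂ I₁ I₂ ∘ σ) :=
    (isOrderedBasis_concat h₁ h₂).comp σ
  have key : ∀ (J₁ : Fin M₁.natRank → α) (J₂ : Fin M₂.natRank → β)
      (τ : Equiv.Perm (Fin (M₁.sum M₂).natRank)),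
      concat M₁ M₂ I₁ I₂ ∘ σ = concat M₁ M₂ J₁ J₂ ∘ τ →
        χ (Equiv.Perm.sign τ) * (f₁ J₁ * f₂ J₂) = χ (Equiv.Perm.sign σ) * (f₁ I₁ * f₂ I₂) := by
    intro J₁ J₂ τ heq
    obtain ⟨τ₁, τ₂, rfl, rfl, rfl⟩ := exists_perm_of_concat_comp_eq h₁ h₂ heq
    rw [hf₁.map_comp _ _ h₁, hf₂.map_comp _ _ h₂, mul_mul_mul_comm, ← map_mul, ← mul_assoc,
      ← map_mul, ← sign_sumPerm, mul_comm (Equiv.Perm.sign _), ← map_mul]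
  rw [sumFun, dif_pos h]
  exact key _ _ _ h.exists_eq_concat_comp.choose_spec.choose_spec.choose_spec.2.2

theorem sumFun_concat (hf₁ : M₁.IsTutteFun χ f₁) (hf₂ : M₂.IsTutteFun χ f₂)
    {I₁ : Fin M₁.natRank → α} {I₂ : Fin M₂.natRank → β} (h₁ : M₁.IsOrderedBasis I₁)
    (h₂ : M₂.IsOrderedBasis I₂) :
    sumFun M₁ M₂ χ f₁ f₂ (concat M₁ M₂ I₁ I₂) = f₁ I₁ * f₂ I₂ := by
  have h := sumFun_concat_comp hf₁ hf₂ h₁ h₂ 1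
  rwa [map_one, map_one, one_mul, Equiv.Perm.coe_one, Function.comp_id] at h

/-- The degenerate relations of the direct sum are those of the summands, if the four elements
`a, b, c, d` belong to the same summand, and hold automatically otherwise. -/
theorem IsTutteFun.sumFun (hf₁ : M₁.IsTutteFun χ f₁) (hf₂ : M₂.IsTutteFun χ f₂) :
    (M₁.sum M₂).IsTutteFun χ (sumFun M₁ M₂ χ f₁ f₂) where
  map_comp I σ hI := by
    obtain ⟨I₁, I₂, τ, h₁, h₂, rfl⟩ := hI.exists_eq_concat_comp
    rw [Function.comp_assoc, ← Equiv.Perm.coe_mul, sumFun_concat_comp hf₁ hf₂ h₁ h₂,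
      sumFun_concat_comp hf₁ hf₂ h₁ h₂, map_mul, mul_comm (Equiv.Perm.sign τ), map_mul, mul_assoc]
  degenerate I p q hpq a b c d hac had hbc hbd hdeg := by
    have hba : b.isLeft = a.isLeft := isLeft_left_eq_of_placeTwo hpq hac hbc
    have hdc : d.isLeft = c.isLeft := isLeft_right_eq_of_placeTwo hac had
    obtain ⟨I₁, I₂, σ, h₁, h₂, ⟨ha, hc, p', q', hne, hs⟩ | ⟨ha, hc, p', q', hs⟩ |
      ⟨ha, hc, p', q', hs⟩ | ⟨ha, hc, p', q', hne, hs⟩⟩ := exists_sort_placeTwo hpq hac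
    all_goals rw [ha] at hba
    all_goals rw [hc] at hdc
    all_goals
      simp only [Sum.isLeft_eq_false, Sum.isLeft_iff, Sum.isRight_iff] at ha hba hc hdc
      obtain ⟨a, rfl⟩ := ha
      obtain ⟨b, rfl⟩ := hba
      obtain ⟨c, rfl⟩ := hc
      obtain ⟨d, rfl⟩ := hdc
      simp only [hs, isOrderedBasis_comp_iff, isOrderedBasis_concat_iff] at hac had hbc hbd hdeg ⊢
      rw [sumFun_concat_comp hf₁ hf₂ hac.1 hac.2, sumFun_concat_comp hf₁ hf₂ had.1 had.2,
        sumFun_concat_comp hf₁ hf₂ hbc.1 hbc.2, sumFun_concat_comp hf₁ hf₂ hbd.1 hbd.2,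
        mul_mul_mul_comm, mul_mul_mul_comm _ _ (χ _)]
      congr 1
    · rw [mul_mul_mul_comm, hf₁.degenerate I₁ p' q' hne a b c d hac.1 had.1 hbc.1 hbd.1
        fun h => hdeg ⟨⟨h.1, h₂⟩, h.2, h₂⟩, mul_mul_mul_comm]
    · rw [mul_mul_mul_comm, mul_comm (f₂ _) (f₂ _), mul_mul_mul_comm]
    · rw [mul_mul_mul_comm, mul_comm (f₁ _) (f₁ _), mul_mul_mul_comm]
    · rw [mul_mul_mul_comm, hf₂.degenerate I₂ p' q' hne a b c d hac.2 had.2 hbc.2 hbd.2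
        fun h => hdeg ⟨⟨h₁, h.1⟩, h₁, h.2⟩, mul_mul_mul_comm]

theorem IsTutteFun.map_concat_comp_left (hF : (M₁.sum M₂).IsTutteFun χ F)
    {I₁ : Fin M₁.natRank → α} {I₂ : Fin M₂.natRank → β} (h₁ : M₁.IsOrderedBasis I₁)
    (h₂ : M₂.IsOrderedBasis I₂) (σ : Equiv.Perm (Fin M₁.natRank)) :
    F (concat M₁ M₂ (I₁ ∘ σ) I₂) = χ (Equiv.Perm.sign σ) * F (concat M₁ M₂ I₁ I₂) := by
  have h := concat_comp I₁ I₂ σ 1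
  rw [Equiv.Perm.coe_one, Function.comp_id] at h
  rw [h, hF.map_comp _ _ (isOrderedBasis_concat h₁ h₂), sign_sumPerm, map_one, mul_one]

theorem IsTutteFun.map_concat_comp_right (hF : (M₁.sum M₂).IsTutteFun χ F)
    {I₁ : Fin M₁.natRank → α} {I₂ : Fin M₂.natRank → β} (h₁ : M₁.IsOrderedBasis I₁)
    (h₂ : M₂.IsOrderedBasis I₂) (σ : Equiv.Perm (Fin M₂.natRank)) :
    F (concat M₁ M₂ I₁ (I₂ ∘ σ)) = χ (Equiv.Perm.sign σ) * F (concat M₁ M₂ I₁ I₂) := by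
  have h := concat_comp I₁ I₂ 1 σ
  rw [Equiv.Perm.coe_one, Function.comp_id] at h
  rw [h, hF.map_comp _ _ (isOrderedBasis_concat h₁ h₂), sign_sumPerm, map_one, one_mul]

theorem IsTutteFun.restrict_left (hF : (M₁.sum M₂).IsTutteFun χ F) {I₂ : Fin M₂.natRank → β}
    (h₂ : M₂.IsOrderedBasis I₂) : M₁.IsTutteFun χ (fun I₁ => F (concat M₁ M₂ I₁ I₂)) where
  map_comp I₁ σ h₁ := hF.map_concat_comp_left h₁ h₂ σ
  degenerate I p q hpq a b c d hac had hbc hbd hdeg := by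
    simp only [concat_placeTwo_left]
    refine hF.degenerate _ _ _ (by simpa using hpq) _ _ _ _ ?_ ?_ ?_ ?_ ?_ <;>
      simp only [← concat_placeTwo_left, isOrderedBasis_concat_iff] <;> tauto

theorem IsTutteFun.restrict_right (hF : (M₁.sum M₂).IsTutteFun χ F) {I₁ : Fin M₁.natRank → α}
    (h₁ : M₁.IsOrderedBasis I₁) : M₂.IsTutteFun χ (fun I₂ => F (concat M₁ M₂ I₁ I₂)) where
  map_comp I₂ σ h₂ := hF.map_concat_comp_right h₁ h₂ σ
  degenerate I p q hpq a b c d hac had hbc hbd hdeg := by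
    simp only [concat_placeTwo_right]
    refine hF.degenerate _ _ _ (by simpa using hpq) _ _ _ _ ?_ ?_ ?_ ?_ ?_ <;>
      simp only [← concat_placeTwo_right, isOrderedBasis_concat_iff] <;> tauto

/-- If one entry is replaced in each of the two blocks, the four resulting bases give a degenerate
relation, since no basis has too many elements of one summand. -/
theorem IsTutteFun.map_concat_update_mul (hF : (M₁.sum M₂).IsTutteFun χ F)
    {I₁ : Fin M₁.natRank → α} {I₂ : Fin M₂.natRank → β} (h₁ : M₁.IsOrderedBasis I₁)
    (h₂ : M₂.IsOrderedBasis I₂) {p : Fin M₁.natRank} {q : Fin M₂.natRank} {a : α} {b : β}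
    (h₁' : M₁.IsOrderedBasis (Function.update I₁ p a))
    (h₂' : M₂.IsOrderedBasis (Function.update I₂ q b)) :
    F (concat M₁ M₂ I₁ I₂) * F (concat M₁ M₂ (Function.update I₁ p a) (Function.update I₂ q b)) =
      F (concat M₁ M₂ I₁ (Function.update I₂ q b)) *
        F (concat M₁ M₂ (Function.update I₁ p a) I₂) := by
  have key := fun x y => concat_update_update I₁ I₂ p q x y
  have hac := isOrderedBasis_concat h₁ h₂
  have had := isOrderedBasis_concat h₁ h₂'
  have hbc := isOrderedBasis_concat h₁' h₂
  have hbd := isOrderedBasis_concat h₁' h₂'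
  have e₁ := Function.update_eq_self p I₁
  have e₂ := Function.update_eq_self q I₂
  have eac := key (I₁ p) (I₂ q)
  have ead := key (I₁ p) b
  have ebc := key a (I₂ q)
  rw [e₁, e₂] at eac
  rw [e₁] at ead
  rw [e₂] at ebc
  rw [eac] at hac ⊢
  rw [ead] at had ⊢
  rw [ebc] at hbc ⊢
  rw [key] at hbd ⊢
  refine hF.degenerate _ _ _ (by simp) _ _ _ _ hac had hbc hbd fun h => ?_
  have := isLeft_right_eq_of_placeTwo hac h.1
  simp at this

theorem IsTutteFun.map_concat_mul (hF : (M₁.sum M₂).IsTutteFun χ F)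
    {I₁ B₁ : Fin M₁.natRank → α} {I₂ B₂ : Fin M₂.natRank → β} (h₁ : M₁.IsOrderedBasis I₁)
    (h₁' : M₁.IsOrderedBasis B₁) (h₂ : M₂.IsOrderedBasis I₂) (h₂' : M₂.IsOrderedBasis B₂) :
    F (concat M₁ M₂ I₁ I₂) * F (concat M₁ M₂ B₁ B₂) =
      F (concat M₁ M₂ I₁ B₂) * F (concat M₁ M₂ B₁ I₂) := by
  -- For adjacent `I₂` and `I₂'`, the ratio `F(I, I₂) / F(I, I₂')` does not depend on `I`.
  have key : ∀ I₂ q b, M₂.IsOrderedBasis I₂ → M₂.IsOrderedBasis (Function.update I₂ q b) →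
      F (concat M₁ M₂ I₁ I₂) / F (concat M₁ M₂ I₁ (Function.update I₂ q b)) =
        F (concat M₁ M₂ B₁ I₂) / F (concat M₁ M₂ B₁ (Function.update I₂ q b)) := by
    intro I₂ q b h₂ h₂'
    refine eq_of_invariant (fun I => F (concat M₁ M₂ I I₂) /
      F (concat M₁ M₂ I (Function.update I₂ q b))) (fun I σ hI => ?_) (fun I p a hI hI' => ?_) h₁ h₁'
    · simp only [hF.map_concat_comp_left hI h₂, hF.map_concat_comp_left hI h₂',
        mul_div_mul_left_eq_div]
    · have h := hF.map_concat_update_mul hI h₂ hI' h₂'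
      rw [div_eq_div_iff_mul_eq_mul, mul_comm, ← h, mul_comm]
  -- Hence the ratio `F(I₁, I) / F(B₁, I)` does not depend on `I`.
  have h := eq_of_invariant (fun I => F (concat M₁ M₂ I₁ I) / F (concat M₁ M₂ B₁ I))
    (fun I σ hI => ?_) (fun I q b hI hI' => ?_) h₂ h₂'
  · rw [div_eq_div_iff_mul_eq_mul] at h
    exact h
  · simp only [hF.map_concat_comp_right h₁ hI, hF.map_concat_comp_right h₁' hI,
      mul_div_mul_left_eq_div]
  · have h := key I q b hI hI'
    rw [div_eq_div_iff_mul_eq_mul] at h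
    rw [div_eq_div_iff_mul_eq_mul, mul_comm, ← h, mul_comm]

/-- The factorization of a Tutte function of a direct sum, relative to a fixed ordered basis
`(B₁, B₂)`. -/
theorem IsTutteFun.map_concat_eq (hF : (M₁.sum M₂).IsTutteFun χ F)
    {I₁ B₁ : Fin M₁.natRank → α} {I₂ B₂ : Fin M₂.natRank → β} (h₁ : M₁.IsOrderedBasis I₁)
    (h₁' : M₁.IsOrderedBasis B₁) (h₂ : M₂.IsOrderedBasis I₂) (h₂' : M₂.IsOrderedBasis B₂) :
    F (concat M₁ M₂ I₁ I₂) = F (concat M₁ M₂ I₁ B₂) *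
      ((F (concat M₁ M₂ B₁ B₂))⁻¹ * F (concat M₁ M₂ B₁ I₂)) := by
  have h := hF.map_concat_mul h₁ h₁' h₂ h₂'
  rw [← eq_mul_inv_iff_mul_eq] at h
  rw [h, mul_assoc, mul_comm (F (concat M₁ M₂ B₁ I₂))]

end SumFun

end Matroid

/-! ### Representations as unit-valued functions -/

namespace Pasture

variable {P : Type u} [Pasture P]

/-- Null sets consist of unordered triples. -/
theorem null_of_multiset_eq {x y z x' y' z' : P}
    (h : ({x, y, z} : Multiset P) = {x', y', z'}) (hn : null x' y' z') : null x y z := by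
  have pair : ∀ {p q x y : P}, ({p, q} : Multiset P) = {x, y} → p = x ∧ q = y ∨ p = y ∧ q = x := by
    intro p q x y h
    have hp : p ∈ ({x, y} : Multiset P) := by
      rw [← h]
      simp
    rw [Multiset.insert_eq_cons, Multiset.mem_cons, Multiset.mem_singleton] at hp
    rcases hp with rfl | rfl
    · exact Or.inl ⟨rfl, by simpa [Multiset.insert_eq_cons] using h⟩
    · rw [Multiset.pair_comm x] at h
      exact Or.inr ⟨rfl, by simpa [Multiset.insert_eq_cons] using h⟩
  have hswap : ∀ p q r : P, ({p, q, r} : Multiset P) = {q, p, r} := fun p q r =>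
    Multiset.cons_swap _ _ _
  have hrot : ∀ p q r : P, ({p, q, r} : Multiset P) = {r, p, q} := by
    intro p q r
    rw [hswap r p q]
    change p ::ₘ q ::ₘ r ::ₘ 0 = p ::ₘ r ::ₘ q ::ₘ 0
    rw [Multiset.cons_swap q]
  have hx : x ∈ ({x', y', z'} : Multiset P) := by
    rw [← h]
    simp
  simp only [Multiset.insert_eq_cons, Multiset.mem_cons, Multiset.mem_singleton] at hx
  rcases hx with rfl | rfl | rfl
  · rcases pair ((Multiset.cons_inj_right _).1 h) with ⟨rfl, rfl⟩ | ⟨rfl, rfl⟩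
    · exact hn
    · exact null_swap _ _ _ (null_rotate _ _ _ (null_rotate _ _ _ hn))
  · rw [hswap x' x z'] at h
    rcases pair ((Multiset.cons_inj_right _).1 h) with ⟨rfl, rfl⟩ | ⟨rfl, rfl⟩
    · exact null_swap _ _ _ hn
    · exact null_rotate _ _ _ hn
  · rw [hrot x' y' x] at h
    rcases pair ((Multiset.cons_inj_right _).1 h) with ⟨rfl, rfl⟩ | ⟨rfl, rfl⟩
    · exact null_rotate _ _ _ (null_rotate _ _ _ hn)
    · exact null_swap _ _ _ (null_rotate _ _ _ hn)

theorem null_self_neg (a : P) : null a (-a) 0 := (null_zero _ _).2 rfl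

variable (P) in
/-- The sign character with values in the units of a pasture. -/
def unitSign : ℤˣ →* Pˣ := signChar (-1) (by simp)

theorem unitSign_neg_one : unitSign P (-1) = -1 := signChar_neg_one _ _

theorem coe_unitSign_sign {r : ℕ} (σ : Equiv.Perm (Fin r)) :
    (unitSign P (Equiv.Perm.sign σ) : P) = sgn P σ := by
  rw [sgn]
  rcases Int.units_eq_one_or (Equiv.Perm.sign σ) with h | h
  · simp [h]
  · simp [h, unitSign_neg_one]

end Pasture

namespace Matroid

open Pasture

variable {α : Type u} {β : Type v}

/-- The function `f` on ordered bases with values in the units of a pasture defines a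
representation: it is a Tutte function, and `[a b; c d]_J + [a c; b d]_J - 1` is null, for the
cross ratios of `f`, if `(J, a, b, c, d)` is non-degenerate. -/
structure IsUnitRepresentation (M : Matroid α) {P : Type w} [Pasture P]
    (f : (Fin M.natRank → α) → Pˣ) : Prop extends M.IsTutteFun (unitSign P) f where
  null_crossRatio : ∀ I p q a b c d, M.NonDegenerate I p q a b c d →
    null ((crossRatioFun f I p q a b c d : Pˣ) : P) ((crossRatioFun f I p q a c b d : Pˣ) : P) (-1)

section

variable {M : Matroid α} {P : Type w} [Pasture P] {f : (Fin M.natRank → α) → Pˣ}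

/-- Up to a common factor, the non-degenerate three-term relations are the relations between the
two cross ratios. -/
theorem NonDegenerate.null_iff {I : Fin M.natRank → α} {p q : Fin M.natRank} {a b c d : α}
    (h : M.NonDegenerate I p q a b c d) (hf : M.IsTutteFun (unitSign P) f) :
    null ((crossRatioFun f I p q a b c d : Pˣ) : P) ((crossRatioFun f I p q a c b d : Pˣ) : P) (-1) ↔
      null ((f (placeTwo I p q a b) : P) * f (placeTwo I p q c d))
        (-((f (placeTwo I p q a c) : P) * f (placeTwo I p q b d)))
        ((f (placeTwo I p q a d) : P) * f (placeTwo I p q b c)) := by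
  -- Both directions multiply by `-f(Jad) f(Jbc)` or its inverse. The sign of the second term comes
  -- from `f(Jcb) = -f(Jbc)`.
  have hcb : (f (placeTwo I p q c b) : P) = -f (placeTwo I p q b c) := by
    rw [hf.map_swap h.ne h.bc, unitSign_neg_one]
    simp
  rw [crossRatioFun, crossRatioFun]
  simp only [Units.val_div_eq_div_val, Units.val_mul, hcb]
  generalize f (placeTwo I p q a b) = ab
  generalize f (placeTwo I p q a c) = ac
  generalize f (placeTwo I p q a d) = ad
  generalize f (placeTwo I p q b c) = bc
  generalize f (placeTwo I p q b d) = bd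
  generalize f (placeTwo I p q c d) = cd
  have hne : (ad : P) * bc ≠ 0 := mul_ne_zero ad.ne_zero bc.ne_zero
  have hne' : -((ad : P) * bc) ≠ 0 := by simpa using (-(ad * bc)).ne_zero
  have e1 : -((ad : P) * bc) * ((ac * bd) / (ad * bc)) = -(ac * bd) := by
    rw [neg_mul, mul_div_cancel₀ _ hne]
  have e2 : -((ad : P) * bc) * ((ab * cd) / (ad * -bc)) = ab * cd := by
    rw [mul_neg, mul_div_cancel₀ _ hne']
  have e3 : -((ad : P) * bc) * (-1) = ad * bc := by
    rw [mul_neg, mul_one, neg_neg]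
  constructor
  · intro hn
    have h' := null_mul _ _ _ (-((ad : P) * bc)) hn
    rw [e1, e2, e3] at h'
    exact null_swap _ _ _ h'
  · intro hn
    have h' := null_mul _ _ _ (-((ad : P) * bc))⁻¹ (null_swap _ _ _ hn)
    have e1' := (eq_inv_mul_iff_mul_eq₀ hne').2 e1
    have e2' := (eq_inv_mul_iff_mul_eq₀ hne').2 e2
    have e3' := (eq_inv_mul_iff_mul_eq₀ hne').2 e3
    rw [e1', e2', e3']
    exact h'

open Classical in
/-- The extension by zero of a unit-valued function to all tuples. -/
noncomputable def extendZero (M : Matroid α) (f : (Fin M.natRank → α) → Pˣ)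
    (I : Fin M.natRank → α) : P :=
  if M.IsOrderedBasis I then (f I : P) else 0

theorem extendZero_of_isOrderedBasis {I : Fin M.natRank → α} (h : M.IsOrderedBasis I) :
    extendZero M f I = f I := if_pos h

theorem extendZero_of_not {I : Fin M.natRank → α} (h : ¬ M.IsOrderedBasis I) :
    extendZero M f I = 0 := if_neg h

/-- By the exchange property, exactly one of the three terms of a Plücker relation is never
nonzero. If one term vanishes, the relation is a degenerate one. -/
theorem IsUnitRepresentation.null_placeTwo (hf : M.IsUnitRepresentation f)
    (I : Fin M.natRank → α) {p q : Fin M.natRank} (hpq : p ≠ q) (a b c d : α) :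
    null (extendZero M f (placeTwo I p q a b) * extendZero M f (placeTwo I p q c d))
      (-(extendZero M f (placeTwo I p q a c) * extendZero M f (placeTwo I p q b d)))
      (extendZero M f (placeTwo I p q a d) * extendZero M f (placeTwo I p q b c)) := by
  have hs := fun x y => isOrderedBasis_placeTwo_swap (M := M) I hpq x y
  have hfs : ∀ {x y}, M.IsOrderedBasis (placeTwo I p q x y) →
      (f (placeTwo I p q y x) : P) = -f (placeTwo I p q x y) := by
    intro x y h
    rw [hf.map_swap hpq h, unitSign_neg_one]
    simp
  have hz : ∀ {x y z t}, ¬ (M.IsOrderedBasis (placeTwo I p q x y) ∧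
      M.IsOrderedBasis (placeTwo I p q z t)) →
      extendZero M f (placeTwo I p q x y) * extendZero M f (placeTwo I p q z t) = 0 := by
    intro x y z t h
    by_cases hxy : M.IsOrderedBasis (placeTwo I p q x y)
    · rw [extendZero_of_not fun hzt => h ⟨hxy, hzt⟩, mul_zero]
    · rw [extendZero_of_not hxy, zero_mul]
  have hnz : ∀ {x y z t}, (M.IsOrderedBasis (placeTwo I p q x y) ∧
      M.IsOrderedBasis (placeTwo I p q z t)) →
      extendZero M f (placeTwo I p q x y) * extendZero M f (placeTwo I p q z t) =
        f (placeTwo I p q x y) * f (placeTwo I p q z t) := by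
    intro x y z t h
    rw [extendZero_of_isOrderedBasis h.1, extendZero_of_isOrderedBasis h.2]
  have hdeg : ∀ {x y z t}, M.IsOrderedBasis (placeTwo I p q x z) →
      M.IsOrderedBasis (placeTwo I p q x t) → M.IsOrderedBasis (placeTwo I p q y z) →
      M.IsOrderedBasis (placeTwo I p q y t) →
      ¬ (M.IsOrderedBasis (placeTwo I p q x y) ∧ M.IsOrderedBasis (placeTwo I p q z t)) →
      (f (placeTwo I p q x z) : P) * f (placeTwo I p q y t) =
        f (placeTwo I p q x t) * f (placeTwo I p q y z) := by
    intro x y z t h1 h2 h3 h4 h5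
    exact congrArg Units.val (hf.degenerate I p q hpq x y z t h1 h2 h3 h4 h5)
  by_cases hA : M.IsOrderedBasis (placeTwo I p q a b) ∧ M.IsOrderedBasis (placeTwo I p q c d) <;>
  by_cases hB : M.IsOrderedBasis (placeTwo I p q a c) ∧ M.IsOrderedBasis (placeTwo I p q b d) <;>
  by_cases hC : M.IsOrderedBasis (placeTwo I p q a d) ∧ M.IsOrderedBasis (placeTwo I p q b c)
  · have h : M.NonDegenerate I p q a b c d := ⟨hpq, hA.1, hB.1, hC.1, hC.2, hB.2, hA.2⟩
    rw [hnz hA, hnz hB, hnz hC]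
    exact (h.null_iff hf.toIsTutteFun).1 (hf.null_crossRatio _ _ _ _ _ _ _ h)
  · rw [hz hC, hnz hA, hnz hB]
    have e := hdeg hA.1 hB.1 ((hs b d).2 hB.2) ((hs c d).2 hA.2) hC
    rw [hfs hA.2, hfs hB.2, mul_neg, mul_neg, neg_inj] at e
    rw [e]
    exact null_self_neg _
  · rw [hz hB, hnz hA, hnz hC]
    have e := hdeg hA.1 hC.1 ((hs b c).2 hC.2) hA.2 hB
    rw [hfs hC.2, mul_neg] at e
    rw [e, neg_zero]
    exact null_swap _ _ _ (null_rotate _ _ _ (null_rotate _ _ _ (by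
      simpa using null_self_neg (-((f (placeTwo I p q a d) : P) * f (placeTwo I p q b c))))))
  · rcases hA.1.exchange_pairs hpq hA.2 with h | h
    · exact absurd h hB
    · exact absurd h hC
  · rw [hz hA, hnz hB, hnz hC]
    rw [hdeg hB.1 hC.1 hC.2 hB.2 hA]
    exact null_rotate _ _ _ (null_rotate _ _ _ (null_swap _ _ _ (null_self_neg _)))
  · rcases hB.1.exchange_pairs hpq hB.2 with h | h
    · exact absurd h hA
    · exact absurd ⟨h.1, (hs b c).1 h.2⟩ hC
  · rcases hC.1.exchange_pairs hpq hC.2 with h | h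
    · exact absurd ⟨h.1, (hs c d).1 h.2⟩ hA
    · exact absurd ⟨h.1, (hs b d).1 h.2⟩ hB
  · rw [hz hA, hz hB, hz hC, neg_zero]
    simpa using null_self_neg (0 : P)

end

end Matroid

namespace Matroid

open Pasture

variable {α : Type u} {β : Type v}

section

variable {M : Matroid α} {P : Type w} [Pasture P] {f : (Fin M.natRank → α) → Pˣ}

/-- The representation that is given by its values in `Pˣ` on ordered bases. -/
noncomputable def IsUnitRepresentation.toRepresentation (hf : M.IsUnitRepresentation f) :
    Representation M P where
  toFun := extendZero M f
  ne_zero_iff I := by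
    by_cases h : M.IsOrderedBasis I
    · simp [extendZero_of_isOrderedBasis h, h]
    · simp [extendZero_of_not h, h]
  alternating I σ := by
    by_cases h : M.IsOrderedBasis I
    · rw [extendZero_of_isOrderedBasis h, extendZero_of_isOrderedBasis (h.comp σ),
        hf.map_comp I σ h, Units.val_mul, coe_unitSign_sign]
    · rw [extendZero_of_not h, extendZero_of_not (by rwa [isOrderedBasis_comp_iff]), mul_zero]
  plucker k hk J e₁ e₂ e₃ e₄ := by
    obtain ⟨I, p, q, hpq, h⟩ := exists_tupleSnoc₂_eq_placeTwo hk J e₁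
    simp only [h]
    exact hf.null_placeTwo I hpq e₁ e₂ e₃ e₄

theorem IsUnitRepresentation.toRepresentation_toFun (hf : M.IsUnitRepresentation f) :
    hf.toRepresentation.toFun = extendZero M f := rfl

namespace Representation

theorem eq_zero_of_not (Δ : Representation M P) {I : Fin M.natRank → α}
    (h : ¬ M.IsOrderedBasis I) : Δ.toFun I = 0 := by
  by_contra h'
  exact h ((Δ.ne_zero_iff I).1 h')

theorem null_placeTwo (Δ : Representation M P) (I : Fin M.natRank → α) {p q : Fin M.natRank}
    (hpq : p ≠ q) (a b c d : α) :
    null (Δ.toFun (placeTwo I p q a b) * Δ.toFun (placeTwo I p q c d))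
      (-(Δ.toFun (placeTwo I p q a c) * Δ.toFun (placeTwo I p q b d)))
      (Δ.toFun (placeTwo I p q a d) * Δ.toFun (placeTwo I p q b c)) := by
  obtain ⟨k, hk, J, σ, hJ⟩ := exists_placeTwo_comp_eq_tupleSnoc₂ I hpq
  have h := Δ.plucker k hk J a b c d
  have hs : ∀ x y : P, sgn P σ * x * (sgn P σ * y) = x * y := by
    intro x y
    rw [mul_mul_mul_comm, ← coe_unitSign_sign, ← Units.val_mul, map_units_int_mul_self,
      Units.val_one, one_mul]
  simpa only [← hJ, Δ.alternating, hs] using h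

open Classical in
/-- The values of a representation on ordered bases, as units of the pasture. -/
noncomputable def unitFun (Δ : Representation M P) (I : Fin M.natRank → α) : Pˣ :=
  if h : Δ.toFun I ≠ 0 then Units.mk0 _ h else 1

theorem coe_unitFun (Δ : Representation M P) {I : Fin M.natRank → α} (h : M.IsOrderedBasis I) :
    (Δ.unitFun I : P) = Δ.toFun I := by
  rw [unitFun, dif_pos ((Δ.ne_zero_iff I).2 h), Units.val_mk0]

theorem isTutteFun_unitFun (Δ : Representation M P) :
    M.IsTutteFun (unitSign P) Δ.unitFun where
  map_comp I σ h := by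
    apply Units.ext
    rw [Units.val_mul, Δ.coe_unitFun h, Δ.coe_unitFun (h.comp σ), Δ.alternating,
      coe_unitSign_sign]
  degenerate I p q hpq a b c d hac had hbc hbd hdeg := by
    apply Units.ext
    rw [Units.val_mul, Units.val_mul, Δ.coe_unitFun hac, Δ.coe_unitFun had, Δ.coe_unitFun hbc,
      Δ.coe_unitFun hbd]
    have h := Δ.null_placeTwo I hpq a b c d
    have h0 : Δ.toFun (placeTwo I p q a b) * Δ.toFun (placeTwo I p q c d) = 0 := by
      by_contra h'
      exact hdeg ⟨(Δ.ne_zero_iff _).1 (left_ne_zero_of_mul h'),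
        (Δ.ne_zero_iff _).1 (right_ne_zero_of_mul h')⟩
    rw [h0] at h
    rw [(null_zero _ _).1 (null_rotate _ _ _ h), neg_neg]

theorem isUnitRepresentation_unitFun (Δ : Representation M P) :
    M.IsUnitRepresentation Δ.unitFun where
  toIsTutteFun := Δ.isTutteFun_unitFun
  null_crossRatio I p q a b c d h := by
    rw [h.null_iff Δ.isTutteFun_unitFun, Δ.coe_unitFun h.ab, Δ.coe_unitFun h.ac,
      Δ.coe_unitFun h.ad, Δ.coe_unitFun h.bc, Δ.coe_unitFun h.bd, Δ.coe_unitFun h.cd]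
    exact Δ.null_placeTwo I h.ne a b c d

end Representation

end

/-! ### Representations of a direct sum -/

section Sum

variable {M₁ : Matroid α} {M₂ : Matroid β} [M₁.Finite] [M₂.Finite]

section CrossRatio

variable {G : Type w} [CommGroup G]

theorem NonDegenerate.crossRatioFun_concat_left {I₁ : Fin M₁.natRank → α} {p q : Fin M₁.natRank}
    {a b c d : α} (h : M₁.NonDegenerate I₁ p q a b c d) (I₂ : Fin M₂.natRank → β)
    (F : (Fin (M₁.sum M₂).natRank → α ⊕ β) → G) (t : G) :
    crossRatioFun F (concat M₁ M₂ I₁ I₂) (sumPos M₁ M₂ (Sum.inl p)) (sumPos M₁ M₂ (Sum.inl q))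
        (Sum.inl a) (Sum.inl b) (Sum.inl c) (Sum.inl d) =
      crossRatioFun (fun I => t * F (concat M₁ M₂ I I₂)) I₁ p q a b c d := by
  refine h.crossRatioFun_eq_of_mul _ t⁻¹ Sum.inl _ _ _ fun x y _ => ?_
  rw [inv_mul_cancel_left, concat_placeTwo_left]

theorem NonDegenerate.crossRatioFun_concat_right {I₂ : Fin M₂.natRank → β}
    {p q : Fin M₂.natRank} {a b c d : β} (h : M₂.NonDegenerate I₂ p q a b c d)
    (I₁ : Fin M₁.natRank → α) (F : (Fin (M₁.sum M₂).natRank → α ⊕ β) → G) (t : G) :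
    crossRatioFun F (concat M₁ M₂ I₁ I₂) (sumPos M₁ M₂ (Sum.inr p)) (sumPos M₁ M₂ (Sum.inr q))
        (Sum.inr a) (Sum.inr b) (Sum.inr c) (Sum.inr d) =
      crossRatioFun (fun I => t * F (concat M₁ M₂ I₁ I)) I₂ p q a b c d := by
  refine h.crossRatioFun_eq_of_mul _ t⁻¹ Sum.inr _ _ _ fun x y _ => ?_
  rw [inv_mul_cancel_left, concat_placeTwo_right]

/-- A non-degenerate tuple of a direct sum comes from one of the summands, up to sorting. The cross
ratios of a Tutte function of the direct sum are those of its restriction to that summand. -/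
theorem NonDegenerate.exists_crossRatioFun_eq {χ : ℤˣ →* G}
    {F : (Fin (M₁.sum M₂).natRank → α ⊕ β) → G} (hF : (M₁.sum M₂).IsTutteFun χ F)
    {f₁ : (Fin M₁.natRank → α) → G} {f₂ : (Fin M₂.natRank → β) → G} (t : G)
    (hf : ∀ I₁ I₂, M₁.IsOrderedBasis I₁ → M₂.IsOrderedBasis I₂ →
      F (concat M₁ M₂ I₁ I₂) = t * (f₁ I₁ * f₂ I₂))
    {I : Fin (M₁.sum M₂).natRank → α ⊕ β}
    {p q : Fin (M₁.sum M₂).natRank} {a b c d : α ⊕ β}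
    (h : (M₁.sum M₂).NonDegenerate I p q a b c d) :
    (∃ I₁ p₁ q₁ a₁ b₁ c₁ d₁, M₁.NonDegenerate I₁ p₁ q₁ a₁ b₁ c₁ d₁ ∧
      crossRatioFun F I p q a b c d = crossRatioFun f₁ I₁ p₁ q₁ a₁ b₁ c₁ d₁ ∧
      crossRatioFun F I p q a c b d = crossRatioFun f₁ I₁ p₁ q₁ a₁ c₁ b₁ d₁) ∨
    (∃ I₂ p₂ q₂ a₂ b₂ c₂ d₂, M₂.NonDegenerate I₂ p₂ q₂ a₂ b₂ c₂ d₂ ∧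
      crossRatioFun F I p q a b c d = crossRatioFun f₂ I₂ p₂ q₂ a₂ b₂ c₂ d₂ ∧
      crossRatioFun F I p q a c b d = crossRatioFun f₂ I₂ p₂ q₂ a₂ c₂ b₂ d₂) := by
  obtain ⟨I₁, I₂, σ, h₁, h₂, ⟨p', q', a, b, c, d, rfl, rfl, rfl, rfl, h', hs⟩ |
    ⟨p', q', a, b, c, d, rfl, rfl, rfl, rfl, h', hs⟩⟩ := h.exists_sort
  · refine Or.inl ⟨I₁, p', q', a, b, c, d, h', ?_, ?_⟩
    · refine h'.crossRatioFun_eq_of_mul F (χ (Equiv.Perm.sign σ) * (t * f₂ I₂)) Sum.inl I p q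
        fun x y hxy => ?_
      rw [hs, hF.map_comp _ _ (isOrderedBasis_concat hxy h₂), hf _ _ hxy h₂, mul_assoc,
        mul_assoc t, mul_comm (f₂ I₂)]
    · refine h'.swap.crossRatioFun_eq_of_mul F (χ (Equiv.Perm.sign σ) * (t * f₂ I₂)) Sum.inl I p q
        fun x y hxy => ?_
      rw [hs, hF.map_comp _ _ (isOrderedBasis_concat hxy h₂), hf _ _ hxy h₂, mul_assoc,
        mul_assoc t, mul_comm (f₂ I₂)]
  · refine Or.inr ⟨I₂, p', q', a, b, c, d, h', ?_, ?_⟩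
    · refine h'.crossRatioFun_eq_of_mul F (χ (Equiv.Perm.sign σ) * (t * f₁ I₁)) Sum.inr I p q
        fun x y hxy => ?_
      rw [hs, hF.map_comp _ _ (isOrderedBasis_concat h₁ hxy), hf _ _ h₁ hxy, mul_assoc,
        mul_assoc t]
    · refine h'.swap.crossRatioFun_eq_of_mul F (χ (Equiv.Perm.sign σ) * (t * f₁ I₁)) Sum.inr I p q
        fun x y hxy => ?_
      rw [hs, hF.map_comp _ _ (isOrderedBasis_concat h₁ hxy), hf _ _ h₁ hxy, mul_assoc,
        mul_assoc t]

end CrossRatio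

variable {P : Type w} [Pasture P]

theorem IsUnitRepresentation.sumFun {f₁ : (Fin M₁.natRank → α) → Pˣ}
    {f₂ : (Fin M₂.natRank → β) → Pˣ} (hf₁ : M₁.IsUnitRepresentation f₁)
    (hf₂ : M₂.IsUnitRepresentation f₂) :
    (M₁.sum M₂).IsUnitRepresentation (sumFun M₁ M₂ (unitSign P) f₁ f₂) where
  toIsTutteFun := hf₁.toIsTutteFun.sumFun hf₂.toIsTutteFun
  null_crossRatio I p q a b c d h := by
    obtain ⟨I', p', q', a', b', c', d', h', e1, e2⟩ | ⟨I', p', q', a', b', c', d', h', e1, e2⟩ :=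
      h.exists_crossRatioFun_eq (hf₁.toIsTutteFun.sumFun hf₂.toIsTutteFun) 1 fun _ _ h₁ h₂ => by
        rw [one_mul, sumFun_concat hf₁.toIsTutteFun hf₂.toIsTutteFun h₁ h₂]
    · rw [e1, e2]
      exact hf₁.null_crossRatio _ _ _ _ _ _ _ h'
    · rw [e1, e2]
      exact hf₂.null_crossRatio _ _ _ _ _ _ _ h'

theorem IsUnitRepresentation.restrict_left {F : (Fin (M₁.sum M₂).natRank → α ⊕ β) → Pˣ}
    (hF : (M₁.sum M₂).IsUnitRepresentation F) {I₂ : Fin M₂.natRank → β}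
    (h₂ : M₂.IsOrderedBasis I₂) (t : Pˣ) :
    M₁.IsUnitRepresentation (fun I₁ => t * F (concat M₁ M₂ I₁ I₂)) where
  toIsTutteFun := (hF.toIsTutteFun.restrict_left h₂).const_mul t
  null_crossRatio I p q a b c d h := by
    rw [← h.crossRatioFun_concat_left, ← h.swap.crossRatioFun_concat_left]
    exact hF.null_crossRatio _ _ _ _ _ _ _ (h.concat_left h₂)

theorem IsUnitRepresentation.restrict_right {F : (Fin (M₁.sum M₂).natRank → α ⊕ β) → Pˣ}
    (hF : (M₁.sum M₂).IsUnitRepresentation F) {I₁ : Fin M₁.natRank → α}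
    (h₁ : M₁.IsOrderedBasis I₁) (t : Pˣ) :
    M₂.IsUnitRepresentation (fun I₂ => t * F (concat M₁ M₂ I₁ I₂)) where
  toIsTutteFun := (hF.toIsTutteFun.restrict_right h₁).const_mul t
  null_crossRatio I p q a b c d h := by
    rw [← h.crossRatioFun_concat_right, ← h.swap.crossRatioFun_concat_right]
    exact hF.null_crossRatio _ _ _ _ _ _ _ (h.concat_right h₁)

namespace Representation

/-- The direct sum of two representations. -/
noncomputable def sum (Δ₁ : Representation M₁ P) (Δ₂ : Representation M₂ P) :
    Representation (M₁.sum M₂) P :=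
  (Δ₁.isUnitRepresentation_unitFun.sumFun Δ₂.isUnitRepresentation_unitFun).toRepresentation

theorem sum_concat (Δ₁ : Representation M₁ P) (Δ₂ : Representation M₂ P)
    (I₁ : Fin M₁.natRank → α) (I₂ : Fin M₂.natRank → β) :
    (Δ₁.sum Δ₂).toFun (concat M₁ M₂ I₁ I₂) = Δ₁.toFun I₁ * Δ₂.toFun I₂ := by
  rw [sum, IsUnitRepresentation.toRepresentation_toFun]
  by_cases h₁ : M₁.IsOrderedBasis I₁
  · by_cases h₂ : M₂.IsOrderedBasis I₂
    · rw [extendZero_of_isOrderedBasis (isOrderedBasis_concat h₁ h₂),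
        sumFun_concat Δ₁.isTutteFun_unitFun Δ₂.isTutteFun_unitFun h₁ h₂, Units.val_mul,
        coe_unitFun _ h₁, coe_unitFun _ h₂]
    · rw [extendZero_of_not fun h => h₂ (isOrderedBasis_concat_iff.1 h).2, Δ₂.eq_zero_of_not h₂,
        mul_zero]
  · rw [extendZero_of_not fun h => h₁ (isOrderedBasis_concat_iff.1 h).1, Δ₁.eq_zero_of_not h₁,
      zero_mul]

/-- Every representation of a direct sum is the product of two representations. -/
theorem exists_map_concat_eq_mul (Δ : Representation (M₁.sum M₂) P) :
    ∃ (Δ₁ : Representation M₁ P) (Δ₂ : Representation M₂ P), ∀ I₁ I₂,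
      Δ.toFun (concat M₁ M₂ I₁ I₂) = Δ₁.toFun I₁ * Δ₂.toFun I₂ := by
  obtain ⟨B₁, hB₁⟩ := M₁.exists_isOrderedBasis
  obtain ⟨B₂, hB₂⟩ := M₂.exists_isOrderedBasis
  have hΔ := Δ.isUnitRepresentation_unitFun
  -- Restricting to both blocks counts the value at `(B₁, B₂)` twice, so one factor is normalized.
  refine ⟨(hΔ.restrict_left hB₂ 1).toRepresentation,
    (hΔ.restrict_right hB₁ (Δ.unitFun (concat M₁ M₂ B₁ B₂))⁻¹).toRepresentation,
    fun I₁ I₂ => ?_⟩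
  rw [IsUnitRepresentation.toRepresentation_toFun, IsUnitRepresentation.toRepresentation_toFun]
  by_cases h₁ : M₁.IsOrderedBasis I₁
  · by_cases h₂ : M₂.IsOrderedBasis I₂
    · rw [extendZero_of_isOrderedBasis h₁, extendZero_of_isOrderedBasis h₂, one_mul,
        ← Units.val_mul, ← hΔ.map_concat_eq h₁ hB₁ h₂ hB₂,
        Δ.coe_unitFun (isOrderedBasis_concat h₁ h₂)]
    · rw [extendZero_of_not h₂, mul_zero]
      exact Δ.eq_zero_of_not fun h => h₂ (isOrderedBasis_concat_iff.1 h).2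
  · rw [extendZero_of_not h₁, zero_mul]
    exact Δ.eq_zero_of_not fun h => h₁ (isOrderedBasis_concat_iff.1 h).1

/-- Representations of a direct sum are isomorphic if they agree on sorted tuples, up to a constant
factor. -/
theorem isoClass_eq_of_concat {Δ Δ' : Representation (M₁.sum M₂) P} {c : P} (hc : c ≠ 0)
    (h : ∀ I₁ I₂, Δ'.toFun (concat M₁ M₂ I₁ I₂) = c * Δ.toFun (concat M₁ M₂ I₁ I₂)) :
    Δ.isoClass = Δ'.isoClass := by
  refine Quotient.sound ⟨c, hc, fun T => ?_⟩
  by_cases hT : (M₁.sum M₂).IsOrderedBasis T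
  · obtain ⟨I₁, I₂, σ, -, -, rfl⟩ := hT.exists_eq_concat_comp
    rw [Δ.alternating, Δ'.alternating, h, mul_left_comm]
  · rw [Δ.eq_zero_of_not hT, Δ'.eq_zero_of_not hT, mul_zero]

theorem isoClass_eq_iff {M : Matroid α} {Δ Δ' : Representation M P} :
    Δ.isoClass = Δ'.isoClass ↔ ∃ c : P, c ≠ 0 ∧ ∀ I, Δ'.toFun I = c * Δ.toFun I :=
  Quotient.eq

end Representation

/-- The isomorphism class of a direct sum of representations. -/
noncomputable def IsoClass.sum (x : IsoClass M₁ P × IsoClass M₂ P) : IsoClass (M₁.sum M₂) P :=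
  Quotient.map₂ Representation.sum (by
    rintro Δ₁ Δ₁' ⟨c₁, hc₁, h₁⟩ Δ₂ Δ₂' ⟨c₂, hc₂, h₂⟩
    refine Representation.isoClass_eq_iff.1 (Representation.isoClass_eq_of_concat
      (mul_ne_zero hc₁ hc₂) fun I₁ I₂ => ?_)
    rw [Representation.sum_concat, Representation.sum_concat, h₁, h₂, mul_mul_mul_comm]) x.1 x.2

theorem IsoClass.sum_mk (Δ₁ : Representation M₁ P) (Δ₂ : Representation M₂ P) :
    IsoClass.sum (Δ₁.isoClass, Δ₂.isoClass) = (Δ₁.sum Δ₂).isoClass := rfl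

theorem IsoClass.sum_eq_of_concat {Δ : Representation (M₁.sum M₂) P} {Δ₁ : Representation M₁ P}
    {Δ₂ : Representation M₂ P}
    (h : ∀ I₁ I₂, Δ.toFun (concat M₁ M₂ I₁ I₂) = Δ₁.toFun I₁ * Δ₂.toFun I₂) :
    IsoClass.sum (Δ₁.isoClass, Δ₂.isoClass) = Δ.isoClass := by
  refine Representation.isoClass_eq_of_concat one_ne_zero fun I₁ I₂ => ?_
  rw [one_mul, Representation.sum_concat, h]

theorem IsoClass.exists_rep {M : Matroid α} (x : IsoClass M P) :
    ∃ Δ : Representation M P, Δ.isoClass = x := Quotient.exists_rep x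

theorem IsoClass.sum_bijective :
    Function.Bijective (IsoClass.sum : IsoClass M₁ P × IsoClass M₂ P → _) := by
  constructor
  · rintro ⟨x₁, x₂⟩ ⟨x₁', x₂'⟩ h
    obtain ⟨Δ₁, rfl⟩ := x₁.exists_rep
    obtain ⟨Δ₂, rfl⟩ := x₂.exists_rep
    obtain ⟨Δ₁', rfl⟩ := x₁'.exists_rep
    obtain ⟨Δ₂', rfl⟩ := x₂'.exists_rep
    rw [IsoClass.sum_mk, IsoClass.sum_mk, Representation.isoClass_eq_iff] at h
    obtain ⟨c, hc, h⟩ := h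
    obtain ⟨B₁, hB₁⟩ := M₁.exists_isOrderedBasis
    obtain ⟨B₂, hB₂⟩ := M₂.exists_isOrderedBasis
    have key : ∀ I₁ I₂, Δ₁'.toFun I₁ * Δ₂'.toFun I₂ = c * (Δ₁.toFun I₁ * Δ₂.toFun I₂) := by
      intro I₁ I₂
      rw [← Representation.sum_concat, ← Representation.sum_concat, h]
    have n₁ := (Δ₁.ne_zero_iff B₁).2 hB₁
    have n₂ := (Δ₂.ne_zero_iff B₂).2 hB₂
    have n₁' := (Δ₁'.ne_zero_iff B₁).2 hB₁
    have n₂' := (Δ₂'.ne_zero_iff B₂).2 hB₂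
    refine Prod.ext (Representation.isoClass_eq_iff.2
      ⟨c * Δ₂.toFun B₂ / Δ₂'.toFun B₂, div_ne_zero (mul_ne_zero hc n₂) n₂', fun I₁ => ?_⟩)
      (Representation.isoClass_eq_iff.2
      ⟨c * Δ₁.toFun B₁ / Δ₁'.toFun B₁, div_ne_zero (mul_ne_zero hc n₁) n₁', fun I₂ => ?_⟩)
    · rw [div_mul_eq_mul_div, eq_div_iff n₂', key, mul_assoc, mul_comm (Δ₁.toFun I₁)]
    · rw [div_mul_eq_mul_div, eq_div_iff n₁', mul_comm, key, mul_assoc]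
  · intro x
    obtain ⟨Δ, rfl⟩ := x.exists_rep
    obtain ⟨Δ₁, Δ₂, h⟩ := Δ.exists_map_concat_eq_mul
    exact ⟨_, IsoClass.sum_eq_of_concat h⟩

theorem IsoClass.sum_map {Q : Type w} [Pasture Q] (f : Pasture.Hom P Q)
    (x : IsoClass M₁ P × IsoClass M₂ P) :
    IsoClass.sum (x.1.map f, x.2.map f) = (IsoClass.sum x).map f := by
  obtain ⟨x₁, x₂⟩ := x
  obtain ⟨Δ₁, rfl⟩ := x₁.exists_rep
  obtain ⟨Δ₂, rfl⟩ := x₂.exists_rep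
  refine IsoClass.sum_eq_of_concat (Δ := (Δ₁.sum Δ₂).map f) (Δ₁ := Δ₁.map f) (Δ₂ := Δ₂.map f)
    fun I₁ I₂ => ?_
  change f.toMonoidWithZeroHom _ = f.toMonoidWithZeroHom _ * f.toMonoidWithZeroHom _
  rw [Representation.sum_concat, map_mul]

variable (M₁ M₂ P) in
/-- The isomorphism classes of representations of a direct sum are the pairs of isomorphism classes
of representations of the summands. -/
noncomputable def isoClassSumEquiv : IsoClass (M₁.sum M₂) P ≃ IsoClass M₁ P × IsoClass M₂ P :=
  (Equiv.ofBijective _ IsoClass.sum_bijective).symm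

theorem isoClassSumEquiv_eq_iff {x : IsoClass (M₁.sum M₂) P} {y : IsoClass M₁ P × IsoClass M₂ P} :
    isoClassSumEquiv M₁ M₂ P x = y ↔ IsoClass.sum y = x := by
  rw [isoClassSumEquiv, Equiv.symm_apply_eq, eq_comm]
  rfl

theorem isoClassSumEquiv_map {Q : Type w} [Pasture Q] (f : Pasture.Hom P Q)
    (x : IsoClass (M₁.sum M₂) P) :
    isoClassSumEquiv M₁ M₂ Q (x.map f) =
      ((isoClassSumEquiv M₁ M₂ P x).1.map f, (isoClassSumEquiv M₁ M₂ P x).2.map f) := by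
  rw [isoClassSumEquiv_eq_iff, IsoClass.sum_map, isoClassSumEquiv_eq_iff.1 rfl]

end Sum

end Matroid

/-! ### Morphisms from foundations -/

namespace Matroid

open Pasture

variable {α : Type u} {β : Type v}

theorem map_crossRatioFun {G H : Type*} [CommGroup G] [CommGroup H] (g : G →* H) {r : ℕ}
    (f : (Fin r → α) → G) (I : Fin r → α) (p q : Fin r) (a b c d : α) :
    g (crossRatioFun f I p q a b c d) = crossRatioFun (fun I => g (f I)) I p q a b c d := by
  simp only [crossRatioFun, map_div, map_mul]

section

variable {M : Matroid α}

theorem IsTutteFun.lift_crossRatioFun {G : Type w} [CommGroup G] {χ : ℤˣ →* G}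
    {f : (Fin M.natRank → α) → G} (hf : M.IsTutteFun χ f) {I : Fin M.natRank → α}
    {p q : Fin M.natRank} {a b c d : α} (h : M.NonDegenerate I p q a b c d) :
    hf.lift (crossRatioFun (tutteFun M) I p q a b c d) = crossRatioFun f I p q a b c d := by
  rw [map_crossRatioFun]
  refine h.crossRatioFun_eq_of_mul _ 1 id I p q fun x y hxy => ?_
  rw [one_mul]
  exact hf.lift_tutteFun hxy

theorem IsTutteFun.lift_tutteSign {G : Type w} [CommGroup G] {χ : ℤˣ →* G}
    {f : (Fin M.natRank → α) → G} (hf : M.IsTutteFun χ f) (u : ℤˣ) :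
    hf.lift (tutteSign M u) = χ u := by
  rcases Int.units_eq_one_or u with rfl | rfl
  · rw [map_one, map_one, map_one]
  · rw [tutteSign_neg_one, hf.lift_negOne]

theorem tutteDeg_negOne : tutteDeg M (tutteNegOne M) = 1 := freeDeg_negOne M

theorem tutteDeg_tutteFun {I : Fin M.natRank → α} (hI : M.IsOrderedBasis I) :
    tutteDeg M (tutteFun M I) = Multiplicative.ofAdd (1, ∑ i, Finsupp.single (I i) 1) := by
  rw [tutteFun_eq hI]
  exact freeDeg_T I hI

theorem tutteDeg_tutteSign (u : ℤˣ) : tutteDeg M (tutteSign M u) = 1 := by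
  rcases Int.units_eq_one_or u with rfl | rfl
  · rw [map_one, map_one]
  · rw [tutteSign_neg_one, tutteDeg_negOne]

theorem NonDegenerate.crossRatioFun_mem {I : Fin M.natRank → α}
    {p q : Fin M.natRank} {a b c d : α} (h : M.NonDegenerate I p q a b c d) :
    crossRatioFun (tutteFun M) I p q a b c d ∈ innerTutteGroup M := by
  refine MonoidHom.mem_ker.2 ?_
  rw [crossRatioFun, map_div, div_eq_one, map_mul, map_mul, tutteDeg_tutteFun h.ac,
    tutteDeg_tutteFun h.bd, tutteDeg_tutteFun h.ad, tutteDeg_tutteFun h.bc, ← ofAdd_add,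
    ← ofAdd_add, Prod.mk_add_mk, Prod.mk_add_mk, ← Finset.sum_add_distrib,
    ← Finset.sum_add_distrib]
  congr 2
  refine Finset.sum_congr rfl fun i _ => ?_
  rcases eq_or_ne i q with rfl | hq
  · simp only [placeTwo_right, add_comm]
  rcases eq_or_ne i p with rfl | hp
  · simp only [placeTwo_left _ h.ne]
  · simp only [placeTwo_of_ne _ hp hq]

/-- The inclusion of the inner Tutte group into the foundation. -/
def toFoundation (x : innerTutteGroup M) : Foundation M := ((x : innerTutteGroup M) : WithZero _)

theorem toFoundation_negOne : toFoundation (innerNegOne M) = -1 :=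
  (mul_one (toFoundation (innerNegOne M))).symm

theorem null_of_mem_foundationTerms {s : innerTutteGroup M × innerTutteGroup M × innerTutteGroup M}
    (hs : s ∈ foundationTerms M) :
    null (toFoundation s.1) (toFoundation s.2.1) (toFoundation s.2.2) :=
  Or.inr ⟨1, s, hs, by simp only [one_mul]; rfl⟩

/-- A multiplicative map from the foundation preserves null sets if it preserves `-1` and maps the
generating terms to null terms. -/
theorem map_null_of_foundationTerms {Q : Type w} [Pasture Q] (g : Foundation M →*₀ Q)
    (hneg : g (-1) = -1)
    (hg : ∀ s ∈ foundationTerms M, null (g (toFoundation s.1)) (g (toFoundation s.2.1))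
      (g (toFoundation s.2.2))) {x y z : Foundation M} (h : null x y z) :
    null (g x) (g y) (g z) := by
  have key : ∀ p q r : Foundation M, ({x, y, z} : Multiset (Foundation M)) = {p, q, r} →
      ({g x, g y, g z} : Multiset Q) = {g p, g q, g r} := by
    intro p q r h
    simpa using congrArg (Multiset.map g) h
  rcases h with ⟨(a : Foundation M), ha⟩ | ⟨d, s, hs, hx⟩
  · refine null_of_multiset_eq (key a (-a) 0 ha) ?_
    rw [← neg_one_mul, map_mul, hneg, neg_one_mul, map_zero]
    exact null_self_neg _
  · have hmul : ∀ e : innerTutteGroup M,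
        toFoundation (d * e) = toFoundation d * toFoundation e := fun e => rfl
    refine null_of_multiset_eq (key (toFoundation (d * s.1)) (toFoundation (d * s.2.1))
      (toFoundation (d * s.2.2)) hx) ?_
    rw [hmul, hmul, hmul, map_mul, map_mul, map_mul]
    exact null_mul _ _ _ _ (hg s hs)

end

end Matroid

/-! ### The inner Tutte group of a direct sum -/

namespace Matroid

open Pasture

variable {α : Type u} {β : Type v}

section Product

variable {M₁ : Matroid α} {M₂ : Matroid β}

/-- The subgroup `{±(1, 1)}` of the product of the extended Tutte groups. -/
def tutteSignSubgroup (M₁ : Matroid α) (M₂ : Matroid β) :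
    Subgroup (ExtTutteGroup M₁ × ExtTutteGroup M₂) :=
  Subgroup.zpowers (tutteNegOne M₁, tutteNegOne M₂)

/-- The quotient of the product of the extended Tutte groups that identifies the elements `-1`. -/
abbrev TutteProduct (M₁ : Matroid α) (M₂ : Matroid β) : Type max u v :=
  (ExtTutteGroup M₁ × ExtTutteGroup M₂) ⧸ tutteSignSubgroup M₁ M₂

/-- The class of `(x, 1)`. -/
def productInl (M₁ : Matroid α) (M₂ : Matroid β) : ExtTutteGroup M₁ →* TutteProduct M₁ M₂ :=
  (QuotientGroup.mk' _).comp (MonoidHom.inl _ _)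

/-- The class of `(1, x)`. -/
def productInr (M₁ : Matroid α) (M₂ : Matroid β) : ExtTutteGroup M₂ →* TutteProduct M₁ M₂ :=
  (QuotientGroup.mk' _).comp (MonoidHom.inr _ _)

theorem productInl_mul_productInr_eq_one_iff {x₁ : ExtTutteGroup M₁} {x₂ : ExtTutteGroup M₂} :
    productInl M₁ M₂ x₁ * productInr M₁ M₂ x₂ = 1 ↔ (x₁, x₂) ∈ tutteSignSubgroup M₁ M₂ := by
  rw [← QuotientGroup.eq_one_iff]
  have h : ((x₁, x₂) : ExtTutteGroup M₁ × ExtTutteGroup M₂) = (x₁, 1) * (1, x₂) := by simp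
  rw [h]
  rfl

theorem productInl_negOne :
    productInl M₁ M₂ (tutteNegOne M₁) = productInr M₁ M₂ (tutteNegOne M₂) := by
  have h : productInl M₁ M₂ (tutteNegOne M₁) * productInr M₁ M₂ (tutteNegOne M₂) = 1 :=
    productInl_mul_productInr_eq_one_iff.2 (Subgroup.mem_zpowers _)
  have h' : productInr M₁ M₂ (tutteNegOne M₂) * productInr M₁ M₂ (tutteNegOne M₂) = 1 := by
    rw [← map_mul, tutteNegOne_mul_self, map_one]
  exact mul_right_cancel (h.trans h'.symm)

theorem productInr_comp_tutteSign :
    (productInr M₁ M₂).comp (tutteSign M₂) = (productInl M₁ M₂).comp (tutteSign M₁) := by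
  ext u
  rcases Int.units_eq_one_or u with rfl | rfl
  · rw [map_one, map_one]
  · rw [MonoidHom.comp_apply, MonoidHom.comp_apply, tutteSign_neg_one, tutteSign_neg_one,
      productInl_negOne]

theorem isTutteFun_productInl : M₁.IsTutteFun ((productInl M₁ M₂).comp (tutteSign M₁))
    (fun I => productInl M₁ M₂ (tutteFun M₁ I)) :=
  (isTutteFun_tutteFun M₁).map _

theorem isTutteFun_productInr : M₂.IsTutteFun ((productInl M₁ M₂).comp (tutteSign M₁))
    (fun I => productInr M₁ M₂ (tutteFun M₂ I)) := by
  rw [← productInr_comp_tutteSign]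
  exact (isTutteFun_tutteFun M₂).map _

end Product

section Sum

variable {M₁ : Matroid α} {M₂ : Matroid β} [M₁.Finite] [M₂.Finite]
  {B₁ : Fin M₁.natRank → α} {B₂ : Fin M₂.natRank → β}

/-- The homomorphism `T_I ↦ T_{(I, B₂)} / T_{(B₁, B₂)}` of extended Tutte groups. -/
noncomputable def tutteInl (B₁ : Fin M₁.natRank → α) (hB₂ : M₂.IsOrderedBasis B₂) :
    ExtTutteGroup M₁ →* ExtTutteGroup (M₁.sum M₂) :=
  (((isTutteFun_tutteFun (M₁.sum M₂)).restrict_left hB₂).const_mul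
    (tutteFun (M₁.sum M₂) (concat M₁ M₂ B₁ B₂))⁻¹).lift

/-- The homomorphism `T_I ↦ T_{(B₁, I)} / T_{(B₁, B₂)}` of extended Tutte groups. -/
noncomputable def tutteInr (hB₁ : M₁.IsOrderedBasis B₁) (B₂ : Fin M₂.natRank → β) :
    ExtTutteGroup M₂ →* ExtTutteGroup (M₁.sum M₂) :=
  (((isTutteFun_tutteFun (M₁.sum M₂)).restrict_right hB₁).const_mul
    (tutteFun (M₁.sum M₂) (concat M₁ M₂ B₁ B₂))⁻¹).lift

theorem tutteInl_tutteFun (hB₂ : M₂.IsOrderedBasis B₂) {I : Fin M₁.natRank → α}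
    (hI : M₁.IsOrderedBasis I) : tutteInl B₁ hB₂ (tutteFun M₁ I) =
      (tutteFun (M₁.sum M₂) (concat M₁ M₂ B₁ B₂))⁻¹ *
        tutteFun (M₁.sum M₂) (concat M₁ M₂ I B₂) :=
  IsTutteFun.lift_tutteFun _ hI

theorem tutteInr_tutteFun (hB₁ : M₁.IsOrderedBasis B₁) {I : Fin M₂.natRank → β}
    (hI : M₂.IsOrderedBasis I) : tutteInr hB₁ B₂ (tutteFun M₂ I) =
      (tutteFun (M₁.sum M₂) (concat M₁ M₂ B₁ B₂))⁻¹ *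
        tutteFun (M₁.sum M₂) (concat M₁ M₂ B₁ I) :=
  IsTutteFun.lift_tutteFun _ hI

theorem tutteInl_tutteSign (hB₂ : M₂.IsOrderedBasis B₂) (u : ℤˣ) :
    tutteInl B₁ hB₂ (tutteSign M₁ u) = tutteSign (M₁.sum M₂) u :=
  IsTutteFun.lift_tutteSign _ u

theorem tutteInr_tutteSign (hB₁ : M₁.IsOrderedBasis B₁) (u : ℤˣ) :
    tutteInr hB₁ B₂ (tutteSign M₂ u) = tutteSign (M₁.sum M₂) u :=
  IsTutteFun.lift_tutteSign _ u

theorem tutteInl_negOne (hB₂ : M₂.IsOrderedBasis B₂) :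
    tutteInl B₁ hB₂ (tutteNegOne M₁) = tutteNegOne (M₁.sum M₂) := by
  rw [← tutteSign_neg_one, tutteInl_tutteSign, tutteSign_neg_one]

theorem tutteInr_negOne (hB₁ : M₁.IsOrderedBasis B₁) :
    tutteInr hB₁ B₂ (tutteNegOne M₂) = tutteNegOne (M₁.sum M₂) := by
  rw [← tutteSign_neg_one, tutteInr_tutteSign, tutteSign_neg_one]

theorem tutteDeg_tutteFun_concat {I₁ : Fin M₁.natRank → α} {I₂ : Fin M₂.natRank → β}
    (h₁ : M₁.IsOrderedBasis I₁) (h₂ : M₂.IsOrderedBasis I₂) :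
    tutteDeg (M₁.sum M₂) (tutteFun (M₁.sum M₂) (concat M₁ M₂ I₁ I₂)) =
      Multiplicative.ofAdd (1, Finsupp.mapDomain Sum.inl (∑ i, Finsupp.single (I₁ i) 1) +
        Finsupp.mapDomain Sum.inr (∑ i, Finsupp.single (I₂ i) 1)) := by
  rw [tutteDeg_tutteFun (isOrderedBasis_concat h₁ h₂), ← (sumPos M₁ M₂).sum_comp,
    Fintype.sum_sum_type]
  simp only [concat_sumPos_inl, concat_sumPos_inr, Finsupp.mapDomain_finsetSum,
    Finsupp.mapDomain_single]

/-- Up to a power of `T_{(B₁, B₂)}`, every element of the extended Tutte group of a direct sum comes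
from the summands, and the degree and multi-degree are compatible with this decomposition. -/
theorem exists_tutteInl_mul_tutteInr (hB₁ : M₁.IsOrderedBasis B₁) (hB₂ : M₂.IsOrderedBasis B₂)
    (x : ExtTutteGroup (M₁.sum M₂)) :
    ∃ (x₁ : ExtTutteGroup M₁) (x₂ : ExtTutteGroup M₂) (d : ℤ) (m₁ : α →₀ ℤ) (m₂ : β →₀ ℤ),
      tutteDeg M₁ x₁ = Multiplicative.ofAdd (d, m₁) ∧
      tutteDeg M₂ x₂ = Multiplicative.ofAdd (d, m₂) ∧
      tutteDeg (M₁.sum M₂) x =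
        Multiplicative.ofAdd (d, Finsupp.mapDomain Sum.inl m₁ + Finsupp.mapDomain Sum.inr m₂) ∧
      x = tutteFun (M₁.sum M₂) (concat M₁ M₂ B₁ B₂) ^ d *
        (tutteInl B₁ hB₂ x₁ * tutteInr hB₁ B₂ x₂) := by
  induction x using extTutteGroup_induction with
  | one => exact ⟨1, 1, 0, 0, 0, map_one _, map_one _, by simp; rfl, by simp⟩
  | negOne =>
    refine ⟨tutteNegOne M₁, 1, 0, 0, 0, tutteDeg_negOne, map_one _, ?_, ?_⟩
    · rw [tutteDeg_negOne]
      simp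
      rfl
    · rw [tutteInl_negOne, map_one, zpow_zero, one_mul, mul_one]
  | T I hI =>
    obtain ⟨I₁, I₂, σ, h₁, h₂, rfl⟩ := hI.exists_eq_concat_comp
    have hT := isTutteFun_tutteFun (M₁.sum M₂)
    rw [← tutteFun_eq, hT.map_comp _ _ (isOrderedBasis_concat h₁ h₂)]
    refine ⟨tutteSign M₁ (Equiv.Perm.sign σ) * tutteFun M₁ I₁, tutteFun M₂ I₂, 1,
      ∑ i, Finsupp.single (I₁ i) 1, ∑ i, Finsupp.single (I₂ i) 1, ?_, tutteDeg_tutteFun h₂, ?_, ?_⟩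
    · rw [map_mul, tutteDeg_tutteSign, one_mul, tutteDeg_tutteFun h₁]
    · rw [map_mul, tutteDeg_tutteSign, one_mul, tutteDeg_tutteFun_concat h₁ h₂]
    · rw [map_mul, tutteInl_tutteSign, tutteInl_tutteFun hB₂ h₁, tutteInr_tutteFun hB₁ h₂,
        hT.map_concat_eq h₁ hB₁ h₂ hB₂, zpow_one]
      generalize tutteFun (M₁.sum M₂) (concat M₁ M₂ B₁ B₂) = c
      generalize tutteSign (M₁.sum M₂) (Equiv.Perm.sign σ) = s
      rw [mul_assoc s, mul_left_comm c, mul_assoc c⁻¹, mul_inv_cancel_left]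
  | mul x y hx hy =>
    obtain ⟨x₁, x₂, d, m₁, m₂, h1, h2, h3, h4⟩ := hx
    obtain ⟨y₁, y₂, e, n₁, n₂, k1, k2, k3, k4⟩ := hy
    refine ⟨x₁ * y₁, x₂ * y₂, d + e, m₁ + n₁, m₂ + n₂, ?_, ?_, ?_, ?_⟩
    · rw [map_mul, h1, k1]
      rfl
    · rw [map_mul, h2, k2]
      rfl
    · rw [map_mul, h3, k3, ← ofAdd_add, Prod.mk_add_mk, Finsupp.mapDomain_add,
        Finsupp.mapDomain_add, add_add_add_comm]
    · rw [map_mul, map_mul, zpow_add, mul_mul_mul_comm (tutteInl B₁ hB₂ x₁), mul_mul_mul_comm,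
        ← h4, ← k4]
  | inv x hx =>
    obtain ⟨x₁, x₂, d, m₁, m₂, h1, h2, h3, h4⟩ := hx
    refine ⟨x₁⁻¹, x₂⁻¹, -d, -m₁, -m₂, ?_, ?_, ?_, ?_⟩
    · rw [map_inv, h1]
      rfl
    · rw [map_inv, h2]
      rfl
    · have hl : ∀ m : α →₀ ℤ, Finsupp.mapDomain (Sum.inl : α → α ⊕ β) (-m) =
          -Finsupp.mapDomain Sum.inl m := fun m =>
        map_neg (Finsupp.mapDomain.addMonoidHom (M := ℤ) (Sum.inl : α → α ⊕ β)) m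
      have hr : ∀ m : β →₀ ℤ, Finsupp.mapDomain (Sum.inr : β → α ⊕ β) (-m) =
          -Finsupp.mapDomain Sum.inr m := fun m =>
        map_neg (Finsupp.mapDomain.addMonoidHom (M := ℤ) (Sum.inr : β → α ⊕ β)) m
      rw [map_inv, h3, ← ofAdd_neg, hl, hr, ← neg_add, Prod.neg_mk]
    · rw [map_inv, map_inv, zpow_neg, ← mul_inv, ← mul_inv, ← h4]

/-- The inner Tutte group of a direct sum is generated by those of the summands. -/
theorem exists_mem_innerTutteGroup (hB₁ : M₁.IsOrderedBasis B₁) (hB₂ : M₂.IsOrderedBasis B₂)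
    {x : ExtTutteGroup (M₁.sum M₂)} (hx : x ∈ innerTutteGroup (M₁.sum M₂)) :
    ∃ x₁ ∈ innerTutteGroup M₁, ∃ x₂ ∈ innerTutteGroup M₂,
      tutteInl B₁ hB₂ x₁ * tutteInr hB₁ B₂ x₂ = x := by
  -- An element of degree and multi-degree zero needs no power of `T_{(B₁, B₂)}`, and the
  -- multi-degrees on the two blocks vanish separately.
  obtain ⟨x₁, x₂, d, m₁, m₂, h1, h2, h3, h4⟩ := exists_tutteInl_mul_tutteInr hB₁ hB₂ x
  rw [MonoidHom.mem_ker.1 hx] at h3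
  have h3' := congrArg Multiplicative.toAdd h3
  obtain ⟨h0, hm⟩ := Prod.mk.inj h3'
  have hm₁ : m₁ = 0 := by
    ext a
    have := DFunLike.congr_fun hm (Sum.inl a)
    rw [Finsupp.add_apply, Finsupp.mapDomain_apply Sum.inl_injective,
      Finsupp.mapDomain_of_notMem_range _ _ (by simp), add_zero] at this
    exact this.symm
  have hm₂ : m₂ = 0 := by
    ext a
    have := DFunLike.congr_fun hm (Sum.inr a)
    rw [Finsupp.add_apply, Finsupp.mapDomain_apply Sum.inr_injective,
      Finsupp.mapDomain_of_notMem_range _ _ (by simp), zero_add] at this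
    exact this.symm
  have hd : d = 0 := h0.symm
  subst hd hm₁ hm₂
  refine ⟨x₁, MonoidHom.mem_ker.2 h1, x₂, MonoidHom.mem_ker.2 h2, ?_⟩
  rw [h4, zpow_zero, one_mul]

/-- The effect of `tutteInl` and `tutteInr` on the degree and the multi-degree: the degree of
`T_{(I, B₂)} / T_{(B₁, B₂)}` is `0`, and its multi-degree is that of `I` minus that of `B₁`. -/
noncomputable def degShift {γ δ : Type*} (e : γ → δ) {r : ℕ} (B : Fin r → γ) :
    ℤ × (γ →₀ ℤ) →+ ℤ × (δ →₀ ℤ) :=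
  AddMonoidHom.prod 0 ((Finsupp.mapDomain.addMonoidHom e).comp
    (AddMonoidHom.snd ℤ (γ →₀ ℤ) - (zmultiplesHom _ (∑ i, Finsupp.single (B i) (1 : ℤ))).comp
      (AddMonoidHom.fst ℤ (γ →₀ ℤ))))

theorem tutteDeg_tutteInl (hB₁ : M₁.IsOrderedBasis B₁) (hB₂ : M₂.IsOrderedBasis B₂)
    (x : ExtTutteGroup M₁) : tutteDeg (M₁.sum M₂) (tutteInl B₁ hB₂ x) =
      (degShift Sum.inl B₁).toMultiplicative (tutteDeg M₁ x) := by
  refine DFunLike.congr_fun (f := (tutteDeg (M₁.sum M₂)).comp (tutteInl B₁ hB₂))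
    (g := (degShift Sum.inl B₁).toMultiplicative.comp (tutteDeg M₁))
    (extTutteGroup_hom_ext ?_ fun I hI => ?_) x
  · simp only [MonoidHom.comp_apply]
    rw [tutteInl_negOne, tutteDeg_negOne, tutteDeg_negOne, map_one]
  · simp only [MonoidHom.comp_apply]
    rw [← tutteFun_eq, tutteInl_tutteFun hB₂ hI, tutteDeg_tutteFun hI, map_mul, map_inv,
      tutteDeg_tutteFun_concat hI hB₂, tutteDeg_tutteFun_concat hB₁ hB₂, ← ofAdd_neg, ← ofAdd_add]
    change _ = Multiplicative.ofAdd (degShift Sum.inl B₁ _)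
    congr 1
    ext1
    · simp [degShift]
    · simp only [degShift, AddMonoidHom.prod_apply, AddMonoidHom.comp_apply, Prod.snd_add,
        Prod.snd_neg, AddMonoidHom.sub_apply, AddMonoidHom.coe_snd, AddMonoidHom.coe_fst,
        zmultiplesHom_apply, toAdd_ofAdd, one_smul, map_sub, Finsupp.mapDomain.addMonoidHom_apply]
      abel

theorem tutteDeg_tutteInr (hB₁ : M₁.IsOrderedBasis B₁) (hB₂ : M₂.IsOrderedBasis B₂)
    (x : ExtTutteGroup M₂) : tutteDeg (M₁.sum M₂) (tutteInr hB₁ B₂ x) =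
      (degShift Sum.inr B₂).toMultiplicative (tutteDeg M₂ x) := by
  refine DFunLike.congr_fun (f := (tutteDeg (M₁.sum M₂)).comp (tutteInr hB₁ B₂))
    (g := (degShift Sum.inr B₂).toMultiplicative.comp (tutteDeg M₂))
    (extTutteGroup_hom_ext ?_ fun I hI => ?_) x
  · simp only [MonoidHom.comp_apply]
    rw [tutteInr_negOne, tutteDeg_negOne, tutteDeg_negOne, map_one]
  · simp only [MonoidHom.comp_apply]
    rw [← tutteFun_eq, tutteInr_tutteFun hB₁ hI, tutteDeg_tutteFun hI, map_mul, map_inv,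
      tutteDeg_tutteFun_concat hB₁ hI, tutteDeg_tutteFun_concat hB₁ hB₂, ← ofAdd_neg, ← ofAdd_add]
    change _ = Multiplicative.ofAdd (degShift Sum.inr B₂ _)
    congr 1
    ext1
    · simp [degShift]
    · simp only [degShift, AddMonoidHom.prod_apply, AddMonoidHom.comp_apply, Prod.snd_add,
        Prod.snd_neg, AddMonoidHom.sub_apply, AddMonoidHom.coe_snd, AddMonoidHom.coe_fst,
        zmultiplesHom_apply, toAdd_ofAdd, one_smul, map_sub, Finsupp.mapDomain.addMonoidHom_apply]
      abel

/-- The homomorphism of inner Tutte groups induced by `tutteInl`. -/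
noncomputable def innerInl (hB₁ : M₁.IsOrderedBasis B₁) (hB₂ : M₂.IsOrderedBasis B₂) :
    innerTutteGroup M₁ →* innerTutteGroup (M₁.sum M₂) :=
  ((tutteInl B₁ hB₂).comp (innerTutteGroup M₁).subtype).codRestrict _ fun x => by
    refine MonoidHom.mem_ker.2 ?_
    rw [MonoidHom.comp_apply, tutteDeg_tutteInl hB₁, Subgroup.subtype_apply,
      MonoidHom.mem_ker.1 x.2, map_one]

/-- The homomorphism of inner Tutte groups induced by `tutteInr`. -/
noncomputable def innerInr (hB₁ : M₁.IsOrderedBasis B₁) (hB₂ : M₂.IsOrderedBasis B₂) :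
    innerTutteGroup M₂ →* innerTutteGroup (M₁.sum M₂) :=
  ((tutteInr hB₁ B₂).comp (innerTutteGroup M₂).subtype).codRestrict _ fun x => by
    refine MonoidHom.mem_ker.2 ?_
    rw [MonoidHom.comp_apply, tutteDeg_tutteInr hB₁ hB₂, Subgroup.subtype_apply,
      MonoidHom.mem_ker.1 x.2, map_one]

theorem innerInl_negOne (hB₁ : M₁.IsOrderedBasis B₁) (hB₂ : M₂.IsOrderedBasis B₂) :
    innerInl hB₁ hB₂ (innerNegOne M₁) = innerNegOne (M₁.sum M₂) :=
  Subtype.ext (tutteInl_negOne hB₂)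

theorem innerInr_negOne (hB₁ : M₁.IsOrderedBasis B₁) (hB₂ : M₂.IsOrderedBasis B₂) :
    innerInr hB₁ hB₂ (innerNegOne M₂) = innerNegOne (M₁.sum M₂) :=
  Subtype.ext (tutteInr_negOne hB₁)

variable (M₁ M₂) in
/-- The homomorphism from the extended Tutte group of a direct sum with
`T_{(I₁, I₂)} ↦ (T_{I₁}, T_{I₂})`. -/
noncomputable def tutteSplit : ExtTutteGroup (M₁.sum M₂) →* TutteProduct M₁ M₂ :=
  (isTutteFun_productInl.sumFun isTutteFun_productInr).lift

theorem tutteSplit_tutteFun_concat {I₁ : Fin M₁.natRank → α} {I₂ : Fin M₂.natRank → β}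
    (h₁ : M₁.IsOrderedBasis I₁) (h₂ : M₂.IsOrderedBasis I₂) :
    tutteSplit M₁ M₂ (tutteFun (M₁.sum M₂) (concat M₁ M₂ I₁ I₂)) =
      productInl M₁ M₂ (tutteFun M₁ I₁) * productInr M₁ M₂ (tutteFun M₂ I₂) := by
  rw [tutteSplit, IsTutteFun.lift_tutteFun _ (isOrderedBasis_concat h₁ h₂)]
  exact sumFun_concat isTutteFun_productInl isTutteFun_productInr h₁ h₂

theorem tutteSplit_negOne : tutteSplit M₁ M₂ (tutteNegOne (M₁.sum M₂)) =
    productInl M₁ M₂ (tutteNegOne M₁) := by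
  rw [tutteSplit, IsTutteFun.lift_negOne, MonoidHom.comp_apply, tutteSign_neg_one]

/-- The degree homomorphism on the extended Tutte group. -/
noncomputable def tutteDegree (M : Matroid α) : ExtTutteGroup M →* Multiplicative ℤ :=
  (AddMonoidHom.fst ℤ (α →₀ ℤ)).toMultiplicative.comp (tutteDeg M)

theorem tutteDegree_eq_one {M : Matroid α} {x : ExtTutteGroup M} (hx : x ∈ innerTutteGroup M) :
    tutteDegree M x = 1 := by
  rw [tutteDegree, MonoidHom.comp_apply, MonoidHom.mem_ker.1 hx, map_one]

theorem tutteDegree_tutteFun {M : Matroid α} {I : Fin M.natRank → α} (hI : M.IsOrderedBasis I) :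
    tutteDegree M (tutteFun M I) = Multiplicative.ofAdd 1 := by
  rw [tutteDegree, MonoidHom.comp_apply, tutteDeg_tutteFun hI]
  rfl

theorem tutteDegree_negOne {M : Matroid α} : tutteDegree M (tutteNegOne M) = 1 := by
  rw [tutteDegree, MonoidHom.comp_apply, tutteDeg_negOne, map_one]

theorem tutteSplit_tutteInl (hB₁ : M₁.IsOrderedBasis B₁) (hB₂ : M₂.IsOrderedBasis B₂)
    (x : ExtTutteGroup M₁) : tutteSplit M₁ M₂ (tutteInl B₁ hB₂ x) =
      productInl M₁ M₂ (x * zpowersHom _ (tutteFun M₁ B₁)⁻¹ (tutteDegree M₁ x)) := by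
  refine DFunLike.congr_fun (f := (tutteSplit M₁ M₂).comp (tutteInl B₁ hB₂))
    (g := (productInl M₁ M₂).comp
      (MonoidHom.id _ * (zpowersHom _ (tutteFun M₁ B₁)⁻¹).comp (tutteDegree M₁)))
    (extTutteGroup_hom_ext ?_ fun I hI => ?_) x
  · simp only [MonoidHom.comp_apply, MonoidHom.mul_apply, MonoidHom.id_apply]
    rw [tutteInl_negOne, tutteSplit_negOne, tutteDegree_negOne, map_one, mul_one]
  · simp only [MonoidHom.comp_apply, MonoidHom.mul_apply, MonoidHom.id_apply]
    rw [← tutteFun_eq, tutteInl_tutteFun hB₂ hI, tutteDegree_tutteFun hI, map_mul, map_inv,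
      tutteSplit_tutteFun_concat hI hB₂, tutteSplit_tutteFun_concat hB₁ hB₂, zpowersHom_apply,
      toAdd_ofAdd, zpow_one, map_mul, map_inv, mul_inv, mul_mul_mul_comm, inv_mul_cancel, mul_one,
      mul_comm]

theorem tutteSplit_tutteInr (hB₁ : M₁.IsOrderedBasis B₁) (hB₂ : M₂.IsOrderedBasis B₂)
    (x : ExtTutteGroup M₂) : tutteSplit M₁ M₂ (tutteInr hB₁ B₂ x) =
      productInr M₁ M₂ (x * zpowersHom _ (tutteFun M₂ B₂)⁻¹ (tutteDegree M₂ x)) := by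
  refine DFunLike.congr_fun (f := (tutteSplit M₁ M₂).comp (tutteInr hB₁ B₂))
    (g := (productInr M₁ M₂).comp
      (MonoidHom.id _ * (zpowersHom _ (tutteFun M₂ B₂)⁻¹).comp (tutteDegree M₂)))
    (extTutteGroup_hom_ext ?_ fun I hI => ?_) x
  · simp only [MonoidHom.comp_apply, MonoidHom.mul_apply, MonoidHom.id_apply]
    rw [tutteInr_negOne, tutteSplit_negOne, productInl_negOne, tutteDegree_negOne, map_one,
      mul_one]
  · simp only [MonoidHom.comp_apply, MonoidHom.mul_apply, MonoidHom.id_apply]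
    rw [← tutteFun_eq, tutteInr_tutteFun hB₁ hI, tutteDegree_tutteFun hI, map_mul, map_inv,
      tutteSplit_tutteFun_concat hB₁ hI, tutteSplit_tutteFun_concat hB₁ hB₂, zpowersHom_apply,
      toAdd_ofAdd, zpow_one, map_mul, map_inv, mul_inv, mul_mul_mul_comm, inv_mul_cancel, one_mul,
      mul_comm]

theorem innerInl_mul_innerInr_eq_one_iff (hB₁ : M₁.IsOrderedBasis B₁) (hB₂ : M₂.IsOrderedBasis B₂)
    (x₁ : innerTutteGroup M₁) (x₂ : innerTutteGroup M₂) :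
    innerInl hB₁ hB₂ x₁ * innerInr hB₁ hB₂ x₂ = 1 ↔
      (x₁, x₂) ∈ Subgroup.zpowers (innerNegOne M₁, innerNegOne M₂) := by
  constructor
  · intro h
    have h' : tutteInl B₁ hB₂ x₁ * tutteInr hB₁ B₂ x₂ = 1 := congrArg Subtype.val h
    -- On elements of degree zero, `tutteSplit` is a left inverse.
    have h'' := congrArg (tutteSplit M₁ M₂) h'
    rw [map_mul, map_one, tutteSplit_tutteInl hB₁ hB₂, tutteSplit_tutteInr hB₁ hB₂,
      tutteDegree_eq_one x₁.2, tutteDegree_eq_one x₂.2, map_one, map_one, mul_one, mul_one,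
      productInl_mul_productInr_eq_one_iff] at h''
    obtain ⟨n, hn⟩ := Subgroup.mem_zpowers_iff.1 h''
    refine Subgroup.mem_zpowers_iff.2 ⟨n, Prod.ext (Subtype.ext ?_) (Subtype.ext ?_)⟩
    · exact congrArg Prod.fst hn
    · exact congrArg Prod.snd hn
  · intro h
    obtain ⟨n, hn⟩ := Subgroup.mem_zpowers_iff.1 h
    have h₁ : innerNegOne M₁ ^ n = x₁ := congrArg Prod.fst hn
    have h₂ : innerNegOne M₂ ^ n = x₂ := congrArg Prod.snd hn
    rw [← h₁, ← h₂, map_zpow, map_zpow, innerInl_negOne, innerInr_negOne, ← mul_zpow, innerNegOne_mul_self,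
      one_zpow]

end Sum

end Matroid

/-! ### The foundation of a direct sum -/

namespace Matroid

open Pasture

variable {α : Type u} {β : Type v}

section

variable (M : Matroid α)

/-- The units of the foundation are the elements of the inner Tutte group. -/
noncomputable def foundationUnits : (Foundation M)ˣ ≃* innerTutteGroup M :=
  WithZero.unitsWithZeroEquiv

variable {M}

theorem toFoundation_foundationUnits (x : (Foundation M)ˣ) :
    toFoundation (foundationUnits M x) = x :=
  WithZero.coe_unzero _

theorem foundationUnits_neg_one : foundationUnits M (-1) = innerNegOne M := by
  have h : toFoundation (foundationUnits M (-1)) = toFoundation (innerNegOne M) := by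
    rw [toFoundation_foundationUnits, toFoundation_negOne, Units.val_neg, Units.val_one]
  exact WithZero.coe_injective h

/-- The extension by zero of a homomorphism of inner Tutte groups to the foundations. -/
noncomputable def foundationMap {N : Matroid β} (f : innerTutteGroup M →* innerTutteGroup N) :
    Foundation M →*₀ Foundation N :=
  WithZero.map' f

theorem foundationMap_toFoundation {N : Matroid β} (f : innerTutteGroup M →* innerTutteGroup N)
    (x : innerTutteGroup M) : foundationMap f (toFoundation x) = toFoundation (f x) :=
  WithZero.map'_coe f x

theorem foundationMap_neg_one {N : Matroid β} {f : innerTutteGroup M →* innerTutteGroup N}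
    (hf : f (innerNegOne M) = innerNegOne N) : foundationMap f (-1) = -1 := by
  rw [← toFoundation_negOne, ← toFoundation_negOne, foundationMap_toFoundation, hf]

end

section Sum

variable {M₁ : Matroid α} {M₂ : Matroid β} [M₁.Finite] [M₂.Finite]
  {B₁ : Fin M₁.natRank → α} {B₂ : Fin M₂.natRank → β}

theorem tutteInl_crossRatioFun (hB₂ : M₂.IsOrderedBasis B₂) {I : Fin M₁.natRank → α}
    {p q : Fin M₁.natRank} {a b c d : α} (h : M₁.NonDegenerate I p q a b c d) :
    tutteInl B₁ hB₂ (crossRatioFun (tutteFun M₁) I p q a b c d) =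
      crossRatioFun (fun I => (tutteFun (M₁.sum M₂) (concat M₁ M₂ B₁ B₂))⁻¹ *
        tutteFun (M₁.sum M₂) (concat M₁ M₂ I B₂)) I p q a b c d := by
  rw [tutteInl, IsTutteFun.lift_crossRatioFun _ h]

theorem tutteInr_crossRatioFun (hB₁ : M₁.IsOrderedBasis B₁) {I : Fin M₂.natRank → β}
    {p q : Fin M₂.natRank} {a b c d : β} (h : M₂.NonDegenerate I p q a b c d) :
    tutteInr hB₁ B₂ (crossRatioFun (tutteFun M₂) I p q a b c d) =
      crossRatioFun (fun I => (tutteFun (M₁.sum M₂) (concat M₁ M₂ B₁ B₂))⁻¹ *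
        tutteFun (M₁.sum M₂) (concat M₁ M₂ B₁ I)) I p q a b c d := by
  rw [tutteInr, IsTutteFun.lift_crossRatioFun _ h]

/-- The generating terms of the null set of the foundation of a direct sum are those of the two
summands. -/
theorem mem_foundationTerms_sum_iff (hB₁ : M₁.IsOrderedBasis B₁) (hB₂ : M₂.IsOrderedBasis B₂)
    (s : innerTutteGroup (M₁.sum M₂) × innerTutteGroup (M₁.sum M₂) ×
      innerTutteGroup (M₁.sum M₂)) :
    s ∈ foundationTerms (M₁.sum M₂) ↔
      (∃ t ∈ foundationTerms M₁, s = (innerInl hB₁ hB₂ t.1, innerInl hB₁ hB₂ t.2.1,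
        innerInl hB₁ hB₂ t.2.2)) ∨
      ∃ t ∈ foundationTerms M₂, s = (innerInr hB₁ hB₂ t.1, innerInr hB₁ hB₂ t.2.1,
        innerInr hB₁ hB₂ t.2.2) := by
  have hT := isTutteFun_tutteFun (M₁.sum M₂)
  constructor
  · intro hs
    obtain ⟨I, p, q, a, b, c, d, h, h1, h2, h3⟩ := (mem_foundationTerms_iff _ s).1 hs
    obtain ⟨I', p', q', a', b', c', d', h', e1, e2⟩ | ⟨I', p', q', a', b', c', d', h', e1, e2⟩ :=
      h.exists_crossRatioFun_eq hT
        (f₁ := fun I => (tutteFun (M₁.sum M₂) (concat M₁ M₂ B₁ B₂))⁻¹ *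
          tutteFun (M₁.sum M₂) (concat M₁ M₂ I B₂))
        (f₂ := fun I => (tutteFun (M₁.sum M₂) (concat M₁ M₂ B₁ B₂))⁻¹ *
          tutteFun (M₁.sum M₂) (concat M₁ M₂ B₁ I))
        (tutteFun (M₁.sum M₂) (concat M₁ M₂ B₁ B₂)) fun I₁ I₂ h₁ h₂ => by
          rw [← mul_assoc, mul_inv_cancel_left, hT.map_concat_eq h₁ hB₁ h₂ hB₂]
    · refine Or.inl ⟨(⟨_, h'.crossRatioFun_mem⟩, ⟨_, h'.swap.crossRatioFun_mem⟩, innerNegOne M₁),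
        (mem_foundationTerms_iff _ _).2 ⟨_, _, _, _, _, _, _, h', rfl, rfl, rfl⟩, ?_⟩
      refine Prod.ext (Subtype.ext ?_) (Prod.ext (Subtype.ext ?_) ?_)
      · rw [h1, e1]
        exact (tutteInl_crossRatioFun hB₂ h').symm
      · rw [h2, e2]
        exact (tutteInl_crossRatioFun hB₂ h'.swap).symm
      · rw [h3]
        exact (innerInl_negOne hB₁ hB₂).symm
    · refine Or.inr ⟨(⟨_, h'.crossRatioFun_mem⟩, ⟨_, h'.swap.crossRatioFun_mem⟩, innerNegOne M₂),
        (mem_foundationTerms_iff _ _).2 ⟨_, _, _, _, _, _, _, h', rfl, rfl, rfl⟩, ?_⟩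
      refine Prod.ext (Subtype.ext ?_) (Prod.ext (Subtype.ext ?_) ?_)
      · rw [h1, e1]
        exact (tutteInr_crossRatioFun hB₁ h').symm
      · rw [h2, e2]
        exact (tutteInr_crossRatioFun hB₁ h'.swap).symm
      · rw [h3]
        exact (innerInr_negOne hB₁ hB₂).symm
  · rintro (⟨t, ht, rfl⟩ | ⟨t, ht, rfl⟩)
    · obtain ⟨I, p, q, a, b, c, d, h, h1, h2, h3⟩ := (mem_foundationTerms_iff _ t).1 ht
      refine (mem_foundationTerms_iff _ _).2 ⟨_, _, _, _, _, _, _, h.concat_left hB₂, ?_, ?_, ?_⟩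
      · rw [h.crossRatioFun_concat_left _ _ (tutteFun (M₁.sum M₂) (concat M₁ M₂ B₁ B₂))⁻¹,
          ← tutteInl_crossRatioFun hB₂ h, ← h1]
        rfl
      · rw [h.swap.crossRatioFun_concat_left _ _ (tutteFun (M₁.sum M₂) (concat M₁ M₂ B₁ B₂))⁻¹,
          ← tutteInl_crossRatioFun hB₂ h.swap, ← h2]
        rfl
      · rw [h3, innerInl_negOne]
    · obtain ⟨I, p, q, a, b, c, d, h, h1, h2, h3⟩ := (mem_foundationTerms_iff _ t).1 ht
      refine (mem_foundationTerms_iff _ _).2 ⟨_, _, _, _, _, _, _, h.concat_right hB₁, ?_, ?_, ?_⟩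
      · rw [h.crossRatioFun_concat_right _ _ (tutteFun (M₁.sum M₂) (concat M₁ M₂ B₁ B₂))⁻¹,
          ← tutteInr_crossRatioFun hB₁ h, ← h1]
        rfl
      · rw [h.swap.crossRatioFun_concat_right _ _ (tutteFun (M₁.sum M₂) (concat M₁ M₂ B₁ B₂))⁻¹,
          ← tutteInr_crossRatioFun hB₁ h.swap, ← h2]
        rfl
      · rw [h3, innerInr_negOne]

theorem null_foundationMap_innerInl (hB₁ : M₁.IsOrderedBasis B₁) (hB₂ : M₂.IsOrderedBasis B₂)
    {x y z : Foundation M₁} (h : null x y z) :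
    null (foundationMap (innerInl hB₁ hB₂) x) (foundationMap (innerInl hB₁ hB₂) y)
      (foundationMap (innerInl hB₁ hB₂) z) := by
  refine map_null_of_foundationTerms _ (foundationMap_neg_one (innerInl_negOne hB₁ hB₂))
    (fun s hs => ?_) h
  simp only [foundationMap_toFoundation]
  exact null_of_mem_foundationTerms
    ((mem_foundationTerms_sum_iff hB₁ hB₂ _).2 (Or.inl ⟨s, hs, rfl⟩))

theorem null_foundationMap_innerInr (hB₁ : M₁.IsOrderedBasis B₁) (hB₂ : M₂.IsOrderedBasis B₂)
    {x y z : Foundation M₂} (h : null x y z) :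
    null (foundationMap (innerInr hB₁ hB₂) x) (foundationMap (innerInr hB₁ hB₂) y)
      (foundationMap (innerInr hB₁ hB₂) z) := by
  refine map_null_of_foundationTerms _ (foundationMap_neg_one (innerInr_negOne hB₁ hB₂))
    (fun s hs => ?_) h
  simp only [foundationMap_toFoundation]
  exact null_of_mem_foundationTerms
    ((mem_foundationTerms_sum_iff hB₁ hB₂ _).2 (Or.inr ⟨s, hs, rfl⟩))

/-- The homomorphism from the product of the unit groups of the foundations of two matroids to the
inner Tutte group of the direct sum. -/
noncomputable def unitsProdMap (hB₁ : M₁.IsOrderedBasis B₁) (hB₂ : M₂.IsOrderedBasis B₂) :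
    (Foundation M₁)ˣ × (Foundation M₂)ˣ →* innerTutteGroup (M₁.sum M₂) :=
  ((innerInl hB₁ hB₂).comp (foundationUnits M₁).toMonoidHom).coprod
    ((innerInr hB₁ hB₂).comp (foundationUnits M₂).toMonoidHom)

theorem unitsProdMap_apply (hB₁ : M₁.IsOrderedBasis B₁) (hB₂ : M₂.IsOrderedBasis B₂)
    (x : (Foundation M₁)ˣ × (Foundation M₂)ˣ) : unitsProdMap hB₁ hB₂ x =
      innerInl hB₁ hB₂ (foundationUnits M₁ x.1) * innerInr hB₁ hB₂ (foundationUnits M₂ x.2) :=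
  rfl

theorem unitsProdMap_surjective (hB₁ : M₁.IsOrderedBasis B₁) (hB₂ : M₂.IsOrderedBasis B₂) :
    Function.Surjective (unitsProdMap hB₁ hB₂) := by
  rintro ⟨x, hx⟩
  obtain ⟨x₁, h₁, x₂, h₂, h⟩ := exists_mem_innerTutteGroup hB₁ hB₂ hx
  refine ⟨((foundationUnits M₁).symm ⟨x₁, h₁⟩, (foundationUnits M₂).symm ⟨x₂, h₂⟩), ?_⟩
  rw [unitsProdMap_apply, MulEquiv.apply_symm_apply, MulEquiv.apply_symm_apply]
  exact Subtype.ext h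

theorem ker_unitsProdMap (hB₁ : M₁.IsOrderedBasis B₁) (hB₂ : M₂.IsOrderedBasis B₂) :
    (unitsProdMap hB₁ hB₂).ker = signSubgroup (Foundation M₁) (Foundation M₂) := by
  ext ⟨x₁, x₂⟩
  rw [MonoidHom.mem_ker, unitsProdMap_apply, innerInl_mul_innerInr_eq_one_iff, signSubgroup,
    Subgroup.mem_zpowers_iff, Subgroup.mem_zpowers_iff]
  refine exists_congr fun n => ?_
  rw [← foundationUnits_neg_one, ← foundationUnits_neg_one]
  have e : ((foundationUnits M₁ (-1), foundationUnits M₂ (-1)) :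
      innerTutteGroup M₁ × innerTutteGroup M₂) ^ n =
      (foundationUnits M₁ ((-1) ^ n), foundationUnits M₂ ((-1) ^ n)) := by
    rw [map_zpow, map_zpow]
    rfl
  rw [e, Prod.mk_inj, EmbeddingLike.apply_eq_iff_eq, EmbeddingLike.apply_eq_iff_eq, ← Prod.mk_inj]
  rfl

/-- The isomorphism between the unit group of the tensor product of the foundations of two matroids
and the inner Tutte group of the direct sum. -/
noncomputable def tensorUnitsEquiv (hB₁ : M₁.IsOrderedBasis B₁) (hB₂ : M₂.IsOrderedBasis B₂) :
    ((Foundation M₁)ˣ × (Foundation M₂)ˣ) ⧸ signSubgroup (Foundation M₁) (Foundation M₂) ≃*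
      innerTutteGroup (M₁.sum M₂) :=
  (QuotientGroup.quotientMulEquivOfEq (ker_unitsProdMap hB₁ hB₂).symm).trans
    (QuotientGroup.quotientKerEquivOfSurjective _ (unitsProdMap_surjective hB₁ hB₂))

/-- The multiplicative isomorphism between the tensor product of the foundations of two matroids
and the foundation of the direct sum. -/
noncomputable def tensorFoundationEquiv (hB₁ : M₁.IsOrderedBasis B₁)
    (hB₂ : M₂.IsOrderedBasis B₂) :
    Tensor (Foundation M₁) (Foundation M₂) ≃* Foundation (M₁.sum M₂) :=
  MulEquiv.withZero (tensorUnitsEquiv hB₁ hB₂)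

theorem tensorFoundationEquiv_tmul (hB₁ : M₁.IsOrderedBasis B₁) (hB₂ : M₂.IsOrderedBasis B₂)
    (a : Foundation M₁) (b : Foundation M₂) : tensorFoundationEquiv hB₁ hB₂ (tmul a b) =
      foundationMap (innerInl hB₁ hB₂) a * foundationMap (innerInr hB₁ hB₂) b := by
  by_cases ha : a = 0
  · rw [ha, zero_tmul, map_zero, map_zero, zero_mul]
  by_cases hb : b = 0
  · rw [hb, tmul_zero, map_zero, map_zero, mul_zero]
  lift a to (Foundation M₁)ˣ using isUnit_iff_ne_zero.2 ha
  lift b to (Foundation M₂)ˣ using isUnit_iff_ne_zero.2 hb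
  rw [tmul_units, ← toFoundation_foundationUnits a, ← toFoundation_foundationUnits b,
    foundationMap_toFoundation, foundationMap_toFoundation]
  rfl

theorem tensorFoundationEquiv_symm_innerInl (hB₁ : M₁.IsOrderedBasis B₁)
    (hB₂ : M₂.IsOrderedBasis B₂) (x : innerTutteGroup M₁) :
    (tensorFoundationEquiv hB₁ hB₂).symm (toFoundation (innerInl hB₁ hB₂ x)) =
      tmul (toFoundation x) 1 := by
  rw [MulEquiv.symm_apply_eq, tensorFoundationEquiv_tmul, map_one, mul_one,
    foundationMap_toFoundation]

theorem tensorFoundationEquiv_symm_innerInr (hB₁ : M₁.IsOrderedBasis B₁)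
    (hB₂ : M₂.IsOrderedBasis B₂) (x : innerTutteGroup M₂) :
    (tensorFoundationEquiv hB₁ hB₂).symm (toFoundation (innerInr hB₁ hB₂ x)) =
      tmul 1 (toFoundation x) := by
  rw [MulEquiv.symm_apply_eq, tensorFoundationEquiv_tmul, map_one, one_mul,
    foundationMap_toFoundation]

theorem null_tensorFoundationEquiv (hB₁ : M₁.IsOrderedBasis B₁) (hB₂ : M₂.IsOrderedBasis B₂)
    {x y z : Tensor (Foundation M₁) (Foundation M₂)} (h : null x y z) :
    null (tensorFoundationEquiv hB₁ hB₂ x) (tensorFoundationEquiv hB₁ hB₂ y)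
      (tensorFoundationEquiv hB₁ hB₂ z) := by
  rcases h with ⟨a, b, c, d, h, rfl, rfl, rfl⟩ | ⟨d, a, b, c, h, rfl, rfl, rfl⟩
  · simp only [tensorFoundationEquiv_tmul, mul_comm _ (foundationMap (innerInr hB₁ hB₂) d)]
    exact null_mul _ _ _ _ (null_foundationMap_innerInl hB₁ hB₂ h)
  · simp only [tensorFoundationEquiv_tmul]
    exact null_mul _ _ _ _ (null_foundationMap_innerInr hB₁ hB₂ h)

theorem tmul_neg_one_one {P : Type u} {Q : Type v} [Pasture P] [Pasture Q] :
    tmul (-1 : P) (1 : Q) = -1 := by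
  have h : tmul (1 : P) (1 : Q) = 1 := by
    have := tmul_units (1 : Pˣ) (1 : Qˣ)
    rw [Units.val_one, Units.val_one] at this
    exact this
  rw [← tensorNegOne_mul_tmul, h]
  rfl

theorem null_tensorFoundationEquiv_symm (hB₁ : M₁.IsOrderedBasis B₁)
    (hB₂ : M₂.IsOrderedBasis B₂) {x y z : Foundation (M₁.sum M₂)} (h : null x y z) :
    null ((tensorFoundationEquiv hB₁ hB₂).symm x) ((tensorFoundationEquiv hB₁ hB₂).symm y)
      ((tensorFoundationEquiv hB₁ hB₂).symm z) := by
  let g : Foundation (M₁.sum M₂) →*₀ Tensor (Foundation M₁) (Foundation M₂) :=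
    { (tensorFoundationEquiv hB₁ hB₂).symm.toMonoidHom with
      map_zero' := map_zero (tensorFoundationEquiv hB₁ hB₂).symm }
  refine map_null_of_foundationTerms g ?_ ?_ h
  · change (tensorFoundationEquiv hB₁ hB₂).symm (-1) = -1
    rw [← toFoundation_negOne, ← innerInl_negOne hB₁ hB₂, tensorFoundationEquiv_symm_innerInl,
      toFoundation_negOne, tmul_neg_one_one]
  · intro s hs
    change null ((tensorFoundationEquiv hB₁ hB₂).symm _) ((tensorFoundationEquiv hB₁ hB₂).symm _)
      ((tensorFoundationEquiv hB₁ hB₂).symm _)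
    obtain ⟨t, ht, rfl⟩ | ⟨t, ht, rfl⟩ := (mem_foundationTerms_sum_iff hB₁ hB₂ s).1 hs
    · simp only [tensorFoundationEquiv_symm_innerInl]
      exact Or.inl ⟨_, _, _, 1, null_of_mem_foundationTerms ht, rfl, rfl, rfl⟩
    · simp only [tensorFoundationEquiv_symm_innerInr]
      exact Or.inr ⟨1, _, _, _, null_of_mem_foundationTerms ht, rfl, rfl, rfl⟩

variable (M₁ M₂) in
theorem nonempty_foundation_sum_iso :
    Nonempty (Pasture.Iso (Foundation (M₁.sum M₂))
      (Tensor (Foundation M₁) (Foundation M₂))) := by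
  obtain ⟨B₁, hB₁⟩ := M₁.exists_isOrderedBasis
  obtain ⟨B₂, hB₂⟩ := M₂.exists_isOrderedBasis
  refine ⟨{ (tensorFoundationEquiv hB₁ hB₂).symm with
    map_null_iff := fun a b c => ⟨fun h => ?_, null_tensorFoundationEquiv_symm hB₁ hB₂⟩ }⟩
  simpa using null_tensorFoundationEquiv hB₁ hB₂ h

end Sum

end Matroid

theorem theoremA {α : Type u} {β : Type v} (M₁ : Matroid α) (M₂ : Matroid β)
    [M₁.Finite] [M₂.Finite] :
    Nonempty (Pasture.Iso (Matroid.Foundation (M₁.sum M₂))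
      (Pasture.Tensor (Matroid.Foundation M₁) (Matroid.Foundation M₂))) ∧
    ∃ Φ : ∀ (P : Type w) [Pasture P],
        Matroid.IsoClass (M₁.sum M₂) P ≃ Matroid.IsoClass M₁ P × Matroid.IsoClass M₂ P,
      (∀ (P Q : Type w) [Pasture P] [Pasture Q] (f : Pasture.Hom P Q)
        (x : Matroid.IsoClass (M₁.sum M₂) P),
        Φ Q (x.map f) = ((Φ P x).1.map f, (Φ P x).2.map f)) ∧
      (∀ (P : Type w) [Pasture P] (Δ : Matroid.Representation (M₁.sum M₂) P),
        ∃ (Δ₁ : Matroid.Representation M₁ P) (Δ₂ : Matroid.Representation M₂ P),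
          Φ P Δ.isoClass = (Δ₁.isoClass, Δ₂.isoClass) ∧
          ∀ (I₁ : Fin M₁.natRank → α) (I₂ : Fin M₂.natRank → β),
            Δ.toFun (Matroid.concat M₁ M₂ I₁ I₂) = Δ₁.toFun I₁ * Δ₂.toFun I₂) := by
  refine ⟨Matroid.nonempty_foundation_sum_iso M₁ M₂, Matroid.isoClassSumEquiv M₁ M₂, ?_, ?_⟩
  · intro P Q _ _ f x
    exact Matroid.isoClassSumEquiv_map f x
  · intro P _ Δ
    obtain ⟨Δ₁, Δ₂, h⟩ := Δ.exists_map_concat_eq_mul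
    exact ⟨Δ₁, Δ₂, Matroid.isoClassSumEquiv_eq_iff.2 (Matroid.IsoClass.sum_eq_of_concat h), h⟩
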